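/- **Theorem 7.5.1.** For all positive integers $k\le n$ there is an $\mathsf{LAQCC}$-$\mathsf{LOG}$ circuit on $\mathrm{poly}(n)$ qubits that prepares the Dicke-$(n,k)$ state $$|D^n_k\rangle=\binom{n}{k}^{-1/2}\sum_{x\in\{0,1\}^n,\ |x|=k}|x\rangle .$$ Here $\mathsf{LAQCC}$-$\mathsf{LOG}=\mathsf{LAQCC}(\mathsf{QNC}^0,\mathsf{NC}^1,O(\log n))$: the qubits form a rectangular grid and start in $|0\cdots0\rangle$, and the circuit consists of $O(\log n)$ alternations. Each alternation consists of (i) a conventional Boolean circuit of bounded fan-in (AND, OR, NOT), of depth $O(\log n)$ and size $\mathrm{poly}(n)$, whose input consists of the earlier measurement outcomes; (ii) a quantum circuit of depth $O(1)$ of arbitrary single-qubit gates and CNOT gates between neighboring qubits of the grid, where each gate may be controlled by an output bit of the conventional circuit; (iii) a measurement of a subset of the qubits in the computational basis. The preparation is exact and deterministic: for all measurement outcomes that occur, the final state is, up to a global phase, $|D^n_k\rangle$ on $n$ fixed output qubits with all other qubits in $|0\rangle$. The implied constants and polynomials do not depend on $n$ and $k$. -/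

import Mathlib

/-! ### Conventional (Boolean) circuits of bounded fan-in -/

/-- A gate of fan-in at most two, reading wires labelled by `In`. -/
inductive BoolGate (In : Type) : Type
  | const (b : Bool) : BoolGate In
  | wire (a : In) : BoolGate In
  | not (a : In) : BoolGate In
  | and (a b : In) : BoolGate In
  | or (a b : In) : BoolGate In

namespace BoolGate

def eval {In : Type} (v : In → Bool) : BoolGate In → Bool
  | const b => b
  | wire a => v a
  | not a => !(v a)
  | and a b => v a && v b
  | or a b => v a || v b

end BoolGate

/-- A layered circuit with input wires `In` and output wires `Out`. A layer is a finite family of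
gates, each of which reads wires of the preceding layer (with unrestricted fan-out); `wire` gates
carry values along. At the end the outputs are read off the wires of the last layer. -/
inductive BoolCircuit : Type → Type → Type 1
  | output {In Out : Type} (f : Out → In) : BoolCircuit In Out
  | layer {In Mid Out : Type} [Fintype Mid] (g : Mid → BoolGate In)
      (rest : BoolCircuit Mid Out) : BoolCircuit In Out

namespace BoolCircuit

def eval : {In Out : Type} → BoolCircuit In Out → (In → Bool) → (Out → Bool)
  | _, _, output f, v => fun o => v (f o)
  | _, _, layer g rest, v => rest.eval (fun m => (g m).eval v)

/-- The number of layers. -/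
def depth : {In Out : Type} → BoolCircuit In Out → ℕ
  | _, _, output _ => 0
  | _, _, layer _ rest => rest.depth + 1

/-- The number of gates. -/
def size : {In Out : Type} → BoolCircuit In Out → ℕ
  | _, _, output _ => 0
  | _, _, layer (Mid := Mid) _ rest => Fintype.card Mid + rest.size

end BoolCircuit

/-! ### Quantum states and gates -/

/-- The amplitudes in the computational basis of a (not necessarily normalized) vector in the state
space of the qubits labelled by `V`. -/
abbrev QState (V : Type) : Type := (V → Bool) → ℂ

/-- The state in which all qubits are `0`. -/
noncomputable def zeroState (V : Type) : QState V := by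
  classical exact fun x => if ∀ q, x q = false then 1 else 0

/-- The gate set: arbitrary single-qubit unitaries, and CNOT gates on qubits that are adjacent in
the connectivity graph `G`. -/
inductive QGate {V : Type} (G : SimpleGraph V) : Type
  | single (U : Matrix.unitaryGroup Bool ℂ) (q : V) : QGate G
  | cnot (c t : V) (h : G.Adj c t) : QGate G

namespace QGate

variable {V : Type} [DecidableEq V] {G : SimpleGraph V}

/-- The qubits on which a gate acts. -/
def support : QGate G → Finset V
  | single _ q => {q}
  | cnot c t _ => {c, t}

/-- The action of a gate on states; `cnot c t` maps the basis state `x` to the one in which `x t` is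
replaced by `x t xor x c`. -/
noncomputable def apply : QGate G → QState V → QState V
  | single U q, ψ => fun x => ∑ b : Bool, (U : Matrix Bool Bool ℂ) (x q) b *
      ψ (Function.update x q b)
  | cnot c t _, ψ => fun x => ψ (Function.update x t (xor (x t) (x c)))

end QGate

/-- One time step of a quantum circuit: gates on pairwise disjoint sets of qubits. Each gate is
either always applied (`none`), or applied precisely if one specified conventional control bit,
labelled by an element of `B`, is one. -/
structure QStep {V : Type} [DecidableEq V] (G : SimpleGraph V) (B : Type) : Type where
  gates : List (Option B × QGate G)
  disjoint : gates.Pairwise fun g h => Disjoint g.2.support h.2.support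

/-- The action of a step for given values `y` of the control bits. -/
noncomputable def QStep.apply {V : Type} [DecidableEq V] {G : SimpleGraph V} {B : Type}
    (S : QStep G B) (y : B → Bool) (ψ : QState V) : QState V :=
  S.gates.foldl (fun φ g => if g.1.elim true y then g.2.apply φ else φ) ψ

/-- The unnormalized post-measurement state when the qubits in `M` are measured in the computational
basis and the outcomes are given by `m`. -/
noncomputable def measureBranch {V : Type} (M : Finset V) (m : V → Bool) (ψ : QState V) :
    QState V := by
  classical exact fun x => if ∀ q ∈ M, x q = m q then ψ x else 0

/-! ### Alternating quantum-classical circuits -/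

/-- One alternation: a conventional circuit, then a quantum circuit controlled by its output bits,
then a measurement of a subset of the qubits. The input wire `(j, q)` of the conventional circuit
carries the outcome of the measurement of qubit `q` in the earlier alternation number `j`. -/
structure Alternation {V : Type} [DecidableEq V] (G : SimpleGraph V) : Type 1 where
  Control : Type
  conventional : BoolCircuit (ℕ × V) Control
  quantum : List (QStep G Control)
  measured : Finset V

namespace Alternation

variable {V : Type} [DecidableEq V] {G : SimpleGraph V}

/-- Quantum and measurement part of the alternation, given the record `r` of the earlier measurement
outcomes, in the branch in which the measurement has the outcomes `m`. -/
noncomputable def apply (A : Alternation G) (r : ℕ × V → Bool) (m : V → Bool) (ψ : QState V) :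
    QState V :=
  measureBranch A.measured m
    (A.quantum.foldl (fun φ S => S.apply (A.conventional.eval r) φ) ψ)

/-- The record of measurement outcomes after alternation number `i` with outcomes `m`. Wires of
qubits that were not measured, and of later alternations, carry `false`. -/
def record (A : Alternation G) (i : ℕ) (m : V → Bool) (r : ℕ × V → Bool) : ℕ × V → Bool :=
  fun p => if p.1 = i then decide (p.2 ∈ A.measured) && m p.2 else r p

/-- Run a list of alternations, numbered from `i` on, in the branch in which alternation number `j`
has the measurement outcomes `o j`. -/
noncomputable def run (o : ℕ → V → Bool) :
    List (Alternation G) → ℕ → (ℕ × V → Bool) → QState V → QState V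
  | [], _, _, ψ => ψ
  | A :: As, i, r, ψ => run o As (i + 1) (A.record i (o i) r) (A.apply r (o i) ψ)

end Alternation

/-- The unnormalized final state, starting from the all-zeros state, in the branch given by the
measurement outcomes `o`; its squared norm is the probability of the branch. -/
noncomputable def finalState {V : Type} [DecidableEq V] {G : SimpleGraph V}
    (As : List (Alternation G)) (o : ℕ → V → Bool) : QState V :=
  Alternation.run o As 0 (fun _ => false) (zeroState V)

/-- The state `ψ` on the `n` output qubits at the positions `out`, with all other qubits in `0`. -/
noncomputable def withAncillas {V : Type} {n : ℕ} (out : Fin n ↪ V) (ψ : QState (Fin n)) :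
    QState V := by
  classical exact fun x =>
    if ∀ q, q ∉ Set.range out → x q = false then ψ (fun i => x (out i)) else 0

/-- The alternations deterministically prepare `ψ`: whatever the measurement outcomes, they end in
the pure state `ψ` at fixed output positions, with all other qubits in `0`, up to a scalar (a
global phase times the square root of the probability of these outcomes). -/
def Prepares {V : Type} [DecidableEq V] {G : SimpleGraph V} (As : List (Alternation G)) {n : ℕ}
    (ψ : QState (Fin n)) : Prop :=
  ∃ out : Fin n ↪ V, ∀ o : ℕ → V → Bool, ∃ c : ℂ, ∀ x,
    finalState As o x = c * withAncillas out ψ x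

/-- The rectangular grid, in which every vertex is adjacent to its at most four direct neighbors. -/
abbrev gridGraph (rows cols : ℕ) : SimpleGraph (Fin rows × Fin cols) :=
  SimpleGraph.boxProd (SimpleGraph.pathGraph rows) (SimpleGraph.pathGraph cols)

/-- A local alternating quantum-classical circuit on a rectangular grid of qubits. -/
structure LAQCircuit : Type 1 where
  rows : ℕ
  cols : ℕ
  alternations : List (Alternation (gridGraph rows cols))

/-- The number of qubits of the circuit, ancillas included. -/
def LAQCircuit.numQubits (C : LAQCircuit) : ℕ := C.rows * C.cols

/-- The family `C` of circuits, where `C i` has size parameter `n i`, consists of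
LAQCC(QNC⁰, NC¹, O(log n)) circuits (all bounds depend on the size parameter only). -/
structure IsLAQCCLOG {ι : Type} (n : ι → ℕ) (C : ι → LAQCircuit) : Prop where
  /-- all quantum layers have constant depth -/
  quantum : ∃ a : ℕ, ∀ i, ∀ A ∈ (C i).alternations, A.quantum.length ≤ a
  /-- all conventional layers have logarithmic depth and polynomial size -/
  conventional : ∃ (f : ℕ → ℕ) (p : Polynomial ℕ),
    (fun m => (f m : ℝ)) =O[Filter.atTop] (fun m : ℕ => Real.log m) ∧
    ∀ i, ∀ A ∈ (C i).alternations,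
      A.conventional.depth ≤ f (n i) ∧ A.conventional.size ≤ p.eval (n i)
  /-- there are logarithmically many alternations -/
  alternations : ∃ d : ℕ → ℕ,
    (fun m => (d m : ℝ)) =O[Filter.atTop] (fun m : ℕ => Real.log m) ∧
    ∀ i, (C i).alternations.length ≤ d (n i)

/-- The Dicke-`(n, k)` state: the uniform superposition of the `n`-bit strings of Hamming
weight `k`. -/
noncomputable def dickeState (n k : ℕ) : QState (Fin n) :=
  fun x => if (Finset.univ.filter fun i => x i = true).card = k
    then (((Real.sqrt (n.choose k))⁻¹ : ℝ) : ℂ) else 0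

/-! Choose the string bit by bit: if `s` of the first `i` bits are ones, let the next bit be one
with probability `(k - s) / (n - i)`. These probabilities multiply to `1 / n.choose k` on strings of
weight `k` and to `0` on all others (`prod_coinAmp`). To do this in parallel, a coin is tossed for
every position `i` and every conceivable `s`. The coins define transition matrices over the field
with two elements, from `s` to `s` or `s + 1`; about `log n` doublings of their products give the
number of preceding ones at all positions at once (`segEntry_path`), stored one-hot in `pos`, and
each bit copies the coin that `pos` selects.

All auxiliary qubits must then return to zero. A used coin equals its bit and is erased by it. An
unused coin is reset by the same reflection that tossed it, under the control of `pos`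
(`run_untossLayers`). Finally the path depends only on the coins lying on it (`path_congr`), so the
bits alone determine `pos`, which can be computed again and thereby cancelled (`run_dickeLayers`).

All the maps on basis states used here add quadratic polynomials to qubits that the polynomials do
not read. In the Hadamard basis of the targets such a map is a cubic sign (`run_layers`), and a
cubic sign is a product of phases of parities by eighth roots of unity (`prod_maskPhase`). Phases
commute, so all parities of a layer can be treated simultaneously: `gridGadget` writes each of them
into its own columns of the grid in constant depth. This uses measurements with random outcomes,
whose effect is a bit flip linear in the outcomes (`couple_apply`). Measuring the ancillas in the
Hadamard basis then erases them and leaves a sign that is linear in the data (`restore_apply`). Both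
corrections are parities of outcomes, hence computable in logarithmic depth (`linearCircuit_eval`).
A layer thus costs three alternations, and there are `O(log n)` layers. -/

set_option linter.unusedSectionVars false

/-! ### Products of single-qubit maps -/

section LocalMap

variable {V : Type} [Fintype V] [DecidableEq V]

/-- The tensor product of the single-qubit maps `U q`. -/
def localMap (U : V → Matrix Bool Bool ℂ) (ψ : QState V) : QState V :=
  fun x => ∑ y : V → Bool, (∏ q, U q (x q) (y q)) * ψ y

theorem prod_one_apply (x y : V → Bool) :
    (∏ q, (1 : Matrix Bool Bool ℂ) (x q) (y q)) = if x = y then 1 else 0 := by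
  split_ifs with h
  · subst h; simp
  · obtain ⟨q, hq⟩ := Function.ne_iff.mp h
    exact Finset.prod_eq_zero (Finset.mem_univ q) (by simp [hq])

theorem localMap_one (ψ : QState V) : localMap (fun _ => 1) ψ = ψ := by
  funext x
  simp [localMap, prod_one_apply]

theorem localMap_smul (U : V → Matrix Bool Bool ℂ) (c : ℂ) (ψ : QState V) :
    localMap U (c • ψ) = c • localMap U ψ := by
  funext x
  simp only [localMap, Pi.smul_apply, smul_eq_mul, Finset.mul_sum]
  exact Finset.sum_congr rfl fun y _ => by ring

theorem single_apply_localMap {G : SimpleGraph V} (U : Matrix.unitaryGroup Bool ℂ) (q : V)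
    (W : V → Matrix Bool Bool ℂ) (ψ : QState V) :
    (QGate.single (G := G) U q).apply (localMap W ψ) =
      localMap (Function.update W q ((U : Matrix Bool Bool ℂ) * W q)) ψ := by
  funext x
  simp only [QGate.apply, localMap, Finset.mul_sum]
  rw [Finset.sum_comm]
  refine Finset.sum_congr rfl fun y _ => ?_
  rw [← Finset.mul_prod_erase _ _ (Finset.mem_univ q)]
  have h : ∀ b, (∏ r, W r (Function.update x q b r) (y r)) =
      W q b (y q) * ∏ r ∈ Finset.univ.erase q, W r (x r) (y r) := by
    intro b
    rw [← Finset.mul_prod_erase _ _ (Finset.mem_univ q)]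
    congr 1
    · simp
    · refine Finset.prod_congr rfl fun r hr => ?_
      rw [Function.update_of_ne (Finset.ne_of_mem_erase hr)]
  have h' : (∏ r ∈ Finset.univ.erase q,
      (Function.update W q ((U : Matrix Bool Bool ℂ) * W q)) r (x r) (y r)) =
      ∏ r ∈ Finset.univ.erase q, W r (x r) (y r) := by
    refine Finset.prod_congr rfl fun r hr => ?_
    rw [Function.update_of_ne (Finset.ne_of_mem_erase hr)]
  simp only [h, h', Function.update_self, Matrix.mul_apply, Finset.sum_mul]
  exact Finset.sum_congr rfl fun b _ => by ring

/-- Each gate is absorbed into the tensor factor of its own qubit, which is why `W` has to vary in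
the induction. As the list has no duplicates, every factor is changed at most once. -/
theorem foldl_single {G : SimpleGraph V} (ctl : V → Bool) (U : V → Matrix.unitaryGroup Bool ℂ)
    (ψ : QState V) : ∀ (l : List V), l.Nodup → ∀ W : V → Matrix Bool Bool ℂ,
    l.foldl (fun φ q => if ctl q then (QGate.single (G := G) (U q) q).apply φ else φ)
      (localMap W ψ) =
    localMap (fun q => if q ∈ l ∧ ctl q = true then (U q : Matrix Bool Bool ℂ) * W q else W q) ψ
  | [], _, W => by simp
  | a :: l, hl, W => by
    rw [List.nodup_cons] at hl
    rw [List.foldl_cons]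
    by_cases hc : ctl a = true
    · rw [if_pos hc, single_apply_localMap, foldl_single ctl U ψ l hl.2]
      congr 1
      funext q
      by_cases hq : q = a
      · subst hq; simp [hl.1, hc]
      · simp [hq]
    · rw [if_neg hc, foldl_single ctl U ψ l hl.2]
      congr 1
      funext q
      by_cases hq : q = a
      · subst hq; simp [hc]
      · simp [hq]

/-- One time step applying the single-qubit gate `U q` to each qubit `q`, controlled by `ctl q`. -/
noncomputable def singleStep {G : SimpleGraph V} {B : Type} (ctl : V → Option B)
    (U : V → Matrix.unitaryGroup Bool ℂ) : QStep G B where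
  gates := (Finset.univ : Finset V).toList.map fun q => (ctl q, QGate.single (U q) q)
  disjoint := by
    rw [List.pairwise_map]
    refine (Finset.nodup_toList (Finset.univ : Finset V)).imp fun h => ?_
    simpa [QGate.support] using h

theorem singleStep_apply {G : SimpleGraph V} {B : Type} (ctl : V → Option B)
    (U : V → Matrix.unitaryGroup Bool ℂ) (y : B → Bool) (ψ : QState V) :
    (singleStep (G := G) ctl U).apply y ψ =
      localMap (fun q => if (ctl q).elim true y = true then (U q : Matrix Bool Bool ℂ) else 1)
        ψ := by
  have h := foldl_single (G := G) (fun q => (ctl q).elim true y) U ψ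
    (Finset.univ : Finset V).toList (Finset.nodup_toList _) (fun _ => 1)
  rw [localMap_one] at h
  simpa [QStep.apply, singleStep, List.foldl_map] using h

/-- A product of diagonal maps. -/
theorem localMap_diagonal (d : V → Bool → ℂ) (ψ : QState V) :
    localMap (fun q => Matrix.diagonal (d q)) ψ = fun x => (∏ q, d q (x q)) * ψ x := by
  funext x
  rw [localMap, Finset.sum_eq_single x]
  · simp
  · intro y _ hy
    obtain ⟨q, hq⟩ := Function.ne_iff.mp hy
    rw [Finset.prod_eq_zero (Finset.mem_univ q), zero_mul]
    rw [Matrix.diagonal_apply_ne' _ hq]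
  · simp

/-- The matrix which exchanges the basis states. -/
def notMatrix : Matrix Bool Bool ℂ := Matrix.of fun a b => if a = !b then 1 else 0

theorem notMatrix_mul_self : notMatrix * notMatrix = 1 := by
  ext a b; cases a <;> cases b <;> simp [notMatrix, Matrix.mul_apply]

theorem notMatrix_mem : notMatrix ∈ Matrix.unitaryGroup Bool ℂ := by
  rw [Matrix.mem_unitaryGroup_iff]
  have : star notMatrix = notMatrix := by
    ext a b; cases a <;> cases b <;> simp [notMatrix, Matrix.star_apply]
  rw [this, notMatrix_mul_self]

/-- Bit flips on the qubits in which `b` is one. -/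
theorem localMap_not (b : V → Bool) (ψ : QState V) :
    localMap (fun q => if b q = true then notMatrix else 1) ψ = fun x => ψ (x + b) := by
  funext x
  rw [localMap, Finset.sum_eq_single (x + b)]
  · rw [Finset.prod_eq_one, one_mul]
    intro q _
    rw [Pi.add_apply, Bool.add_eq_xor]
    cases b q <;> cases x q <;> rfl
  · intro y _ hy
    obtain ⟨q, hq⟩ := Function.ne_iff.mp hy
    rw [Finset.prod_eq_zero (Finset.mem_univ q), zero_mul]
    rw [Pi.add_apply, Bool.add_eq_xor] at hq
    cases h : b q <;> cases h' : x q <;> cases h'' : y q <;>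
      simp_all [notMatrix]
  · simp

end LocalMap

/-! ### Signs and the Hadamard gate -/

/-- The sign `(-1) ^ b`. -/
def boolSign (b : Bool) : ℂ := if b = true then -1 else 1

@[simp] theorem boolSign_zero : boolSign 0 = 1 := rfl

@[simp] theorem boolSign_false : boolSign false = 1 := rfl

@[simp] theorem boolSign_true : boolSign true = -1 := rfl

theorem boolSign_add (a b : Bool) : boolSign (a + b) = boolSign a * boolSign b := by
  cases a <;> cases b <;> simp [Bool.add_eq_xor]

theorem boolSign_sum {ι : Type*} (s : Finset ι) (f : ι → Bool) :
    boolSign (∑ i ∈ s, f i) = ∏ i ∈ s, boolSign (f i) := by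
  classical
  induction s using Finset.induction_on with
  | empty => rfl
  | insert a s ha ih => rw [Finset.sum_insert ha, Finset.prod_insert ha, boolSign_add, ih]

theorem boolSign_mul_self (a : Bool) : boolSign a * boolSign a = 1 := by
  cases a <;> simp

/-- The amplitude `1 / √2`. -/
noncomputable def rootHalf : ℂ := ((Real.sqrt 2)⁻¹ : ℝ)

theorem rootHalf_mul_self : rootHalf * rootHalf = 1 / 2 := by
  have h : (Real.sqrt 2)⁻¹ * (Real.sqrt 2)⁻¹ = 1 / 2 := by
    rw [← mul_inv, Real.mul_self_sqrt (by norm_num)]; norm_num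
  rw [rootHalf, ← Complex.ofReal_mul, h]; norm_num

/-- The Hadamard matrix. -/
noncomputable def hadamard : Matrix Bool Bool ℂ :=
  Matrix.of fun a b => rootHalf * boolSign (a * b)

theorem hadamard_apply (a b : Bool) : hadamard a b = rootHalf * boolSign (a * b) := rfl

theorem hadamard_mem : hadamard ∈ Matrix.unitaryGroup Bool ℂ := by
  rw [Matrix.mem_unitaryGroup_iff]
  ext a b
  have h := rootHalf_mul_self
  have h2 : (starRingEnd ℂ) rootHalf = rootHalf := Complex.conj_ofReal _
  cases a <;> cases b <;>
    simp [Matrix.mul_apply, Matrix.star_apply, hadamard_apply, Bool.mul_eq_and, h2, h]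
  all_goals norm_num

/-- The diagonal gate with phase `w` on the basis state one. -/
noncomputable def phaseGate (w : unitary ℂ) : Matrix.unitaryGroup Bool ℂ :=
  ⟨Matrix.diagonal fun b => if b = true then (w : ℂ) else 1, by
    rw [Matrix.mem_unitaryGroup_iff]
    ext a b
    have h := Unitary.mul_star_self_of_mem w.2
    cases a <;> cases b <;> simp [Matrix.mul_apply, Matrix.star_apply, Matrix.diagonal]
    simpa using h⟩

theorem neg_one_mem_unitary : (-1 : ℂ) ∈ unitary ℂ := by
  rw [Unitary.mem_iff]; simp

/-! ### Time steps of CNOT gates -/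

section Cnot

variable {V : Type} [Fintype V] [DecidableEq V] {G : SimpleGraph V}

/-- The conditions under which the CNOT gates with target `q` and control `src q` can be applied
in a single time step. -/
structure IsCnotPattern (G : SimpleGraph V) (src : V → Option V) : Prop where
  adj : ∀ q c, src q = some c → G.Adj c q
  inj : ∀ q r c, src q = some c → src r = some c → q = r
  control : ∀ q c, src q = some c → src c = none

/-- The CNOT gate with target `q` of a pattern, if there is one. -/
def cnotGate? {B : Type} {src : V → Option V} (h : IsCnotPattern G src) (q : V) :
    Option (Option B × QGate G) :=
  match hq : src q with
  | none => none
  | some c => some (none, QGate.cnot c q (h.adj q c hq))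

theorem cnotGate?_of_none {B : Type} {src : V → Option V} (h : IsCnotPattern G src) {q : V}
    (hq : src q = none) : cnotGate? (B := B) h q = none := by
  unfold cnotGate?; split <;> simp_all

theorem cnotGate?_of_some {B : Type} {src : V → Option V} (h : IsCnotPattern G src) {q c : V}
    (hq : src q = some c) :
    cnotGate? (B := B) h q = some (none, QGate.cnot c q (h.adj q c hq)) := by
  unfold cnotGate?; split
  · simp_all
  · next c' hc => obtain rfl : c' = c := by simp_all
                  rfl

/-- The time step of a pattern of CNOT gates. -/
noncomputable def cnotStep {B : Type} {src : V → Option V} (h : IsCnotPattern G src) :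
    QStep G B where
  gates := (Finset.univ : Finset V).toList.filterMap (cnotGate? h)
  disjoint := by
    rw [List.pairwise_filterMap]
    refine (Finset.nodup_toList (Finset.univ : Finset V)).imp ?_
    intro q r hqr g hg g' hg'
    cases hq : src q with
    | none => rw [cnotGate?_of_none h hq] at hg; simp at hg
    | some c =>
      cases hr : src r with
      | none => rw [cnotGate?_of_none h hr] at hg'; simp at hg'
      | some d =>
        rw [cnotGate?_of_some h hq] at hg
        rw [cnotGate?_of_some h hr] at hg'
        obtain rfl := Option.some.inj hg
        obtain rfl := Option.some.inj hg'
        have h1 : c ≠ d := fun e => hqr (h.inj q r c hq (e ▸ hr))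
        have h2 : c ≠ r := fun e => by
          have := h.control q c hq
          rw [e, hr] at this
          simp at this
        have h3 : q ≠ d := fun e => by
          have := h.control r d hr
          rw [← e, hq] at this
          simp at this
        simp [QGate.support, h1, h2, h3, hqr, Finset.disjoint_left]

/-- The action of a pattern of CNOT gates on basis states. -/
def cnotMap (src : V → Option V) (x : V → Bool) : V → Bool :=
  fun q => x q + (src q).elim 0 x

/-- No control qubit is a target, so every gate reads an unchanged value and the gates act as one
simultaneous addition. -/
theorem foldl_cnot {B : Type} {src : V → Option V} (h : IsCnotPattern G src) (y : B → Bool) :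
    ∀ (l : List V), l.Nodup → ∀ ψ : QState V,
    (l.filterMap (cnotGate? h)).foldl
      (fun φ (g : Option B × QGate G) => if g.1.elim true y then g.2.apply φ else φ) ψ =
    fun x => ψ fun q => if q ∈ l then cnotMap src x q else x q
  | [], _, ψ => by simp
  | a :: l, hl, ψ => by
    rw [List.nodup_cons] at hl
    cases ha : src a with
    | none =>
      rw [List.filterMap_cons_none (cnotGate?_of_none h ha), foldl_cnot h y l hl.2]
      funext x
      congr 1
      funext q
      by_cases hq : q = a
      · subst hq; simp [cnotMap, ha]
      · simp [hq]
    | some c =>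
      rw [List.filterMap_cons_some (cnotGate?_of_some h ha), List.foldl_cons,
        foldl_cnot h y l hl.2]
      funext x
      have hc := h.control a c ha
      change ψ (Function.update _ a _) = ψ _
      congr 1
      funext q
      by_cases hq : q = a
      · subst hq
        simp [hl.1, cnotMap, ha, hc, Bool.add_eq_xor]
      · simp [hq]

theorem cnotStep_apply {B : Type} {src : V → Option V} (h : IsCnotPattern G src) (y : B → Bool)
    (ψ : QState V) : (cnotStep h).apply y ψ = fun x => ψ (cnotMap src x) := by
  rw [QStep.apply, cnotStep, foldl_cnot h y _ (Finset.nodup_toList _)]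
  simp

end Cnot

/-! ### Conventional circuits for linear maps -/

/-- A balanced tree of parities over the cube of dimension `k`. -/
def xorTree (Out : Type) [Fintype Out] : (k : ℕ) → BoolCircuit (Out × (Fin k → Bool)) Out
  | 0 => .output fun o => (o, Fin.elim0)
  | k + 1 =>
    -- Three layers per level, since `a xor b = (a or b) and not (a and b)`: the tag `true` carries
    -- the disjunction, the tag `false` the conjunction that is negated in the second layer.
    .layer (Mid := (Out × (Fin k → Bool)) × Bool)
      (fun p => if p.2 = true then .or (p.1.1, Fin.cons false p.1.2) (p.1.1, Fin.cons true p.1.2)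
        else .and (p.1.1, Fin.cons false p.1.2) (p.1.1, Fin.cons true p.1.2)) <|
    .layer (Mid := (Out × (Fin k → Bool)) × Bool)
      (fun p => if p.2 = true then .wire p else .not p) <|
    .layer (Mid := Out × (Fin k → Bool)) (fun p => .and (p, false) (p, true)) (xorTree Out k)

theorem xorTree_eval (Out : Type) [Fintype Out] : ∀ (k : ℕ) (v : Out × (Fin k → Bool) → Bool)
    (o : Out), (xorTree Out k).eval v o = ∑ y : Fin k → Bool, v (o, y)
  | 0, v, o => by
    rw [Fintype.sum_unique, xorTree, BoolCircuit.eval]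
    exact congrArg _ (Prod.ext rfl (Subsingleton.elim _ _))
  | k + 1, v, o => by
    rw [xorTree]
    simp only [BoolCircuit.eval]
    rw [xorTree_eval Out k, ← (Fin.consEquiv fun _ => Bool).sum_comp, Fintype.sum_prod_type_right]
    refine Finset.sum_congr rfl fun y _ => ?_
    rw [Fintype.sum_bool]
    simp only [BoolGate.eval, Fin.consEquiv, Equiv.coe_fn_mk, Bool.add_eq_xor, if_true,
      Bool.false_eq_true, if_false]
    cases v (o, Fin.cons false y) <;> cases v (o, Fin.cons true y) <;> rfl

theorem xorTree_depth (Out : Type) [Fintype Out] : ∀ k : ℕ, (xorTree Out k).depth = 3 * k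
  | 0 => rfl
  | k + 1 => by simp only [xorTree, BoolCircuit.depth, xorTree_depth Out k]; ring

/-- Each node of the tree costs `2 + 2 + 1 = 5` gates, and the numbers of nodes form a geometric
series. -/
theorem xorTree_size_le (Out : Type) [Fintype Out] :
    ∀ k : ℕ, (xorTree Out k).size ≤ 5 * (Fintype.card Out * 2 ^ k)
  | 0 => by simp [xorTree, BoolCircuit.size]
  | k + 1 => by
    have := xorTree_size_le Out k
    simp only [xorTree, BoolCircuit.size, Fintype.card_prod, Fintype.card_bool,
      Fintype.card_pi, Finset.prod_const, Finset.card_univ, Fintype.card_fin, pow_succ]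
    linarith

section LinearCircuit

variable {V : Type} [Fintype V]

/-- The labels `V` as corners of a cube. -/
noncomputable def cornerOf (V : Type) [Fintype V] :
    V ↪ (Fin (Nat.clog 2 (Fintype.card V)) → Bool) :=
  (Function.Embedding.nonempty_of_card_le
    (by simpa using Nat.le_pow_clog (by norm_num) (Fintype.card V))).some

variable [DecidableEq V]

open Classical in
/-- The gate feeding one corner of the parity tree which computes output `q` of `f`. -/
noncomputable def cornerGate (f : (V → Bool) →+ (V → Bool)) (j : ℕ) (q : V)
    (y : Fin (Nat.clog 2 (Fintype.card V)) → Bool) : BoolGate (ℕ × V) :=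
  if h : ∃ p, cornerOf V p = y then
    if f (Pi.single h.choose 1) q = true then .wire (j, h.choose) else .const false
  else .const false

/-- A circuit which applies the linear map `f` to the outcomes of alternation number `j`. -/
noncomputable def linearCircuit (f : (V → Bool) →+ (V → Bool)) (j : ℕ) : BoolCircuit (ℕ × V) V :=
  .layer (fun p : V × (Fin (Nat.clog 2 (Fintype.card V)) → Bool) => cornerGate f j p.1 p.2)
    (xorTree V _)

/-- An additive map is automatically linear over the field with two elements, so it is determined by
its values on unit vectors. -/
theorem addMonoidHom_apply_eq_sum (f : (V → Bool) →+ (V → Bool)) (x : V → Bool) (q : V) :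
    f x q = ∑ p, f (Pi.single p 1) q * x p := by
  conv_lhs => rw [← Finset.univ_sum_single x, map_sum, Finset.sum_apply]
  refine Finset.sum_congr rfl fun p _ => ?_
  cases h : x p
  · rw [show (false : Bool) = 0 from rfl, Pi.single_zero, map_zero, mul_zero]; rfl
  · rw [show (true : Bool) = 1 from rfl, mul_one]

theorem cornerGate_eval (f : (V → Bool) →+ (V → Bool)) (j : ℕ) (q p : V) (r : ℕ × V → Bool) :
    (cornerGate f j q (cornerOf V p)).eval r = f (Pi.single p 1) q * r (j, p) := by
  have h : ∃ p', cornerOf V p' = cornerOf V p := ⟨p, rfl⟩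
  have h' : h.choose = p := (cornerOf V).injective h.choose_spec
  rw [cornerGate, dif_pos h, h']
  cases f (Pi.single p 1) q <;> simp [BoolGate.eval, Bool.mul_eq_and]

/-- Corners of the cube that label no qubit are fed with `false` and do not contribute to the
parity. -/
theorem linearCircuit_eval (f : (V → Bool) →+ (V → Bool)) (j : ℕ) (r : ℕ × V → Bool) :
    (linearCircuit f j).eval r = f fun q => r (j, q) := by
  funext q
  rw [linearCircuit, BoolCircuit.eval, xorTree_eval, addMonoidHom_apply_eq_sum]
  symm
  refine Fintype.sum_of_injective (cornerOf V) (cornerOf V).injective _ _ ?_ ?_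
  · intro y hy
    rw [cornerGate, dif_neg fun ⟨p, hp⟩ => hy ⟨p, hp⟩]
    rfl
  · intro p
    rw [cornerGate_eval]

theorem linearCircuit_depth (f : (V → Bool) →+ (V → Bool)) (j : ℕ) :
    (linearCircuit f j).depth = 3 * Nat.clog 2 (Fintype.card V) + 1 := by
  rw [linearCircuit, BoolCircuit.depth, xorTree_depth]

theorem linearCircuit_size_le (f : (V → Bool) →+ (V → Bool)) (j : ℕ) :
    (linearCircuit f j).size ≤
      6 * (Fintype.card V * 2 ^ Nat.clog 2 (Fintype.card V)) := by
  have := xorTree_size_le V (Nat.clog 2 (Fintype.card V))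
  simp only [linearCircuit, BoolCircuit.size, Fintype.card_prod, Fintype.card_bool,
      Fintype.card_pi, Finset.prod_const, Finset.card_univ, Fintype.card_fin]
  linarith

end LinearCircuit

/-! ### Phase polynomials by measurement and feedback -/

section Embed

variable {V Λ : Type} [Fintype V] [DecidableEq V] [Fintype Λ] [DecidableEq Λ]

open Classical in
/-- The state `φ` on the qubits `data`, with all other qubits in `0`. -/
noncomputable def embedState (data : Λ ↪ V) (φ : QState Λ) : QState V :=
  fun x => if ∀ q, q ∉ Set.range data → x q = false then φ (fun i => x (data i)) else 0

open Classical in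
/-- The assignment `z` on the qubits `data`, extended by `false`. -/
noncomputable def extendZero (data : Λ ↪ V) (z : Λ → Bool) : V → Bool :=
  fun q => if h : ∃ i, data i = q then z h.choose else false

theorem extendZero_data (data : Λ ↪ V) (z : Λ → Bool) (i : Λ) :
    extendZero data z (data i) = z i := by
  have h : ∃ i', data i' = data i := ⟨i, rfl⟩
  rw [extendZero, dif_pos h, data.injective h.choose_spec]

theorem extendZero_of_not_mem (data : Λ ↪ V) (z : Λ → Bool) {q : V} (hq : q ∉ Set.range data) :
    extendZero data z q = false :=
  dif_neg hq

theorem extendZero_injective (data : Λ ↪ V) : Function.Injective (extendZero data) := by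
  intro z z' h
  funext i
  rw [← extendZero_data data z i, h, extendZero_data]

theorem embedState_smul (data : Λ ↪ V) (c : ℂ) (φ : QState Λ) :
    embedState data (c • φ) = c • embedState data φ := by
  funext x
  simp only [embedState, Pi.smul_apply, smul_eq_mul]
  split_ifs <;> simp

theorem prod_data_mul_prod (data : Λ ↪ V) (f : V → ℂ) :
    ∏ q, f q = (∏ q ∈ Finset.univ \ Finset.univ.map data, f q) * ∏ i, f (data i) := by
  rw [← Finset.prod_sdiff (Finset.subset_univ (Finset.univ.map data)), Finset.prod_map]

theorem mem_map_data (data : Λ ↪ V) (q : V) :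
    q ∈ Finset.univ.map data ↔ q ∈ Set.range data := by simp

/-- Only assignments vanishing off the data contribute to the sum, so each other qubit supplies just
the column `false` of its matrix. -/
theorem localMap_embedState (data : Λ ↪ V) (W : V → Matrix Bool Bool ℂ) (φ : QState Λ)
    (x : V → Bool) :
    localMap W (embedState data φ) x =
      (∏ q ∈ Finset.univ \ Finset.univ.map data, W q (x q) false) *
        localMap (fun i => W (data i)) φ (fun i => x (data i)) := by
  rw [localMap, localMap, Finset.mul_sum]
  symm
  refine Fintype.sum_of_injective (extendZero data) (extendZero_injective data) _ _ ?_ ?_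
  · intro y hy
    rw [embedState, if_neg, mul_zero]
    intro h
    refine hy ⟨fun i => y (data i), funext fun q => ?_⟩
    by_cases hq : q ∈ Set.range data
    · obtain ⟨i, rfl⟩ := hq
      rw [extendZero_data]
    · rw [extendZero_of_not_mem data _ hq, h q hq]
  · intro z
    rw [prod_data_mul_prod data, embedState, if_pos fun q hq => extendZero_of_not_mem data z hq]
    simp only [extendZero_data]
    rw [← mul_assoc]
    congr 2
    refine Finset.prod_congr rfl fun q hq => ?_
    rw [extendZero_of_not_mem]
    simpa using hq

end Embed

/-- A pattern of CNOT gates and measurements by which the parities `parity θ` of the data qubits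
are written into ancillas, up to linear corrections. The ancillas `anc` are prepared in `|+⟩`; the
CNOT gates `steps` change the qubits `meas`, which are measured; `fix` gives the resulting
bit flips, after which the ancillas carry the linear functions `lin` of the data. When the ancillas
are then measured in the Hadamard basis, `back` gives the resulting corrections of the data. -/
structure PhaseGadget {V : Type} [Fintype V] [DecidableEq V] (G : SimpleGraph V) {Λ Θ : Type}
    [Fintype Λ] (parity : Θ → (Λ → Bool) → Bool) where
  data : Λ ↪ V
  anc : Finset V
  meas : Finset V
  steps : List (QStep G V)
  effect : (V → Bool) → V → Bool
  steps_apply : ∀ y ψ, steps.foldl (fun φ S => S.apply y φ) ψ = fun x => ψ (effect x)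
  effect_add : ∀ x x', effect (x + x') = effect x + effect x'
  effect_of_not_mem : ∀ x, ∀ q ∉ meas, effect x q = x q
  data_not_mem_anc : ∀ i, data i ∉ anc
  data_not_mem_meas : ∀ i, data i ∉ meas
  disjoint : Disjoint anc meas
  fix : (V → Bool) →+ (V → Bool)
  fix_of_mem : ∀ m, ∀ q ∈ meas, fix m q = m q
  fix_of_not_mem : ∀ m, ∀ q ∉ meas, q ∉ anc → fix m q = false
  effect_fix : ∀ m, ∀ q ∈ meas, effect (fix m) q = false
  lin : (Λ → Bool) → V → Bool
  solve : ∀ x, (∀ q ∈ meas, x q = false) →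
    ((∀ q ∈ meas, effect x q = false) ↔ ∀ q ∈ anc, x q = lin (fun i => x (data i)) q)
  back : (V → Bool) →+ (V → Bool)
  back_of_mem : ∀ h, ∀ q ∈ anc, back h q = h q
  back_of_not_mem : ∀ h, ∀ q ∉ anc, q ∉ Set.range data → back h q = false
  back_data : ∀ h z, ∑ q ∈ anc, h q * lin z q = ∑ i, back h (data i) * z i
  acc : Θ ↪ V
  acc_mem : ∀ θ, acc θ ∈ anc
  lin_acc : ∀ θ z, lin z (acc θ) = parity θ z

/-! ### The three alternations of a gadget and their action on states. -/

namespace PhaseGadget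

variable {V : Type} [Fintype V] [DecidableEq V] {G : SimpleGraph V} {Λ Θ : Type}
  [Fintype Λ] [DecidableEq Λ] [Fintype Θ] [DecidableEq Θ] {parity : Θ → (Λ → Bool) → Bool}
  (g : PhaseGadget G parity)

open Classical in
/-- The gates before the ancillas are coupled to the data. -/
noncomputable def initGate (U : Λ → Matrix.unitaryGroup Bool ℂ) (q : V) :
    Matrix.unitaryGroup Bool ℂ :=
  if q ∈ g.anc then ⟨hadamard, hadamard_mem⟩
  else if h : ∃ i, g.data i = q then U h.choose else 1

theorem initGate_data (U : Λ → Matrix.unitaryGroup Bool ℂ) (i : Λ) :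
    g.initGate U (g.data i) = U i := by
  have h : ∃ i', g.data i' = g.data i := ⟨i, rfl⟩
  rw [initGate, if_neg (g.data_not_mem_anc i), dif_pos h, g.data.injective h.choose_spec]

theorem initGate_of_not_mem (U : Λ → Matrix.unitaryGroup Bool ℂ) {q : V}
    (hq : q ∉ Set.range g.data) (hq' : q ∉ g.anc) : g.initGate U q = 1 := by
  rw [initGate, if_neg hq']
  exact dif_neg hq

open Classical in
/-- The phase gates. -/
noncomputable def accGate (w : Θ → unitary ℂ) (q : V) : Matrix.unitaryGroup Bool ℂ :=
  if h : ∃ θ, g.acc θ = q then phaseGate (w h.choose) else phaseGate 1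

/-- The corrections after the second measurement. -/
noncomputable def backGate (q : V) : Matrix.unitaryGroup Bool ℂ :=
  if q ∈ g.anc then ⟨notMatrix, notMatrix_mem⟩ else phaseGate ⟨-1, neg_one_mem_unitary⟩

/-- The first alternation: `U` on the data, then the coupling of the ancillas. -/
noncomputable def couple (U : Λ → Matrix.unitaryGroup Bool ℂ) : Alternation G where
  Control := V
  conventional := .output fun q => (0, q)
  quantum := singleStep (fun _ => none) (g.initGate U) :: g.steps
  measured := g.meas

/-- The second alternation: correction, phases, and measurement in the Hadamard basis. -/
noncomputable def accumulate (w : Θ → unitary ℂ) (j : ℕ) : Alternation G where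
  Control := V
  conventional := linearCircuit g.fix j
  quantum := [singleStep some fun _ => ⟨notMatrix, notMatrix_mem⟩,
    singleStep (fun _ => none) (g.accGate w),
    singleStep (fun _ => none) fun q => if q ∈ g.anc then ⟨hadamard, hadamard_mem⟩ else 1]
  measured := g.anc

/-- The third alternation: correction of the data. -/
noncomputable def restore (j : ℕ) : Alternation G where
  Control := V
  conventional := linearCircuit g.back j
  quantum := [singleStep some g.backGate]
  measured := ∅

/-- The alternations for the gates `U` followed by the phases `w` of the parities, if they start
with alternation number `j`. -/
noncomputable def alternations (U : Λ → Matrix.unitaryGroup Bool ℂ) (w : Θ → unitary ℂ) (j : ℕ) :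
    List (Alternation G) :=
  [g.couple U, g.accumulate w j, g.restore (j + 1)]

/-- The normalization factor of one measurement. -/
noncomputable def amplitude : ℂ := rootHalf ^ g.anc.card

/-- The phase of a basis state. -/
noncomputable def phase (_g : PhaseGadget G parity) (w : Θ → unitary ℂ) (z : Λ → Bool) : ℂ :=
  ∏ θ, if parity θ z = true then (w θ : ℂ) else 1

/-- The condition that all qubits except data and ancillas are zero. -/
def Clean (x : V → Bool) : Prop := ∀ q, q ∉ Set.range g.data → q ∉ g.anc → x q = false

-- The column `false` of the Hadamard matrix is constant, so every ancilla contributes the same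
-- factor whatever its value.
open Classical in
theorem initGate_apply_embedState (U : Λ → Matrix.unitaryGroup Bool ℂ) (φ : QState Λ)
    (x : V → Bool) :
    localMap (fun q => (g.initGate U q : Matrix Bool Bool ℂ)) (embedState g.data φ) x =
      if g.Clean x then
        g.amplitude * localMap (fun i => (U i : Matrix Bool Bool ℂ)) φ (fun i => x (g.data i))
      else 0 := by
  rw [localMap_embedState]
  simp only [initGate_data]
  split_ifs with h
  · congr 1
    have hsub : g.anc ⊆ Finset.univ \ Finset.univ.map g.data := by
      intro q hq
      rw [Finset.mem_sdiff, mem_map_data]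
      refine ⟨Finset.mem_univ q, ?_⟩
      rintro ⟨i, rfl⟩
      exact g.data_not_mem_anc i hq
    rw [← Finset.prod_sdiff hsub, Finset.prod_eq_one, one_mul,
      Finset.prod_congr rfl (g := fun _ => rootHalf), Finset.prod_const, amplitude]
    · intro q hq
      simp only [initGate, if_pos hq, hadamard_apply]
      rw [show (false : Bool) = 0 from rfl, mul_zero]
      simp
    · intro q hq
      rw [Finset.mem_sdiff, Finset.mem_sdiff, mem_map_data] at hq
      rw [h q hq.1.2 hq.2, g.initGate_of_not_mem U hq.1.2 hq.2]
      exact Matrix.one_apply_eq _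
  · simp only [Clean, not_forall] at h
    obtain ⟨q, hq, hq', hx⟩ := h
    rw [Finset.prod_eq_zero (i := q), zero_mul]
    · rw [Finset.mem_sdiff, mem_map_data]
      exact ⟨Finset.mem_univ q, hq⟩
    · rw [g.initGate_of_not_mem U hq hq']
      exact Matrix.one_apply_ne hx

/-- Writing the gate as a product over all parities, with at most one nontrivial factor, allows the
products over qubits and over parities to be exchanged in `localMap_accGate`. -/
theorem accGate_apply (w : Θ → unitary ℂ) (q : V) :
    (g.accGate w q : Matrix Bool Bool ℂ) = Matrix.diagonal fun b =>
      ∏ θ, if g.acc θ = q ∧ b = true then (w θ : ℂ) else 1 := by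
  by_cases h : ∃ θ, g.acc θ = q
  · have hs := h.choose_spec
    rw [accGate, dif_pos h, phaseGate]
    refine congrArg Matrix.diagonal (funext fun b => ?_)
    rw [Finset.prod_eq_single h.choose]
    · simp [hs]
    · intro θ _ hθ
      rw [if_neg]
      exact fun e => hθ (g.acc.injective (e.1.trans hs.symm))
    · simp
  · rw [accGate, dif_neg h, phaseGate]
    refine congrArg Matrix.diagonal (funext fun b => ?_)
    rw [Finset.prod_eq_one]
    · simp
    · intro θ _
      rw [if_neg fun e => h ⟨θ, e.1⟩]

theorem localMap_accGate (w : Θ → unitary ℂ) (ψ : QState V) (x : V → Bool) :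
    localMap (fun q => (g.accGate w q : Matrix Bool Bool ℂ)) ψ x =
      (∏ θ, if x (g.acc θ) = true then (w θ : ℂ) else 1) * ψ x := by
  simp only [accGate_apply]
  rw [localMap_diagonal]
  beta_reduce
  rw [Finset.prod_comm]
  congr 1
  refine Finset.prod_congr rfl fun θ _ => ?_
  rw [Finset.prod_eq_single (g.acc θ)]
  · simp
  · intro q _ hq
    rw [if_neg fun e => hq e.1.symm]
  · simp

open Classical in
/-- The states in which the ancillas carry the linear functions of the data. -/
noncomputable def linState (χ : QState Λ) : QState V := fun x =>
  if g.Clean x ∧ ∀ q ∈ g.anc, x q = g.lin (fun i => x (g.data i)) q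
    then χ fun i => x (g.data i) else 0

theorem localMap_accGate_linState (w : Θ → unitary ℂ) (χ : QState Λ) :
    localMap (fun q => (g.accGate w q : Matrix Bool Bool ℂ)) (g.linState χ) =
      g.linState fun z => g.phase w z * χ z := by
  funext x
  rw [localMap_accGate, linState, linState]
  split_ifs with h
  · rw [phase]
    congr 1
    refine Finset.prod_congr rfl fun θ _ => ?_
    rw [h.2 _ (g.acc_mem θ), g.lin_acc]
  · rw [mul_zero]

-- For each `x` a single term survives: off the ancillas the summation variable must agree with `x`,
-- and on the ancillas it is forced by the data. The Hadamard entries at this term give the sign.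
open Classical in
theorem localMap_hadamard_linState (χ : QState Λ) (x : V → Bool) :
    localMap (fun q => if q ∈ g.anc then hadamard else 1) (g.linState χ) x =
      if g.Clean x then g.amplitude *
        boolSign (∑ q ∈ g.anc, x q * g.lin (fun i => x (g.data i)) q) *
          χ (fun i => x (g.data i)) else 0 := by
  set y₀ : V → Bool := fun q => if q ∈ g.anc then g.lin (fun i => x (g.data i)) q else x q
    with hy₀
  have hdata : ∀ i, y₀ (g.data i) = x (g.data i) := fun i => if_neg (g.data_not_mem_anc i)
  have hclean : g.Clean y₀ ↔ g.Clean x := by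
    refine forall_congr' fun q => forall_congr' fun _ => forall_congr' fun h => ?_
    rw [hy₀]; simp only [if_neg h]
  rw [localMap, Finset.sum_eq_single y₀]
  · rw [linState]
    simp only [hdata, hclean]
    have h1 : ∀ q ∈ g.anc, y₀ q = g.lin (fun i => x (g.data i)) q := fun q hq => if_pos hq
    simp only [and_iff_left h1]
    split_ifs with h
    · congr 1
      rw [← Finset.prod_sdiff (Finset.subset_univ g.anc), Finset.prod_eq_one, one_mul,
        boolSign_sum, amplitude, ← Finset.prod_const, ← Finset.prod_mul_distrib]
      · refine Finset.prod_congr rfl fun q hq => ?_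
        rw [if_pos hq, h1 q hq, hadamard_apply]
      · intro q hq
        rw [Finset.mem_sdiff] at hq
        have : y₀ q = x q := if_neg hq.2
        rw [this, if_neg hq.2, Matrix.one_apply_eq]
    · rw [mul_zero]
  · intro y _ hy
    rw [linState]
    split_ifs with h
    · have hne : ∃ q, q ∉ g.anc ∧ x q ≠ y q := by
        by_contra hcon
        push Not at hcon
        refine hy (funext fun q => ?_)
        by_cases hq : q ∈ g.anc
        · simp only [hy₀, if_pos hq]
          rw [h.2 q hq]
          congr 1
          funext i
          exact (hcon _ (g.data_not_mem_anc i)).symm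
        · simp only [hy₀, if_neg hq]
          exact (hcon q hq).symm
      obtain ⟨q, hq, hne⟩ := hne
      rw [Finset.prod_eq_zero (Finset.mem_univ q), zero_mul]
      rw [if_neg hq, Matrix.one_apply_ne hne]
    · rw [mul_zero]
  · simp

/-- The correction flips ancillas, and elsewhere applies the phase gate with phase `-1`, which
contributes only signs. -/
theorem localMap_backGate (b : V → Bool) (ψ : QState V) (x : V → Bool) :
    localMap (fun q => if b q = true then (g.backGate q : Matrix Bool Bool ℂ) else 1) ψ x =
      boolSign (∑ q ∈ Finset.univ \ g.anc, b q * x q) *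
        ψ (fun q => if q ∈ g.anc then x q + b q else x q) := by
  rw [localMap, Finset.sum_eq_single (fun q => if q ∈ g.anc then x q + b q else x q)]
  · congr 1
    rw [← Finset.prod_sdiff (Finset.subset_univ g.anc), boolSign_sum]
    conv_rhs => rw [← mul_one (∏ q ∈ _, _)]
    congr 1
    · refine Finset.prod_congr rfl fun q hq => ?_
      rw [Finset.mem_sdiff] at hq
      beta_reduce
      rw [if_neg hq.2, backGate, if_neg hq.2]
      cases b q <;> cases x q <;> simp [phaseGate, Bool.mul_eq_and]
    · refine Finset.prod_eq_one fun q hq => ?_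
      beta_reduce
      rw [if_pos hq, backGate, if_pos hq]
      cases b q <;> cases x q <;> rfl
  · intro y _ hy
    obtain ⟨q, hq⟩ := Function.ne_iff.mp hy
    rw [Finset.prod_eq_zero (Finset.mem_univ q), zero_mul]
    by_cases h : q ∈ g.anc
    · rw [if_pos h, Bool.add_eq_xor] at hq
      rw [backGate, if_pos h]
      revert hq
      cases b q <;> cases x q <;> cases y q <;> simp [notMatrix]
    · rw [if_neg h] at hq
      rw [backGate, if_neg h]
      revert hq
      cases b q <;> cases x q <;> cases y q <;> simp [phaseGate]
  · simp

/-- After translation by `g.fix c` the state no longer depends on the outcomes. Indeed `fix c`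
equals the outcomes on the measured qubits, so these become zero, while `effect` is additive and
kills `fix c` there. What remains are the homogeneous equations treated by `solve`. The vector `c`
has to agree with the outcomes on the measured qubits only, as does the record. -/
theorem couple_apply (U : Λ → Matrix.unitaryGroup Bool ℂ) (r : ℕ × V → Bool) (m : V → Bool)
    (φ : QState Λ) (c : V → Bool) (hc : ∀ q ∈ g.meas, c q = m q) (x : V → Bool) :
    (g.couple U).apply r m (embedState g.data φ) (x + g.fix c) =
      g.linState (g.amplitude • localMap (fun i => (U i : Matrix Bool Bool ℂ)) φ) x := by
  classical
  have hq : (g.couple U).quantum.foldl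
      (fun φ S => S.apply ((g.couple U).conventional.eval r) φ) (embedState g.data φ) =
      fun x => localMap (fun q => (g.initGate U q : Matrix Bool Bool ℂ))
        (embedState g.data φ) (g.effect x) := by
    rw [couple, List.foldl_cons, g.steps_apply, singleStep_apply]
    simp
  rw [Alternation.apply, hq, measureBranch, linState]
  simp only [couple, initGate_apply_embedState]
  have hm : (∀ q ∈ g.meas, (x + g.fix c) q = m q) ↔ ∀ q ∈ g.meas, x q = false := by
    refine forall_congr' fun q => forall_congr' fun hq => ?_
    rw [Pi.add_apply, g.fix_of_mem c q hq, hc q hq]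
    exact add_eq_right
  have hdata : ∀ i, g.effect (x + g.fix c) (g.data i) = x (g.data i) := by
    intro i
    rw [g.effect_of_not_mem _ _ (g.data_not_mem_meas i), Pi.add_apply,
      g.fix_of_not_mem c _ (g.data_not_mem_meas i) (g.data_not_mem_anc i)]
    exact add_zero _
  have heff : ∀ q, q ∉ g.anc → g.effect (x + g.fix c) q = g.effect x q := by
    intro q hq
    rw [g.effect_add, Pi.add_apply]
    by_cases hq' : q ∈ g.meas
    · rw [g.effect_fix c q hq']; exact add_zero _
    · rw [g.effect_of_not_mem (g.fix c) q hq', g.fix_of_not_mem c q hq' hq]; exact add_zero _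
  have hclean : g.Clean (g.effect (x + g.fix c)) ↔ g.Clean (g.effect x) := by
    refine forall_congr' fun q => forall_congr' fun _ => forall_congr' fun h => ?_
    rw [heff q h]
  have key : (∀ q ∈ g.meas, x q = false) → (g.Clean (g.effect x) ↔
      g.Clean x ∧ ∀ q ∈ g.anc, x q = g.lin (fun i => x (g.data i)) q) := by
    intro h0
    rw [← g.solve x h0]
    constructor
    · intro h
      refine ⟨fun q hq hq' => ?_, fun q hq => ?_⟩
      · by_cases hm : q ∈ g.meas
        · exact h0 q hm
        · rw [← g.effect_of_not_mem x q hm, h q hq hq']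
      · refine h q ?_ (Finset.disjoint_right.mp g.disjoint hq)
        rintro ⟨i, rfl⟩
        exact g.data_not_mem_meas i hq
    · rintro ⟨h, h'⟩ q hq hq'
      by_cases hm : q ∈ g.meas
      · exact h' q hm
      · rw [g.effect_of_not_mem x q hm, h q hq hq']
  simp only [hm, hclean, hdata]
  by_cases h0 : ∀ q ∈ g.meas, x q = false
  · rw [if_pos h0]
    simp only [key h0, Pi.smul_apply, smul_eq_mul]
  · rw [if_neg h0, if_neg]
    rintro ⟨h, -⟩
    refine h0 fun q hq => h q ?_ (Finset.disjoint_right.mp g.disjoint hq)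
    rintro ⟨i, rfl⟩
    exact g.data_not_mem_meas i hq

open Classical in
theorem accumulate_apply (w : Θ → unitary ℂ) (j : ℕ) (r : ℕ × V → Bool) (h : V → Bool)
    (ψ : QState V) (χ : QState Λ) (hψ : ∀ x, ψ (x + g.fix fun q => r (j, q)) = g.linState χ x)
    (x : V → Bool) :
    (g.accumulate w j).apply r h ψ x =
      if ∀ q ∈ g.anc, x q = h q then
        if g.Clean x then g.amplitude *
          boolSign (∑ q ∈ g.anc, x q * g.lin (fun i => x (g.data i)) q) *
          (g.phase w (fun i => x (g.data i)) * χ (fun i => x (g.data i))) else 0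
      else 0 := by
  have h1 : (singleStep (G := G) some fun _ => (⟨notMatrix, notMatrix_mem⟩ :
      Matrix.unitaryGroup Bool ℂ)).apply ((linearCircuit g.fix j).eval r) ψ = g.linState χ := by
    rw [singleStep_apply, linearCircuit_eval]
    funext x
    rw [← hψ]
    exact congrFun (localMap_not _ ψ) x
  have h2 : ∀ y : V → Bool, (singleStep (G := G) (fun _ => none) (g.accGate w)).apply y
      (g.linState χ) = g.linState fun z => g.phase w z * χ z := by
    intro y
    rw [singleStep_apply, ← localMap_accGate_linState]
    simp
  have h3 : ∀ (y : V → Bool) (χ' : QState Λ) (x : V → Bool),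
      (singleStep (G := G) (fun _ => none) fun q =>
      if q ∈ g.anc then (⟨hadamard, hadamard_mem⟩ : Matrix.unitaryGroup Bool ℂ) else 1).apply y
      (g.linState χ') x = if g.Clean x then g.amplitude *
        boolSign (∑ q ∈ g.anc, x q * g.lin (fun i => x (g.data i)) q) *
          χ' (fun i => x (g.data i)) else 0 := by
    intro y χ' x
    rw [singleStep_apply, ← localMap_hadamard_linState]
    congr 2
    funext q
    by_cases hq : q ∈ g.anc <;> simp [hq]
  rw [Alternation.apply, measureBranch]
  simp only [accumulate, List.foldl_cons, List.foldl_nil]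
  rw [h1, h2, h3]
  congr

-- By `back_data` the sign left by the Hadamard measurement is a product of signs of single data
-- qubits. The same sign is applied again and squares to one, while the ancillas are flipped back to
-- zero according to their outcomes.
open Classical in
theorem restore_apply (j : ℕ) (r : ℕ × V → Bool) (m h : V → Bool) (a : QState Λ)
    (ψ : QState V) (hr : ∀ q ∈ g.anc, r (j, q) = h q)
    (hψ : ∀ x, ψ x = if ∀ q ∈ g.anc, x q = h q then
        if g.Clean x then 
          boolSign (∑ q ∈ g.anc, x q * g.lin (fun i => x (g.data i)) q) *
          a (fun i => x (g.data i)) else 0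
      else 0) :
    (g.restore j).apply r m ψ = embedState g.data a := by
  funext x
  rw [Alternation.apply, measureBranch]
  simp only [restore, List.foldl_cons, List.foldl_nil, Finset.notMem_empty, false_implies,
    implies_true, if_true]
  set b : V → Bool := g.back fun q => r (j, q) with hb
  have h1 : (singleStep (G := G) some g.backGate).apply ((linearCircuit g.back j).eval r) ψ x =
      boolSign (∑ q ∈ Finset.univ \ g.anc, b q * x q) *
        ψ (fun q => if q ∈ g.anc then x q + b q else x q) := by
    rw [singleStep_apply, linearCircuit_eval, ← localMap_backGate]
    rfl
  rw [h1, hψ, embedState]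
  have hbq : ∀ q ∈ g.anc, b q = h q := fun q hq => by rw [hb, g.back_of_mem _ q hq, hr q hq]
  have hanc : (∀ q ∈ g.anc, (if q ∈ g.anc then x q + b q else x q) = h q) ↔
      ∀ q ∈ g.anc, x q = false := by
    refine forall_congr' fun q => forall_congr' fun hq => ?_
    rw [if_pos hq, hbq q hq]
    exact add_eq_right
  have hclean : g.Clean (fun q => if q ∈ g.anc then x q + b q else x q) ↔ g.Clean x := by
    refine forall_congr' fun q => forall_congr' fun _ => forall_congr' fun h => ?_
    beta_reduce
    rw [if_neg h]
  have hd : ∀ i, (if g.data i ∈ g.anc then x (g.data i) + b (g.data i) else x (g.data i)) =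
      x (g.data i) := fun i => if_neg (g.data_not_mem_anc i)
  simp only [hanc, hclean, hd]
  by_cases hx : ∀ q, q ∉ Set.range g.data → x q = false
  · have hx1 : ∀ q ∈ g.anc, x q = false := fun q hq => hx q <| by
      rintro ⟨i, rfl⟩; exact g.data_not_mem_anc i hq
    have hx2 : g.Clean x := fun q hq _ => hx q hq
    rw [if_pos hx1, if_pos hx2, if_pos hx, ← mul_assoc]
    have e1 : ∑ q ∈ g.anc, (if q ∈ g.anc then x q + b q else x q) *
        g.lin (fun i => x (g.data i)) q = ∑ i, b (g.data i) * x (g.data i) := by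
      rw [hb, ← g.back_data (fun q => r (j, q)) fun i => x (g.data i)]
      refine Finset.sum_congr rfl fun q hq => ?_
      rw [← hb, if_pos hq, hx1 q hq, hbq q hq, hr q hq]
      congr 1
      exact zero_add _
    have e2 : ∑ q ∈ Finset.univ \ g.anc, b q * x q = ∑ i, b (g.data i) * x (g.data i) := by
      rw [← Finset.sum_map Finset.univ g.data fun q => b q * x q]
      symm
      refine Finset.sum_subset ?_ ?_
      · intro q hq
        rw [mem_map_data] at hq
        obtain ⟨i, rfl⟩ := hq
        simp [g.data_not_mem_anc i]
      · intro q _ hq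
        rw [mem_map_data] at hq
        rw [hx q hq]
        exact mul_zero _
    rw [e1, e2, boolSign_mul_self, one_mul]
  · rw [if_neg hx]
    by_cases hx1 : ∀ q ∈ g.anc, x q = false
    · rw [if_pos hx1, if_neg, mul_zero]
      intro hx2
      refine hx fun q hq => ?_
      by_cases hq' : q ∈ g.anc
      · exact hx1 q hq'
      · exact hx2 q hq hq'
    · rw [if_neg hx1, mul_zero]

/-- The alternations of the gadget act on the data as `U` followed by the phases `w`, in every
branch of the measurements. -/
theorem run_alternations (U : Λ → Matrix.unitaryGroup Bool ℂ) (w : Θ → unitary ℂ)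
    (o : ℕ → V → Bool) (rest : List (Alternation G)) (j : ℕ) (r : ℕ × V → Bool) (φ : QState Λ) :
    ∃ r', Alternation.run o (g.alternations U w j ++ rest) j r (embedState g.data φ) =
      Alternation.run o rest (j + 3) r' (embedState g.data ((g.amplitude * g.amplitude) • fun z =>
        g.phase w z * localMap (fun i => (U i : Matrix Bool Bool ℂ)) φ z)) := by
  classical
  simp only [alternations, List.cons_append, List.nil_append, Alternation.run]
  refine ⟨_, congrArg (Alternation.run o rest (j + 3) _) ?_⟩
  refine g.restore_apply (j + 1) _ _ (o (j + 1)) _ _ ?_ ?_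
  · intro q hq
    simp [Alternation.record, accumulate, hq]
  · intro x
    rw [g.accumulate_apply w j _ _ _
      (g.amplitude • localMap (fun i => (U i : Matrix Bool Bool ℂ)) φ)]
    · split_ifs
      · simp only [Pi.smul_apply, smul_eq_mul]
        ring
      · rfl
      · rfl
    · intro x
      refine g.couple_apply U _ _ _ _ ?_ x
      intro q hq
      simp [Alternation.record, couple, hq]

end PhaseGadget

/-! ### The gadget on the grid -/

section PrefixSum

/-- Sums over initial segments. -/
def prefixSum {n : ℕ} (f : Fin n → Bool) (i : Fin n) : Bool := ∑ j ∈ Finset.Iic i, f j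

theorem prefixSum_zero {n : ℕ} (f : Fin (n + 1) → Bool) : prefixSum f 0 = f 0 := by
  have : Finset.Iic (0 : Fin (n + 1)) = {0} := by
    ext j; simp
  rw [prefixSum, this, Finset.sum_singleton]

theorem prefixSum_succ {n : ℕ} (f : Fin (n + 1) → Bool) (i : Fin n) :
    prefixSum f i.succ = prefixSum f i.castSucc + f i.succ := by
  have : Finset.Iic i.succ = insert i.succ (Finset.Iic i.castSucc) := by
    ext j
    simp only [Finset.mem_Iic, Finset.mem_insert, Fin.le_def, Fin.ext_iff, Fin.val_succ,
      Fin.val_castSucc]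
    omega
  rw [prefixSum, this, Finset.sum_insert, add_comm, prefixSum]
  simp [Fin.le_def]

theorem prefixSum_last {n : ℕ} (f : Fin (n + 1) → Bool) :
    prefixSum f (Fin.last n) = ∑ i, f i := by
  rw [prefixSum]
  congr 1
  ext j
  simp [Fin.le_last]

theorem prefixSum_add {n : ℕ} (f f' : Fin n → Bool) (i : Fin n) :
    prefixSum (fun j => f j + f' j) i = prefixSum f i + prefixSum f' i :=
  Finset.sum_add_distrib

end PrefixSum

/-! ### CNOT patterns: additivity and change of labels. -/

section Pattern

variable {V : Type} [Fintype V] [DecidableEq V]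

theorem cnotMap_add (src : V → Option V) (x x' : V → Bool) :
    cnotMap src (x + x') = cnotMap src x + cnotMap src x' := by
  funext q
  simp only [cnotMap, Pi.add_apply]
  cases src q with
  | none => simp
  | some c => simp only [Option.elim_some, Pi.add_apply]; exact add_add_add_comm _ _ _ _

/-- A pattern described in terms of other labels `C` of the qubits. -/
def relabelPattern {C : Type} (e : C ≃ V) (src : C → Option C) (q : V) : Option V :=
  (src (e.symm q)).map e

theorem cnotMap_relabelPattern {C : Type} (e : C ≃ V) (src : C → Option C) (x : V → Bool)
    (c : C) : cnotMap (relabelPattern e src) x (e c) =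
      x (e c) + (src c).elim 0 fun d => x (e d) := by
  rw [cnotMap, relabelPattern, Equiv.symm_apply_apply]
  cases src c <;> rfl

theorem isCnotPattern_relabelPattern {G : SimpleGraph V} {C : Type} (e : C ≃ V)
    (src : C → Option C) (adj : ∀ c d, src c = some d → G.Adj (e d) (e c))
    (inj : ∀ c c' d, src c = some d → src c' = some d → c = c')
    (control : ∀ c d, src c = some d → src d = none) :
    IsCnotPattern G (relabelPattern e src) where
  adj q c h := by
    obtain ⟨d, hd, rfl⟩ := Option.map_eq_some_iff.mp h
    simpa using adj _ _ hd
  inj q r c h h' := by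
    obtain ⟨d, hd, rfl⟩ := Option.map_eq_some_iff.mp h
    obtain ⟨d', hd', he⟩ := Option.map_eq_some_iff.mp h'
    obtain rfl := e.injective he
    exact e.symm.injective (inj _ _ _ hd hd')
  control q c h := by
    obtain ⟨d, hd, rfl⟩ := Option.map_eq_some_iff.mp h
    rw [relabelPattern, Equiv.symm_apply_apply, control _ _ hd]
    rfl

end Pattern

/-- The kinds of cells in a block of three rows and two columns. Block `(i, τ)` has a copy of data
bit `i`, and a partial sum `acc` of parity number `τ`. -/
inductive CellKind : Type
  | link | copy | check | acc | idle | spare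
  deriving DecidableEq

namespace CellKind

/-- The position of a cell in its block. -/
def equiv : CellKind ≃ Fin 3 × Fin 2 where
  toFun
    | link => (0, 0)
    | copy => (0, 1)
    | check => (1, 1)
    | acc => (2, 1)
    | idle => (1, 0)
    | spare => (2, 0)
  invFun
    | (0, 0) => link
    | (0, 1) => copy
    | (1, 1) => check
    | (2, 1) => acc
    | (1, 0) => idle
    | (2, 0) => spare
  left_inv := by rintro (_ | _) <;> rfl
  right_inv := by decide

instance : Fintype CellKind := Fintype.ofEquiv _ equiv.symm

theorem univ_eq : (Finset.univ : Finset CellKind) = {link, copy, check, acc, idle, spare} := by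
  ext κ; cases κ <;> simp

theorem sum_eq (f : CellKind → Bool) :
    ∑ κ, f κ = f link + f copy + f check + f acc + f idle + f spare := by
  rw [univ_eq]
  simp [add_assoc]

end CellKind

open CellKind

/-! ### Layout of the cells on the grid, the CNOT patterns and their combined effect. -/

section Grid

variable {N T : ℕ}

/-- The positions of the cells on the grid. -/
def cellEquiv (N T : ℕ) : CellKind × Fin (N + 1) × Fin (T + 1) ≃
    Fin ((N + 1) * 3) × Fin ((T + 1) * 2) where
  toFun c := (finProdFinEquiv (c.2.1, (CellKind.equiv c.1).1),
    finProdFinEquiv (c.2.2, (CellKind.equiv c.1).2))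
  invFun q := (CellKind.equiv.symm ((finProdFinEquiv.symm q.1).2, (finProdFinEquiv.symm q.2).2),
    (finProdFinEquiv.symm q.1).1, (finProdFinEquiv.symm q.2).1)
  left_inv c := by
    simp only [Equiv.symm_apply_apply, Prod.mk.eta]
  right_inv q := by
    simp only [Equiv.apply_symm_apply, Prod.mk.eta]

theorem gridGraph_adj_of_row {c d : CellKind × Fin (N + 1) × Fin (T + 1)}
    (hr : (cellEquiv N T c).1.val = (cellEquiv N T d).1.val)
    (hc : (cellEquiv N T c).2.val + 1 = (cellEquiv N T d).2.val) :
    (gridGraph _ _).Adj (cellEquiv N T c) (cellEquiv N T d) := by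
  rw [SimpleGraph.boxProd_adj]
  exact Or.inr ⟨SimpleGraph.pathGraph_adj.mpr (Or.inl hc), Fin.ext hr⟩

theorem gridGraph_adj_of_col {c d : CellKind × Fin (N + 1) × Fin (T + 1)}
    (hr : (cellEquiv N T c).1.val + 1 = (cellEquiv N T d).1.val)
    (hc : (cellEquiv N T c).2.val = (cellEquiv N T d).2.val) :
    (gridGraph _ _).Adj (cellEquiv N T c) (cellEquiv N T d) := by
  rw [SimpleGraph.boxProd_adj]
  exact Or.inl ⟨SimpleGraph.pathGraph_adj.mpr (Or.inl hr), Fin.ext hc⟩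

theorem cellEquiv_row (c : CellKind × Fin (N + 1) × Fin (T + 1)) :
    (cellEquiv N T c).1.val = (CellKind.equiv c.1).1.val + 3 * c.2.1.val := rfl

theorem cellEquiv_col (c : CellKind × Fin (N + 1) × Fin (T + 1)) :
    (cellEquiv N T c).2.val = (CellKind.equiv c.1).2.val + 2 * c.2.2.val := rfl

abbrev Cell (N T : ℕ) := CellKind × Fin (N + 1) × Fin (T + 1)

/-- These maps send a target to its control. The two patterns with target `link` make this cell
compare the copies of a data bit in adjacent blocks. The copies with `τ = 0` are the data qubits
themselves, so there is no link to the left of them. -/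
def linkFromCopy : Cell N T → Option (Cell N T)
  | (link, i, τ) => if τ = 0 then none else some (copy, i, τ)
  | _ => none

def linkFromPrev : Cell N T → Option (Cell N T)
  | (link, i, τ) => if h : τ = 0 then none else some (copy, i, (τ.pred h).castSucc)
  | _ => none

def checkFromAcc : Cell N T → Option (Cell N T)
  | (check, i, τ) => some (acc, i, τ)
  | _ => none

def checkFromCopy (S : Fin (T + 1) → Fin (N + 1) → Bool) : Cell N T → Option (Cell N T)
  | (check, i, τ) => if S τ i = true then some (copy, i, τ) else none
  | _ => none

/-- The cell `acc` of the preceding block is not adjacent to `check`, but it is adjacent to `copy`,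
which in turn is adjacent to `check`. This pattern is used twice, before and after the copy is read,
so that the copy is restored. -/
def copyFromPrev : Cell N T → Option (Cell N T)
  | (copy, i, τ) => if h : i = 0 then none else some (acc, (i.pred h).castSucc, τ)
  | _ => none

theorem isCnotPattern_linkFromCopy : IsCnotPattern (gridGraph ((N + 1) * 3) ((T + 1) * 2))
    (relabelPattern (cellEquiv N T) linkFromCopy) := by
  refine isCnotPattern_relabelPattern _ _ ?_ ?_ ?_
  · rintro ⟨_ | _, i, τ⟩ d h <;> simp only [linkFromCopy, reduceCtorEq] at h
    split_ifs at h
    obtain rfl := Option.some.inj h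
    exact (gridGraph_adj_of_row (by simp [cellEquiv_row, CellKind.equiv])
      (by simp [cellEquiv_col, CellKind.equiv]; omega)).symm
  · rintro ⟨_ | _, i, τ⟩ ⟨_ | _, i', τ'⟩ d h h' <;> simp only [linkFromCopy, reduceCtorEq] at h h'
    split_ifs at h h'
    have := (Option.some.inj h).trans (Option.some.inj h').symm
    clear h h'
    simp_all
  · rintro ⟨_ | _, i, τ⟩ d h <;> simp only [linkFromCopy, reduceCtorEq] at h
    split_ifs at h
    obtain rfl := Option.some.inj h
    rfl

theorem isCnotPattern_linkFromPrev : IsCnotPattern (gridGraph ((N + 1) * 3) ((T + 1) * 2))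
    (relabelPattern (cellEquiv N T) linkFromPrev) := by
  refine isCnotPattern_relabelPattern _ _ ?_ ?_ ?_
  · rintro ⟨_ | _, i, τ⟩ d h <;> simp only [linkFromPrev, reduceCtorEq] at h
    split_ifs at h with hτ
    obtain rfl := Option.some.inj h
    have : τ.val ≠ 0 := fun e => hτ (Fin.ext e)
    exact gridGraph_adj_of_row (by simp [cellEquiv_row, CellKind.equiv])
      (by simp [cellEquiv_col, CellKind.equiv]; omega)
  · rintro ⟨_ | _, i, τ⟩ ⟨_ | _, i', τ'⟩ d h h' <;> simp only [linkFromPrev, reduceCtorEq] at h h'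
    split_ifs at h h'
    have := (Option.some.inj h).trans (Option.some.inj h').symm
    clear h h'
    simp_all
  · rintro ⟨_ | _, i, τ⟩ d h <;> simp only [linkFromPrev, reduceCtorEq] at h
    split_ifs at h
    obtain rfl := Option.some.inj h
    rfl

theorem isCnotPattern_checkFromAcc : IsCnotPattern (gridGraph ((N + 1) * 3) ((T + 1) * 2))
    (relabelPattern (cellEquiv N T) checkFromAcc) := by
  refine isCnotPattern_relabelPattern _ _ ?_ ?_ ?_
  · rintro ⟨_ | _, i, τ⟩ d h <;> simp only [checkFromAcc, reduceCtorEq] at h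
    obtain rfl := Option.some.inj h
    exact (gridGraph_adj_of_col (by simp [cellEquiv_row, CellKind.equiv]; omega)
      (by simp [cellEquiv_col, CellKind.equiv])).symm
  · rintro ⟨_ | _, i, τ⟩ ⟨_ | _, i', τ'⟩ d h h' <;> simp only [checkFromAcc, reduceCtorEq] at h h'
    have := (Option.some.inj h).trans (Option.some.inj h').symm
    clear h h'
    simp_all
  · rintro ⟨_ | _, i, τ⟩ d h <;> simp only [checkFromAcc, reduceCtorEq] at h
    obtain rfl := Option.some.inj h
    rfl

theorem isCnotPattern_checkFromCopy (S : Fin (T + 1) → Fin (N + 1) → Bool) :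
    IsCnotPattern (gridGraph ((N + 1) * 3) ((T + 1) * 2))
    (relabelPattern (cellEquiv N T) (checkFromCopy S)) := by
  refine isCnotPattern_relabelPattern _ _ ?_ ?_ ?_
  · rintro ⟨_ | _, i, τ⟩ d h <;> simp only [checkFromCopy, reduceCtorEq] at h
    split_ifs at h
    obtain rfl := Option.some.inj h
    exact gridGraph_adj_of_col (by simp [cellEquiv_row, CellKind.equiv]; omega)
      (by simp [cellEquiv_col, CellKind.equiv])
  · rintro ⟨_ | _, i, τ⟩ ⟨_ | _, i', τ'⟩ d h h' <;> simp only [checkFromCopy, reduceCtorEq] at h h'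
    split_ifs at h h'
    have := (Option.some.inj h).trans (Option.some.inj h').symm
    clear h h'
    simp_all
  · rintro ⟨_ | _, i, τ⟩ d h <;> simp only [checkFromCopy, reduceCtorEq] at h
    split_ifs at h
    obtain rfl := Option.some.inj h
    rfl

theorem isCnotPattern_copyFromPrev : IsCnotPattern (gridGraph ((N + 1) * 3) ((T + 1) * 2))
    (relabelPattern (cellEquiv N T) copyFromPrev) := by
  refine isCnotPattern_relabelPattern _ _ ?_ ?_ ?_
  · rintro ⟨_ | _, i, τ⟩ d h <;> simp only [copyFromPrev, reduceCtorEq] at h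
    split_ifs at h with hi
    obtain rfl := Option.some.inj h
    have : i.val ≠ 0 := fun e => hi (Fin.ext e)
    exact gridGraph_adj_of_col (by simp [cellEquiv_row, CellKind.equiv]; omega)
      (by simp [cellEquiv_col, CellKind.equiv])
  · rintro ⟨_ | _, i, τ⟩ ⟨_ | _, i', τ'⟩ d h h' <;> simp only [copyFromPrev, reduceCtorEq] at h h'
    split_ifs at h h'
    have := (Option.some.inj h).trans (Option.some.inj h').symm
    clear h h'
    simp_all
  · rintro ⟨_ | _, i, τ⟩ d h <;> simp only [copyFromPrev, reduceCtorEq] at h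
    split_ifs at h
    obtain rfl := Option.some.inj h
    rfl

/-- The CNOT gates of the gadget. The cells `copy` serve as bridges between the cells `acc` and
`check` of successive blocks. -/
noncomputable def gridSteps (S : Fin (T + 1) → Fin (N + 1) → Bool) (B : Type) :
    List (QStep (gridGraph ((N + 1) * 3) ((T + 1) * 2)) B) :=
  [cnotStep isCnotPattern_linkFromCopy, cnotStep isCnotPattern_linkFromPrev,
    cnotStep isCnotPattern_checkFromAcc,
    -- The passage through the bridge adds the copy to `check` in every block. Adding it once more
    -- where `S` is false cancels it there, so that the term `S τ i * copy` remains.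
    cnotStep (isCnotPattern_checkFromCopy fun τ i => !(S τ i)),
    cnotStep isCnotPattern_copyFromPrev,
    cnotStep (isCnotPattern_checkFromCopy fun _ _ => true),
    cnotStep isCnotPattern_copyFromPrev]

/-- The action of `gridSteps` on basis states. -/
def gridEffect (S : Fin (T + 1) → Fin (N + 1) → Bool)
    (x : Fin ((N + 1) * 3) × Fin ((T + 1) * 2) → Bool) :
    Fin ((N + 1) * 3) × Fin ((T + 1) * 2) → Bool :=
  let ρ := fun src => cnotMap (relabelPattern (cellEquiv N T) src)
  -- Gates act on states by precomposition, so the first step in time is the outermost map.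
  ρ linkFromCopy <| ρ linkFromPrev <| ρ checkFromAcc <| ρ (checkFromCopy fun τ i => !(S τ i)) <|
    ρ copyFromPrev <| ρ (checkFromCopy fun _ _ => true) <| ρ copyFromPrev x

theorem gridSteps_apply (S : Fin (T + 1) → Fin (N + 1) → Bool) {B : Type} (y : B → Bool)
    (ψ : QState (Fin ((N + 1) * 3) × Fin ((T + 1) * 2))) :
    (gridSteps S B).foldl (fun φ S => S.apply y φ) ψ = fun x => ψ (gridEffect S x) := by
  simp only [gridSteps, List.foldl_cons, List.foldl_nil, cnotStep_apply]
  rfl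

theorem gridEffect_add (S : Fin (T + 1) → Fin (N + 1) → Bool)
    (x x' : Fin ((N + 1) * 3) × Fin ((T + 1) * 2) → Bool) :
    gridEffect S (x + x') = gridEffect S x + gridEffect S x' := by
  simp only [gridEffect, cnotMap_add]

/-- The value of `f` at the preceding index, or `0`. -/
def atPrev {n : ℕ} (f : Fin (n + 1) → Bool) (i : Fin (n + 1)) : Bool :=
  if h : i = 0 then 0 else f (i.pred h).castSucc

@[simp] theorem atPrev_zero {n : ℕ} (f : Fin (n + 1) → Bool) : atPrev f 0 = 0 := rfl

@[simp] theorem atPrev_succ {n : ℕ} (f : Fin (n + 1) → Bool) (i : Fin n) :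
    atPrev f i.succ = f i.castSucc := rfl

/-- Prefix sums invert the difference operator that the CNOT gates realize along rows and columns of
blocks; this makes them the solution of all linear systems of the gadget. -/
theorem prefixSum_add_atPrev {n : ℕ} (f : Fin (n + 1) → Bool) (i : Fin (n + 1)) :
    prefixSum f i + atPrev (prefixSum f) i = f i := by
  cases i using Fin.cases with
  | zero => rw [prefixSum_zero, atPrev_zero, add_zero]
  | succ i =>
    rw [prefixSum_succ, atPrev_succ]
    cases prefixSum f i.castSucc <;> cases f i.succ <;> rfl

variable (S : Fin (T + 1) → Fin (N + 1) → Bool)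
  (x : Fin ((N + 1) * 3) × Fin ((T + 1) * 2) → Bool)

theorem gridEffect_check (i : Fin (N + 1)) (τ : Fin (T + 1)) :
    gridEffect S x (cellEquiv N T (check, i, τ)) = x (cellEquiv N T (check, i, τ)) +
      x (cellEquiv N T (acc, i, τ)) + atPrev (fun i => x (cellEquiv N T (acc, i, τ))) i +
      S τ i * x (cellEquiv N T (copy, i, τ)) := by
  cases i using Fin.cases <;> cases h : S τ _ <;>
    simp [gridEffect, cnotMap_relabelPattern, linkFromCopy, linkFromPrev, checkFromAcc,
      checkFromCopy, copyFromPrev, h]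
  all_goals
    simp only [Bool.add_eq_xor, Bool.mul_eq_and]
    generalize x _ = a
    generalize x _ = b
    generalize x _ = c
    try generalize x _ = d
    decide +revert

theorem gridEffect_link (i : Fin (N + 1)) (τ : Fin (T + 1)) (hτ : τ ≠ 0) :
    gridEffect S x (cellEquiv N T (link, i, τ)) = x (cellEquiv N T (link, i, τ)) +
      x (cellEquiv N T (copy, i, τ)) + atPrev (fun τ => x (cellEquiv N T (copy, i, τ))) τ := by
  cases τ using Fin.cases with
  | zero => exact absurd rfl hτ
  | succ τ =>
    cases i using Fin.cases <;>
    simp [gridEffect, cnotMap_relabelPattern, linkFromCopy, linkFromPrev, checkFromAcc,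
      checkFromCopy, copyFromPrev]
    all_goals
      simp only [Bool.add_eq_xor]
      generalize x _ = a
      generalize x _ = b
      generalize x _ = c
      try generalize x _ = d
      try generalize x _ = e
      decide +revert

theorem gridEffect_copy (i : Fin (N + 1)) (τ : Fin (T + 1)) :
    gridEffect S x (cellEquiv N T (copy, i, τ)) = x (cellEquiv N T (copy, i, τ)) := by
  cases i using Fin.cases <;>
  simp [gridEffect, cnotMap_relabelPattern, linkFromCopy, linkFromPrev, checkFromAcc,
    checkFromCopy, copyFromPrev]
  rw [add_assoc]
  exact add_eq_left.mpr (Bool.xor_self _)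

theorem gridEffect_of_ne (c : Cell N T) (h : c.1 ≠ check) (h' : c.1 = link → c.2.2 = 0) :
    gridEffect S x (cellEquiv N T c) = x (cellEquiv N T c) := by
  obtain ⟨κ, i, τ⟩ := c
  cases κ
  · obtain rfl : τ = 0 := h' rfl
    simp [gridEffect, cnotMap_relabelPattern, linkFromCopy, linkFromPrev, checkFromAcc,
      checkFromCopy, copyFromPrev]
  · exact gridEffect_copy S x i τ
  · exact absurd rfl h
  all_goals simp [gridEffect, cnotMap_relabelPattern, linkFromCopy, linkFromPrev, checkFromAcc,
      checkFromCopy, copyFromPrev]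

end Grid

open CellKind

/-! ### Corrections and ancilla values on the grid, assembled into a gadget. -/

section GridGadget

variable {N T : ℕ} (S : Fin (T + 1) → Fin (N + 1) → Bool)

/-- The grid on which `T + 1` parities of `N + 1` data qubits are computed. -/
abbrev gridVertex (N T : ℕ) : Type := Fin ((N + 1) * 3) × Fin ((T + 1) * 2)

theorem sum_cells {M : Type*} [AddCommMonoid M] (f : gridVertex N T → M) :
    ∑ q, f q = ∑ κ, ∑ i, ∑ τ, f (cellEquiv N T (κ, i, τ)) := by
  rw [← (cellEquiv N T).sum_comp, Fintype.sum_prod_type]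
  exact Finset.sum_congr rfl fun κ _ => Fintype.sum_prod_type _

/-- The bit flip of a copy after the first measurement. -/
def fixCopy (m : gridVertex N T → Bool) (i : Fin (N + 1)) : Fin (T + 1) → Bool :=
  prefixSum fun τ => if τ = 0 then 0 else m (cellEquiv N T (link, i, τ))

/-- The bit flip of a partial parity after the first measurement. -/
def fixAcc (m : gridVertex N T → Bool) (τ : Fin (T + 1)) : Fin (N + 1) → Bool :=
  prefixSum fun i => m (cellEquiv N T (check, i, τ)) + S τ i * fixCopy m i τ

/-- The bit flips after the first measurement. -/
def fixCell (m : gridVertex N T → Bool) : Cell N T → Bool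
  | (link, i, τ) => if τ = 0 then 0 else m (cellEquiv N T (link, i, τ))
  | (copy, i, τ) => fixCopy m i τ
  | (check, i, τ) => m (cellEquiv N T (check, i, τ))
  | (acc, i, τ) => fixAcc S m τ i
  | _ => 0

/-- The corrections after the second measurement. -/
def backCell (h : gridVertex N T → Bool) : Cell N T → Bool
  | (copy, i, τ) => if τ = 0 then
      ∑ σ, ((if σ = 0 then 0 else h (cellEquiv N T (copy, i, σ))) +
        S σ i * ∑ j, if i ≤ j then h (cellEquiv N T (acc, j, σ)) else 0)
      else h (cellEquiv N T (copy, i, τ))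
  | (acc, i, τ) => h (cellEquiv N T (acc, i, τ))
  | _ => 0

/-- The values of the ancillas. -/
def linCell (z : Fin (N + 1) → Bool) : Cell N T → Bool
  | (copy, i, _) => z i
  | (acc, i, τ) => prefixSum (fun j => S τ j * z j) i
  | _ => 0

theorem fixCopy_add (m m' : gridVertex N T → Bool) (i : Fin (N + 1)) (τ : Fin (T + 1)) :
    fixCopy (m + m') i τ = fixCopy m i τ + fixCopy m' i τ := by
  rw [fixCopy, fixCopy, fixCopy, ← prefixSum_add]
  congr 1
  funext σ
  split_ifs <;> rfl

theorem fixAcc_add (m m' : gridVertex N T → Bool) (i : Fin (N + 1)) (τ : Fin (T + 1)) :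
    fixAcc S (m + m') τ i = fixAcc S m τ i + fixAcc S m' τ i := by
  rw [fixAcc, fixAcc, fixAcc, ← prefixSum_add]
  congr 1
  funext j
  rw [fixCopy_add, mul_add, Pi.add_apply]
  exact add_add_add_comm _ _ _ _

theorem fixCell_add (m m' : gridVertex N T → Bool) (c : Cell N T) :
    fixCell S (m + m') c = fixCell S m c + fixCell S m' c := by
  obtain ⟨κ, i, τ⟩ := c
  cases κ
  · simp only [fixCell]; split_ifs <;> rfl
  · exact fixCopy_add m m' i τ
  · rfl
  · exact fixAcc_add S m m' i τ
  · rfl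
  · rfl

theorem backCell_add (m m' : gridVertex N T → Bool) (c : Cell N T) :
    backCell S (m + m') c = backCell S m c + backCell S m' c := by
  obtain ⟨κ, i, τ⟩ := c
  cases κ
  case copy =>
    simp only [backCell]
    split_ifs
    · rw [← Finset.sum_add_distrib]
      refine Finset.sum_congr rfl fun σ _ => ?_
      rw [add_add_add_comm, ← mul_add, ← Finset.sum_add_distrib]
      congr 1
      · split_ifs <;> rfl
      · congr 1
        refine Finset.sum_congr rfl fun j _ => ?_
        split_ifs <;> rfl
    · rfl
  all_goals rfl

/-- Whether a cell is an ancilla. -/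
def IsAncCell (c : Cell N T) : Prop := (c.1 = copy ∧ c.2.2 ≠ 0) ∨ c.1 = acc

/-- Whether a cell is measured first. -/
def IsMeasCell (c : Cell N T) : Prop := (c.1 = link ∧ c.2.2 ≠ 0) ∨ c.1 = check

instance : DecidablePred (IsAncCell (N := N) (T := T)) := fun _ => by
  unfold IsAncCell; infer_instance

instance : DecidablePred (IsMeasCell (N := N) (T := T)) := fun _ => by
  unfold IsMeasCell; infer_instance

/-- The ancillas. -/
def gridAnc (N T : ℕ) : Finset (gridVertex N T) :=
  Finset.univ.filter fun q => IsAncCell ((cellEquiv N T).symm q)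

/-- The qubits measured first. -/
def gridMeas (N T : ℕ) : Finset (gridVertex N T) :=
  Finset.univ.filter fun q => IsMeasCell ((cellEquiv N T).symm q)

@[simp] theorem cellEquiv_mem_gridAnc (c : Cell N T) :
    cellEquiv N T c ∈ gridAnc N T ↔ IsAncCell c := by simp [gridAnc]

@[simp] theorem cellEquiv_mem_gridMeas (c : Cell N T) :
    cellEquiv N T c ∈ gridMeas N T ↔ IsMeasCell c := by simp [gridMeas]

theorem forall_gridVertex {p : gridVertex N T → Prop} :
    (∀ q, p q) ↔ ∀ c, p (cellEquiv N T c) :=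
  (cellEquiv N T).surjective.forall

/-- The positions of the data qubits. -/
def gridData (N T : ℕ) : Fin (N + 1) ↪ gridVertex N T where
  toFun i := cellEquiv N T (copy, i, 0)
  inj' i j h := by simpa using (cellEquiv N T).injective h

theorem gridData_apply (i : Fin (N + 1)) : gridData N T i = cellEquiv N T (copy, i, 0) := rfl

/-- The positions of the parities. -/
def gridAcc (N T : ℕ) : Fin (T + 1) ↪ gridVertex N T where
  toFun τ := cellEquiv N T (acc, Fin.last N, τ)
  inj' i j h := by simpa using (cellEquiv N T).injective h

theorem gridAcc_apply (τ : Fin (T + 1)) :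
    gridAcc N T τ = cellEquiv N T (acc, Fin.last N, τ) := rfl

/-- The effect on `link` and `check` adds to them a difference of consecutive copies or partial
sums. The flips are prefix sums, so by `prefixSum_add_atPrev` these differences reproduce the
outcomes and cancel them. -/
theorem gridEffect_fixCell (m : gridVertex N T → Bool) (c : Cell N T) (hc : IsMeasCell c) :
    gridEffect S (fun q => fixCell S m ((cellEquiv N T).symm q)) (cellEquiv N T c) = false := by
  obtain ⟨κ, i, τ⟩ := c
  rcases hc with ⟨rfl, hτ⟩ | rfl
  · rw [gridEffect_link _ _ _ _ hτ]
    simp only [Equiv.symm_apply_apply, fixCell, if_neg hτ]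
    have h := prefixSum_add_atPrev (fun τ => if τ = 0 then 0 else m (cellEquiv N T (link, i, τ))) τ
    simp only [if_neg hτ] at h
    rw [add_assoc]
    change _ + (fixCopy m i τ + atPrev (fixCopy m i) τ) = _
    rw [fixCopy, h]
    exact Bool.xor_self _
  · rw [gridEffect_check]
    simp only [Equiv.symm_apply_apply, fixCell]
    have h := prefixSum_add_atPrev
      (fun i => m (cellEquiv N T (check, i, τ)) + S τ i * fixCopy m i τ) i
    rw [add_assoc (m _)]
    change _ + (fixAcc S m τ i + atPrev (fixAcc S m τ) i) + _ = _
    rw [fixAcc, h]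
    generalize m _ = a
    generalize S τ i * _ = b
    cases a <;> cases b <;> rfl

/-- With the measured qubits zero, the links say that consecutive copies agree, and the checks that
`acc` grows by `S τ i * copy` from one block to the next. Induction along the columns and along the
rows of blocks solves these recursions. -/
theorem gridEffect_solve (x : gridVertex N T → Bool)
    (hx : ∀ c, IsMeasCell c → x (cellEquiv N T c) = false) :
    (∀ c, IsMeasCell c → gridEffect S x (cellEquiv N T c) = false) ↔
      ∀ c, IsAncCell c → x (cellEquiv N T c) =
        linCell S (fun i => x (cellEquiv N T (copy, i, 0))) c := by
  have hlink : ∀ i τ, τ ≠ 0 → gridEffect S x (cellEquiv N T (link, i, τ)) =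
      x (cellEquiv N T (copy, i, τ)) + atPrev (fun τ => x (cellEquiv N T (copy, i, τ))) τ := by
    intro i τ hτ
    rw [gridEffect_link _ _ _ _ hτ, hx _ (Or.inl ⟨rfl, hτ⟩)]
    exact congrArg (· + _) (zero_add _)
  have hcheck : ∀ i τ, gridEffect S x (cellEquiv N T (check, i, τ)) =
      x (cellEquiv N T (acc, i, τ)) + atPrev (fun i => x (cellEquiv N T (acc, i, τ))) i +
      S τ i * x (cellEquiv N T (copy, i, τ)) := by
    intro i τ
    rw [gridEffect_check, hx _ (Or.inr rfl)]
    exact congrArg (· + _ + _) (zero_add _)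
  have hsum : ∀ a b : Bool, a + b = false ↔ a = b := by decide
  constructor
  · intro h
    have hcopy : ∀ i τ, x (cellEquiv N T (copy, i, τ)) = x (cellEquiv N T (copy, i, 0)) := by
      intro i τ
      induction τ using Fin.induction with
      | zero => rfl
      | succ τ ih =>
        have := h (link, i, τ.succ) (Or.inl ⟨rfl, Fin.succ_ne_zero τ⟩)
        rw [hlink _ _ (Fin.succ_ne_zero τ), atPrev_succ, hsum] at this
        rw [this, ih]
    have hacc : ∀ i τ, x (cellEquiv N T (acc, i, τ)) =
        prefixSum (fun j => S τ j * x (cellEquiv N T (copy, j, 0))) i := by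
      intro i τ
      induction i using Fin.induction with
      | zero =>
        have := h (check, 0, τ) (Or.inr rfl)
        rw [hcheck, atPrev_zero, add_zero, hsum, hcopy] at this
        rw [this, prefixSum_zero]
      | succ i ih =>
        have := h (check, i.succ, τ) (Or.inr rfl)
        rw [hcheck, atPrev_succ, add_assoc, hsum, hcopy] at this
        rw [this, prefixSum_succ, ih]
    rintro ⟨κ, i, τ⟩ (⟨rfl, hτ⟩ | rfl)
    · exact hcopy i τ
    · exact hacc i τ
  · intro h
    have hcopy : ∀ i τ, x (cellEquiv N T (copy, i, τ)) = x (cellEquiv N T (copy, i, 0)) := by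
      intro i τ
      by_cases hτ : τ = 0
      · rw [hτ]
      · exact h (copy, i, τ) (Or.inl ⟨rfl, hτ⟩)
    have hacc : ∀ τ, (fun i => x (cellEquiv N T (acc, i, τ))) =
        prefixSum (fun j => S τ j * x (cellEquiv N T (copy, j, 0))) :=
      fun τ => funext fun i => h (acc, i, τ) (Or.inr rfl)
    rintro ⟨κ, i, τ⟩ (⟨rfl, hτ⟩ | rfl)
    · rw [hlink i τ hτ, hsum]
      cases τ using Fin.cases with
      | zero => exact absurd rfl hτ
      | succ τ => rw [atPrev_succ, hcopy, hcopy i τ.castSucc]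
    · rw [hcheck, hcopy, hacc, congrFun (hacc τ) i, prefixSum_add_atPrev]
      exact Bool.xor_self _

/-- Exchange of summation: the data bit `z i` occurs in all its copies and in exactly those partial
sums `acc` with index `j ≥ i`, which gives the coefficient in `backCell`. -/
theorem sum_anc_mul_linCell (h : gridVertex N T → Bool) (z : Fin (N + 1) → Bool) :
    ∑ q ∈ gridAnc N T, h q * linCell S z ((cellEquiv N T).symm q) =
      ∑ i, backCell S h (copy, i, 0) * z i := by
  rw [gridAnc, Finset.sum_filter, sum_cells, CellKind.sum_eq]
  simp only [Equiv.symm_apply_apply, IsAncCell, reduceCtorEq, false_and, or_self, if_false,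
    Finset.sum_const_zero, true_and, or_false, add_zero, zero_add, or_true, if_true, linCell,
    backCell, ne_eq]
  simp only [Finset.sum_mul, add_mul, Finset.sum_add_distrib]
  congr 1
  · refine Finset.sum_congr rfl fun i _ => Finset.sum_congr rfl fun τ _ => ?_
    by_cases hτ : τ = 0 <;> simp [hτ]
  · simp only [prefixSum, Finset.mul_sum, Finset.sum_mul]
    rw [Finset.sum_comm]
    have : ∀ τ i, (∑ j ∈ Finset.Iic i, h (cellEquiv N T (acc, i, τ)) * (S τ j * z j)) =
        ∑ j, S τ j * (if j ≤ i then h (cellEquiv N T (acc, i, τ)) else 0) * z j := by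
      intro τ i
      rw [← Finset.sum_subset (Finset.subset_univ (Finset.Iic i))]
      · refine Finset.sum_congr rfl fun j hj => ?_
        rw [if_pos (Finset.mem_Iic.mp hj)]
        ring
      · intro j _ hj
        rw [if_neg fun e => hj (Finset.mem_Iic.mpr e)]
        ring
    simp only [this]
    conv_rhs => rw [Finset.sum_comm]
    exact Finset.sum_congr rfl fun τ _ => Finset.sum_comm

/-- The gadget on the grid for arbitrary parities. -/
noncomputable def gridGadget : PhaseGadget (gridGraph ((N + 1) * 3) ((T + 1) * 2))
    (fun (τ : Fin (T + 1)) (z : Fin (N + 1) → Bool) => ∑ i, S τ i * z i) where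
  data := gridData N T
  anc := gridAnc N T
  meas := gridMeas N T
  steps := gridSteps S _
  effect := gridEffect S
  steps_apply := gridSteps_apply S
  effect_add := gridEffect_add S
  effect_of_not_mem x := by
    rw [forall_gridVertex]
    intro c hc
    rw [cellEquiv_mem_gridMeas, IsMeasCell, not_or, not_and, not_not] at hc
    exact gridEffect_of_ne S x c hc.2 hc.1
  data_not_mem_anc i := by simp [gridData_apply, IsAncCell]
  data_not_mem_meas i := by simp [gridData_apply, IsMeasCell]
  disjoint := by
    rw [Finset.disjoint_left, forall_gridVertex]
    rintro ⟨κ, i, τ⟩ h h'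
    rw [cellEquiv_mem_gridAnc] at h
    rw [cellEquiv_mem_gridMeas] at h'
    rcases h with ⟨rfl, h⟩ | rfl <;> rcases h' with ⟨h', -⟩ | h' <;> cases h'
  fix :=
    { toFun m q := fixCell S m ((cellEquiv N T).symm q)
      map_zero' := by
        have := fixCell_add S (N := N) (T := T) 0 0
        simp only [add_zero] at this
        funext q
        exact left_eq_add.mp (this _)
      map_add' m m' := funext fun q => fixCell_add S m m' _ }
  fix_of_mem m := by
    rw [forall_gridVertex]
    rintro ⟨κ, i, τ⟩ h
    rw [cellEquiv_mem_gridMeas] at h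
    rcases h with ⟨rfl, h⟩ | rfl
    · simp only [AddMonoidHom.coe_mk, ZeroHom.coe_mk, Equiv.symm_apply_apply, fixCell]
      exact if_neg h
    · simp [fixCell]
  fix_of_not_mem m := by
    rw [forall_gridVertex]
    rintro ⟨κ, i, τ⟩ h h'
    rw [cellEquiv_mem_gridMeas] at h
    rw [cellEquiv_mem_gridAnc] at h'
    simp only [AddMonoidHom.coe_mk, ZeroHom.coe_mk, Equiv.symm_apply_apply]
    cases κ <;> simp [IsMeasCell, IsAncCell] at h h'
    · subst h; rfl
    · subst h'
      simp only [fixCell, fixCopy, prefixSum_zero]; rfl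
    · rfl
    · rfl
  effect_fix m := by
    rw [forall_gridVertex]
    intro c hc
    exact gridEffect_fixCell S m c (by simpa using hc)
  lin z q := linCell S z ((cellEquiv N T).symm q)
  solve x := by
    simp only [forall_gridVertex, cellEquiv_mem_gridMeas, cellEquiv_mem_gridAnc,
      Equiv.symm_apply_apply]
    exact gridEffect_solve S x
  back :=
    { toFun h q := backCell S h ((cellEquiv N T).symm q)
      map_zero' := by
        have := backCell_add S (N := N) (T := T) 0 0
        simp only [add_zero] at this
        funext q
        exact left_eq_add.mp (this _)
      map_add' m m' := funext fun q => backCell_add S m m' _ }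
  back_of_mem m := by
    rw [forall_gridVertex]
    rintro ⟨κ, i, τ⟩ h
    rw [cellEquiv_mem_gridAnc] at h
    rcases h with ⟨rfl, h⟩ | rfl
    · simp only [AddMonoidHom.coe_mk, ZeroHom.coe_mk, Equiv.symm_apply_apply, backCell]
      exact if_neg h
    · simp [backCell]
  back_of_not_mem m := by
    rw [forall_gridVertex]
    rintro ⟨κ, i, τ⟩ h h'
    rw [cellEquiv_mem_gridAnc] at h
    simp only [AddMonoidHom.coe_mk, ZeroHom.coe_mk, Equiv.symm_apply_apply]
    cases κ <;> simp [IsAncCell] at h <;> try rfl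
    subst h
    exact absurd ⟨i, rfl⟩ h'
  back_data h z := by
    rw [sum_anc_mul_linCell]
    simp [gridData_apply]
  acc := gridAcc N T
  acc_mem τ := by simp [gridAcc_apply, IsAncCell]
  lin_acc τ z := by
    rw [gridAcc_apply, Equiv.symm_apply_apply]
    exact prefixSum_last _

end GridGadget

/-! ### Circuits of single-qubit gates and cubic phases without locality constraints -/

/-- Single-qubit gates, followed by the sign `(-1) ^ ∑ x t * x a * x b`, where the sum extends over
the triples `(t, a, b)` in `cubic`. -/
structure CubicLayer (Λ : Type) : Type where
  gate : Λ → Matrix.unitaryGroup Bool ℂ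
  cubic : Λ → Λ → Λ → Bool

section Logical

variable {Λ : Type} [Fintype Λ] [DecidableEq Λ]

/-- Triples with repeated entries are allowed. Since bits are idempotent, they provide the terms of
degree one and two. -/
def cubicSum (E : Λ → Λ → Λ → Bool) (z : Λ → Bool) : Bool :=
  ∑ t, ∑ a, ∑ b, E t a b * (z t * z a * z b)

namespace CubicLayer

/-- The action of a layer on states. -/
def apply (l : CubicLayer Λ) (φ : QState Λ) : QState Λ :=
  fun z => boolSign (cubicSum l.cubic z) *
    localMap (fun i => (l.gate i : Matrix Bool Bool ℂ)) φ z

/-- The action of a sequence of layers on states. -/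
def run (ls : List (CubicLayer Λ)) (φ : QState Λ) : QState Λ :=
  ls.foldl (fun φ l => l.apply φ) φ

theorem apply_smul (l : CubicLayer Λ) (c : ℂ) (φ : QState Λ) :
    l.apply (c • φ) = c • l.apply φ := by
  funext z
  rw [apply, localMap_smul, Pi.smul_apply, Pi.smul_apply, apply, smul_eq_mul, smul_eq_mul]
  ring

theorem run_smul (c : ℂ) : ∀ (ls : List (CubicLayer Λ)) (φ : QState Λ),
    run ls (c • φ) = c • run ls φ
  | [], _ => rfl
  | l :: ls, φ => by
    have := run_smul c ls (l.apply φ)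
    rwa [← apply_smul] at this

theorem run_append (ls ls' : List (CubicLayer Λ)) (φ : QState Λ) :
    run (ls ++ ls') φ = run ls' (run ls φ) := List.foldl_append

end CubicLayer

/-- The parities from which the sign of a triple is composed. -/
def tripleParity (θ : (Λ × Λ × Λ) × Bool × Bool × Bool) (z : Λ → Bool) : Bool :=
  θ.2.1 * z θ.1.1 + θ.2.2.1 * z θ.1.2.1 + θ.2.2.2 * z θ.1.2.2

/-- A primitive eighth root of unity. -/
noncomputable def eighthRoot : unitary ℂ :=
  ⟨rootHalf * (1 + Complex.I), by
    have h2 : (starRingEnd ℂ) rootHalf = rootHalf := Complex.conj_ofReal _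
    rw [Unitary.mem_iff_self_mul_star]
    simp only [star_mul', star_add, star_one, Complex.star_def, Complex.conj_I, h2]
    linear_combination (1 + Complex.I) * (1 - Complex.I) * rootHalf_mul_self -
      1 / 2 * Complex.I_mul_I⟩

theorem eighthRoot_pow_four : (eighthRoot : ℂ) ^ 4 = -1 := by
  change (rootHalf * (1 + Complex.I)) ^ 4 = -1
  have h1 : (1 + Complex.I) ^ 4 = -4 := by
    linear_combination (Complex.I ^ 2 + 4 * Complex.I + 5) * Complex.I_mul_I
  have h2 : rootHalf ^ 4 = 1 / 4 := by
    linear_combination (rootHalf * rootHalf + 1 / 2) * rootHalf_mul_self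
  rw [mul_pow, h1, h2]
  norm_num

/-- The phases of the parities of a triple. -/
noncomputable def maskPhase (μ : Bool × Bool × Bool) : unitary ℂ :=
  if μ = (false, false, false) then 1
  else if μ.1 + μ.2.1 + μ.2.2 = true then eighthRoot else star eighthRoot

/-- Over the integers, `4xyz = x + y + z - (x ⊕ y) - (x ⊕ z) - (y ⊕ z) + (x ⊕ y ⊕ z)`. Masks of odd
weight enter with sign plus, nonempty ones of even weight with sign minus, and the fourth power of
the eighth root is `-1`. -/
theorem prod_maskPhase (x y z : Bool) :
    (∏ μ : Bool × Bool × Bool, if μ.1 * x + μ.2.1 * y + μ.2.2 * z = true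
      then (maskPhase μ : ℂ) else 1) = boolSign (x * y * z) := by
  have h1 : (eighthRoot : ℂ) * star (eighthRoot : ℂ) = 1 :=
    Unitary.mul_star_self_of_mem eighthRoot.2
  have h4 := eighthRoot_pow_four
  simp only [Fintype.prod_prod_type, Fintype.prod_bool]
  cases x <;> cases y <;> cases z <;>
    simp [maskPhase, Bool.mul_eq_and, Bool.add_eq_xor]
  all_goals first
    | linear_combination h4
    | (simp only [Complex.star_def] at h1
       linear_combination (eighthRoot * (starRingEnd ℂ) eighthRoot + 1 : ℂ) * h1)

/-- The phases of the parities for a set of triples. -/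
noncomputable def cubicPhase (E : Λ → Λ → Λ → Bool) (θ : (Λ × Λ × Λ) × Bool × Bool × Bool) :
    unitary ℂ :=
  if E θ.1.1 θ.1.2.1 θ.1.2.2 = true then maskPhase θ.2 else 1

theorem prod_cubicPhase (E : Λ → Λ → Λ → Bool) (z : Λ → Bool) :
    (∏ θ, if tripleParity θ z = true then (cubicPhase E θ : ℂ) else 1) =
      boolSign (cubicSum E z) := by
  rw [Fintype.prod_prod_type, Fintype.prod_prod_type, cubicSum, boolSign_sum]
  refine Finset.prod_congr rfl fun t _ => ?_
  rw [Fintype.prod_prod_type, boolSign_sum]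
  refine Finset.prod_congr rfl fun a _ => ?_
  rw [boolSign_sum]
  refine Finset.prod_congr rfl fun b _ => ?_
  cases h : E t a b
  · rw [show (false : Bool) = 0 from rfl, zero_mul, boolSign_zero]
    refine Finset.prod_eq_one fun μ _ => ?_
    simp [cubicPhase, h]
  · rw [show (true : Bool) = 1 from rfl, one_mul, ← prod_maskPhase]
    refine Finset.prod_congr rfl fun μ _ => ?_
    simp only [cubicPhase, h, tripleParity]
    rfl

end Logical

/-- A gadget with other labels of data and parities. -/
def PhaseGadget.relabel {V : Type} [Fintype V] [DecidableEq V] {G : SimpleGraph V}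
    {Λ Θ Λ' Θ' : Type} [Fintype Λ] [Fintype Λ'] {parity : Θ → (Λ → Bool) → Bool}
    {parity' : Θ' → (Λ' → Bool) → Bool} (g : PhaseGadget G parity) (e : Λ' ≃ Λ) (f : Θ' ≃ Θ)
    (hp : ∀ θ z, parity (f θ) (fun i => z (e.symm i)) = parity' θ z) : PhaseGadget G parity' where
  data := e.toEmbedding.trans g.data
  anc := g.anc
  meas := g.meas
  steps := g.steps
  effect := g.effect
  steps_apply := g.steps_apply
  effect_add := g.effect_add
  effect_of_not_mem := g.effect_of_not_mem
  data_not_mem_anc i := g.data_not_mem_anc _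
  data_not_mem_meas i := g.data_not_mem_meas _
  disjoint := g.disjoint
  fix := g.fix
  fix_of_mem := g.fix_of_mem
  fix_of_not_mem := g.fix_of_not_mem
  effect_fix := g.effect_fix
  lin z := g.lin fun i => z (e.symm i)
  solve x hx := by simpa using g.solve x hx
  back := g.back
  back_of_mem := g.back_of_mem
  back_of_not_mem h q hq hq' := g.back_of_not_mem h q hq <| by
    rintro ⟨i, rfl⟩
    exact hq' ⟨e.symm i, by simp⟩
  back_data h z := by
    rw [g.back_data, ← e.sum_comp]
    simp
  acc := f.toEmbedding.trans g.acc
  acc_mem θ := g.acc_mem _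
  lin_acc θ z := by
    rw [← hp]
    exact g.lin_acc _ _

/-! ### Compilation of layers into alternations. -/

section Compile

variable {Λ : Type} [Fintype Λ] [DecidableEq Λ] {V : Type} [Fintype V] [DecidableEq V]
  {G : SimpleGraph V} (g : PhaseGadget G (tripleParity (Λ := Λ)))

/-- The alternations which perform a sequence of layers, starting with alternation number `j`. -/
noncomputable def compileLayers : List (CubicLayer Λ) → ℕ → List (Alternation G)
  | [], _ => []
  | l :: ls, j => g.alternations l.gate (cubicPhase l.cubic) j ++ compileLayers ls (j + 3)

/-- The record `r` is arbitrary because each gadget reads only outcomes of its own alternations;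
hence the layers can be treated one after the other. -/
theorem run_compileLayers (o : ℕ → V → Bool) : ∀ (ls : List (CubicLayer Λ)) (j : ℕ)
    (r : ℕ × V → Bool) (φ : QState Λ), ∃ c : ℂ,
    Alternation.run o (compileLayers g ls j) j r (embedState g.data φ) =
      c • embedState g.data (CubicLayer.run ls φ)
  | [], _, _, φ => ⟨1, by rw [one_smul]; rfl⟩
  | l :: ls, j, r, φ => by
    obtain ⟨r', hr⟩ := g.run_alternations l.gate (cubicPhase l.cubic) o
      (compileLayers g ls (j + 3)) j r φ
    have hφ : (fun z => g.phase (cubicPhase l.cubic) z *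
        localMap (fun i => (l.gate i : Matrix Bool Bool ℂ)) φ z) = l.apply φ := by
      funext z
      rw [PhaseGadget.phase, prod_cubicPhase, CubicLayer.apply]
    obtain ⟨c, hc⟩ := run_compileLayers o ls (j + 3) r' ((g.amplitude * g.amplitude) • l.apply φ)
    refine ⟨c * (g.amplitude * g.amplitude), ?_⟩
    rw [compileLayers, hr, hφ, hc, CubicLayer.run_smul, embedState_smul, smul_smul]
    rfl

theorem length_compileLayers : ∀ (ls : List (CubicLayer Λ)) (j : ℕ),
    (compileLayers g ls j).length = 3 * ls.length
  | [], _ => rfl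
  | l :: ls, j => by
    rw [compileLayers, List.length_append, length_compileLayers ls, List.length_cons]
    simp only [PhaseGadget.alternations, List.length_cons, List.length_nil]
    ring

theorem mem_compileLayers : ∀ (ls : List (CubicLayer Λ)) (j : ℕ), ∀ A ∈ compileLayers g ls j,
    ∃ U w j', A ∈ g.alternations U w j'
  | [], _, A, hA => by simp [compileLayers] at hA
  | l :: ls, j, A, hA => by
    rw [compileLayers, List.mem_append] at hA
    rcases hA with hA | hA
    · exact ⟨_, _, _, hA⟩
    · exact mem_compileLayers ls _ A hA

theorem alternations_bounds (U : Λ → Matrix.unitaryGroup Bool ℂ)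
    (w : (Λ × Λ × Λ) × Bool × Bool × Bool → unitary ℂ) (j : ℕ) (A : Alternation G)
    (hA : A ∈ g.alternations U w j) :
    A.quantum.length ≤ g.steps.length + 3 ∧
    A.conventional.depth ≤ 3 * Nat.clog 2 (Fintype.card V) + 1 ∧
    A.conventional.size ≤ 6 * (Fintype.card V * 2 ^ Nat.clog 2 (Fintype.card V)) := by
  simp only [PhaseGadget.alternations, List.mem_cons, List.not_mem_nil, or_false] at hA
  rcases hA with rfl | rfl | rfl
  · simp [PhaseGadget.couple, BoolCircuit.depth, BoolCircuit.size]
  · exact ⟨by simp [PhaseGadget.accumulate], (linearCircuit_depth (V := V) _ _).le,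
      linearCircuit_size_le (V := V) _ _⟩
  · exact ⟨by simp [PhaseGadget.restore], (linearCircuit_depth (V := V) _ _).le,
      linearCircuit_size_le (V := V) _ _⟩

theorem zeroState_eq_embedState (data : Λ ↪ V) :
    zeroState V = embedState data (zeroState Λ) := by
  classical
  funext x
  simp only [zeroState, embedState]
  by_cases h : ∀ q, x q = false
  · simp [h]
  · rw [if_neg h]
    split_ifs with h1 h2
    · refine absurd (fun q => ?_) h
      by_cases hq : q ∈ Set.range data
      · obtain ⟨i, rfl⟩ := hq; exact h2 i
      · exact h1 q hq
    · rfl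
    · rfl

theorem embedState_withAncillas (data : Λ ↪ V) {n : ℕ} (out : Fin n ↪ Λ) (ψ : QState (Fin n)) :
    embedState data (withAncillas out ψ) = withAncillas (out.trans data) ψ := by
  classical
  funext x
  simp only [embedState, withAncillas]
  have h : (∀ q, q ∉ Set.range (out.trans data) → x q = false) ↔
      (∀ q, q ∉ Set.range data → x q = false) ∧ ∀ i, i ∉ Set.range out → x (data i) = false := by
    constructor
    · intro h
      refine ⟨fun q hq => h q ?_, fun i hi => h _ ?_⟩
      · rintro ⟨k, rfl⟩; exact hq ⟨_, rfl⟩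
      · rintro ⟨k, hk⟩; exact hi ⟨k, data.injective hk⟩
    · rintro ⟨h1, h2⟩ q hq
      by_cases hq' : q ∈ Set.range data
      · obtain ⟨i, rfl⟩ := hq'
        refine h2 i ?_
        rintro ⟨k, rfl⟩; exact hq ⟨k, rfl⟩
      · exact h1 q hq'
  simp only [h]
  split_ifs <;> simp_all

theorem prepares_compileLayers {n : ℕ} (out : Fin n ↪ Λ) (ψ : QState (Fin n))
    (ls : List (CubicLayer Λ)) (h : CubicLayer.run ls (zeroState Λ) = withAncillas out ψ) :
    Prepares (compileLayers g ls 0) ψ := by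
  refine ⟨out.trans g.data, fun o => ?_⟩
  obtain ⟨c, hc⟩ := run_compileLayers g o ls 0 (fun _ => false) (zeroState Λ)
  refine ⟨c, fun x => ?_⟩
  rw [finalState, zeroState_eq_embedState g.data, hc, h, embedState_withAncillas]
  rfl

end Compile

theorem two_pow_clog_le {m : ℕ} (hm : 0 < m) : 2 ^ Nat.clog 2 m ≤ 2 * m := by
  rcases Nat.lt_or_ge 1 m with h | h
  · have := Nat.pow_pred_clog_lt_self (b := 2) (by norm_num) h
    have hpos : 0 < Nat.clog 2 m := Nat.clog_pos (by norm_num) h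
    rw [← Nat.succ_pred_eq_of_pos hpos, pow_succ]
    simp only [Nat.pred_eq_sub_one] at *
    omega
  · obtain rfl : m = 1 := by omega
    simp

/-- Every sequence of layers on `m` qubits is performed by an alternating circuit on a grid of
`48 * m ^ 4` qubits. -/
theorem exists_laqCircuit (Λ : Type) [Fintype Λ] [DecidableEq Λ] [Nonempty Λ]
    (ls : List (CubicLayer Λ)) : ∃ C : LAQCircuit,
    C.numQubits = 48 * Fintype.card Λ ^ 4 ∧
    C.alternations.length = 3 * ls.length ∧
    (∀ A ∈ C.alternations, A.quantum.length ≤ 10 ∧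
      A.conventional.depth ≤ 3 * Nat.clog 2 (48 * Fintype.card Λ ^ 4) + 1 ∧
      A.conventional.size ≤ 12 * (48 * Fintype.card Λ ^ 4) ^ 2) ∧
    ∀ {n : ℕ} (out : Fin n ↪ Λ) (ψ : QState (Fin n)),
      CubicLayer.run ls (zeroState Λ) = withAncillas out ψ → Prepares C.alternations ψ := by
  obtain ⟨N, hN⟩ := Nat.exists_eq_succ_of_ne_zero (Fintype.card_ne_zero (α := Λ))
  obtain ⟨T, hT⟩ := Nat.exists_eq_succ_of_ne_zero
    (Fintype.card_ne_zero (α := (Λ × Λ × Λ) × Bool × Bool × Bool))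
  let e : Λ ≃ Fin (N + 1) := Fintype.equivFinOfCardEq hN
  let f : (Λ × Λ × Λ) × Bool × Bool × Bool ≃ Fin (T + 1) := Fintype.equivFinOfCardEq hT
  -- The coefficient of a data bit is a sum of indicators modulo two, so repeated entries of a
  -- triple cancel just as they do in `tripleParity`.
  let S : Fin (T + 1) → Fin (N + 1) → Bool := fun τ i =>
    (f.symm τ).2.1 * (if i = e (f.symm τ).1.1 then 1 else 0) +
    (f.symm τ).2.2.1 * (if i = e (f.symm τ).1.2.1 then 1 else 0) +
    (f.symm τ).2.2.2 * (if i = e (f.symm τ).1.2.2 then 1 else 0)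
  let g : PhaseGadget (gridGraph ((N + 1) * 3) ((T + 1) * 2)) (tripleParity (Λ := Λ)) :=
    (gridGadget S).relabel e f (by
      intro θ z
      simp [S, tripleParity, add_mul, Finset.sum_add_distrib])
  have hT' : T + 1 = 8 * Fintype.card Λ ^ 3 := by
    rw [← Nat.succ_eq_add_one, ← hT]
    simp only [Fintype.card_prod, Fintype.card_bool]
    ring
  -- Three rows per data qubit, two columns per parity, and eight parities for each of the `card Λ ^
  -- 3` triples.
  have hV : ((N + 1) * 3) * ((T + 1) * 2) = 48 * Fintype.card Λ ^ 4 := by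
    rw [hT', ← Nat.succ_eq_add_one, ← hN]; ring
  have hcard : Fintype.card (gridVertex N T) = 48 * Fintype.card Λ ^ 4 := by
    rw [Fintype.card_prod, Fintype.card_fin, Fintype.card_fin, hV]
  refine ⟨⟨(N + 1) * 3, (T + 1) * 2, compileLayers g ls 0⟩, hV, length_compileLayers g ls 0,
    ?_, fun out ψ h => prepares_compileLayers g out ψ ls h⟩
  intro A hA
  obtain ⟨U, w, j, hA⟩ := mem_compileLayers g ls 0 A hA
  obtain ⟨h1, h2, h3⟩ := alternations_bounds g U w j A hA
  rw [hcard] at h2 h3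
  -- The quantum depth `10` consists of the seven CNOT steps of `gridSteps` and at most three steps
  -- of single-qubit gates.
  refine ⟨h1, h2, h3.trans ?_⟩
  have := two_pow_clog_le (m := 48 * Fintype.card Λ ^ 4)
    (by have := Fintype.card_pos (α := Λ); positivity)
  calc _ ≤ 6 * (48 * Fintype.card Λ ^ 4 * (2 * (48 * Fintype.card Λ ^ 4))) := by gcongr
    _ = _ := by ring

/-! ### Quadratic maps on basis states -/

section LocalMapMul

variable {Λ : Type} [Fintype Λ] [DecidableEq Λ]

theorem localMap_mul (A B : Λ → Matrix Bool Bool ℂ) (φ : QState Λ) :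
    localMap A (localMap B φ) = localMap (fun q => A q * B q) φ := by
  funext x
  simp only [localMap, Finset.mul_sum]
  rw [Finset.sum_comm]
  refine Finset.sum_congr rfl fun y _ => ?_
  simp only [Matrix.mul_apply, Fintype.prod_sum, Finset.sum_mul]
  refine Finset.sum_congr rfl fun z _ => ?_
  rw [Finset.prod_mul_distrib, mul_assoc]

/-- Where the map is the identity on a qubit, the summation variable must agree with `x`. Thus
qubits outside `T` may be treated as constants, which turns controlled gates into products of
single-qubit ones. -/
theorem localMap_congr_of_agree (T : Finset Λ) (A : Λ → Matrix Bool Bool ℂ)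
    (hA : ∀ q ∉ T, A q = 1) (φ φ' : QState Λ) (x : Λ → Bool)
    (h : ∀ y : Λ → Bool, (∀ q ∉ T, y q = x q) → φ y = φ' y) :
    localMap A φ x = localMap A φ' x := by
  refine Finset.sum_congr rfl fun y _ => ?_
  by_cases hy : ∀ q ∉ T, y q = x q
  · rw [h y hy]
  · push Not at hy
    obtain ⟨q, hq, hne⟩ := hy
    rw [Finset.prod_eq_zero (Finset.mem_univ q), zero_mul, zero_mul]
    rw [hA q hq, Matrix.one_apply_ne hne.symm]

theorem localMap_prod (A : Λ → Matrix Bool Bool ℂ) (k : Λ → Bool → ℂ) (x : Λ → Bool) :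
    localMap A (fun y => ∏ q, k q (y q)) x = ∏ q, ∑ b, A q (x q) b * k q b := by
  rw [localMap, Fintype.prod_sum]
  exact Finset.sum_congr rfl fun y _ => Finset.prod_mul_distrib.symm

theorem localMap_zeroState (A : Λ → Matrix Bool Bool ℂ) (x : Λ → Bool) :
    localMap A (zeroState Λ) x = ∏ q, A q (x q) false := by
  rw [localMap, Finset.sum_eq_single fun _ => false]
  · simp [zeroState]
  · intro y _ hy
    rw [zeroState, if_neg, mul_zero]
    exact fun h => hy (funext h)
  · simp

end LocalMapMul

/-- The map on basis states which adds quadratic polynomials of other qubits to the qubits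
`tgt k`. -/
structure QuadStep (Λ : Type) : Type 1 where
  {ι R : Type}
  [fintypeι : Fintype ι]
  [decEqι : DecidableEq ι]
  [fintypeR : Fintype R]
  tgt : ι ↪ Λ
  const : ι → Bool
  coef : ι → R → Bool
  left : ι → R → Λ
  right : ι → R → Λ
  left_ne : ∀ k r k', left k r ≠ tgt k'
  right_ne : ∀ k r k', right k r ≠ tgt k'

namespace QuadStep

attribute [instance] fintypeι decEqι fintypeR

variable {Λ : Type} [Fintype Λ] [DecidableEq Λ] (s : QuadStep Λ)

/-- The polynomial which is added to the qubit `tgt k`. -/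
def poly (k : s.ι) (z : Λ → Bool) : Bool :=
  s.const k + ∑ r, s.coef k r * (z (s.left k r) * z (s.right k r))

/-- The map on basis states. -/
def map (z : Λ → Bool) : Λ → Bool :=
  fun q => z q + ∑ k, if s.tgt k = q then s.poly k z else 0

theorem map_tgt (z : Λ → Bool) (k : s.ι) : s.map z (s.tgt k) = z (s.tgt k) + s.poly k z := by
  rw [map, Finset.sum_eq_single k]
  · rw [if_pos rfl]
  · intro k' _ hk'
    rw [if_neg fun e => hk' (s.tgt.injective e)]
  · simp

theorem map_of_ne (z : Λ → Bool) {q : Λ} (hq : ∀ k, s.tgt k ≠ q) : s.map z q = z q := by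
  rw [map, Finset.sum_eq_zero, add_zero]
  intro k _
  rw [if_neg (hq k)]

theorem poly_congr {z z' : Λ → Bool} (h : ∀ q, (∀ k, s.tgt k ≠ q) → z q = z' q) (k : s.ι) :
    s.poly k z = s.poly k z' := by
  rw [poly, poly]
  congr 1
  refine Finset.sum_congr rfl fun r _ => ?_
  rw [h _ fun k' e => s.left_ne k r k' e.symm, h _ fun k' e => s.right_ne k r k' e.symm]

/-- The polynomials do not read the targets, so the second application adds the same values and
cancels the first. -/
theorem map_map (z : Λ → Bool) : s.map (s.map z) = z := by
  funext q
  by_cases hq : ∃ k, s.tgt k = q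
  · obtain ⟨k, rfl⟩ := hq
    rw [map_tgt, map_tgt, s.poly_congr fun q hq => s.map_of_ne z hq]
    cases z (s.tgt k) <;> cases s.poly k z <;> rfl
  · have hq' : ∀ k, s.tgt k ≠ q := fun k e => hq ⟨k, e⟩
    rw [map_of_ne _ _ hq', map_of_ne _ _ hq']

/-- The triples of qubits whose cubic phases give the quadratic map in the Hadamard basis. -/
def cubic (t a b : Λ) : Bool :=
  ∑ k, ((if s.tgt k = t ∧ s.tgt k = a ∧ s.tgt k = b then s.const k else 0) +
    ∑ r, if s.tgt k = t ∧ s.left k r = a ∧ s.right k r = b then s.coef k r else 0)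

theorem sum_triple_eq (t' a' b' : Λ) (c : Bool) (f : Λ → Λ → Λ → Bool) :
    ∑ t, ∑ a, ∑ b, (if t' = t ∧ a' = a ∧ b' = b then c else 0) * f t a b = c * f t' a' b' := by
  rw [Finset.sum_eq_single t' _ (by simp), Finset.sum_eq_single a' _ (by simp),
    Finset.sum_eq_single b' _ (by simp)]
  · simp
  · intro b _ hb
    rw [if_neg fun h => hb h.2.2.symm, zero_mul]
  · intro a _ ha
    refine Finset.sum_eq_zero fun b _ => ?_
    rw [if_neg fun h => ha h.2.1.symm, zero_mul]
  · intro t _ ht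
    refine Finset.sum_eq_zero fun a _ => Finset.sum_eq_zero fun b _ => ?_
    rw [if_neg fun h => ht h.1.symm, zero_mul]

/-- The constant term of a polynomial comes from the triple with all entries `tgt k`, as the cube of
a bit is the bit. -/
theorem cubicSum_cubic (z : Λ → Bool) :
    cubicSum s.cubic z = ∑ k, z (s.tgt k) * s.poly k z := by
  have h : cubicSum s.cubic z = ∑ k, ((∑ t, ∑ a, ∑ b,
      (if s.tgt k = t ∧ s.tgt k = a ∧ s.tgt k = b then s.const k else 0) * (z t * z a * z b)) +
      ∑ r, ∑ t, ∑ a, ∑ b, (if s.tgt k = t ∧ s.left k r = a ∧ s.right k r = b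
        then s.coef k r else 0) * (z t * z a * z b)) := by
    simp only [cubicSum, cubic, Finset.sum_mul, add_mul, Finset.sum_add_distrib]
    congr 1
    · simp only [Finset.sum_comm (s := (Finset.univ : Finset Λ)) (t := (Finset.univ : Finset s.ι))]
    · simp only [Finset.sum_comm (s := (Finset.univ : Finset Λ)) (t := (Finset.univ : Finset s.ι)),
        Finset.sum_comm (s := (Finset.univ : Finset Λ)) (t := (Finset.univ : Finset s.R))]
  rw [h]
  refine Finset.sum_congr rfl fun k _ => ?_
  rw [sum_triple_eq, poly, mul_add, Finset.mul_sum]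
  congr 1
  · cases z (s.tgt k) <;> cases s.const k <;> rfl
  · refine Finset.sum_congr rfl fun r _ => ?_
    rw [sum_triple_eq]
    ring

open Classical in
/-- The gates `U k` on the qubits `tgt k`. -/
noncomputable def targetGate (U : s.ι → Matrix.unitaryGroup Bool ℂ) (q : Λ) :
    Matrix.unitaryGroup Bool ℂ :=
  if h : ∃ k, s.tgt k = q then U h.choose else 1

theorem targetGate_tgt (U : s.ι → Matrix.unitaryGroup Bool ℂ) (k : s.ι) :
    s.targetGate U (s.tgt k) = U k := by
  have h : ∃ k', s.tgt k' = s.tgt k := ⟨k, rfl⟩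
  rw [targetGate, dif_pos h, s.tgt.injective h.choose_spec]

theorem targetGate_of_ne (U : s.ι → Matrix.unitaryGroup Bool ℂ) {q : Λ}
    (hq : ∀ k, s.tgt k ≠ q) : s.targetGate U q = 1 :=
  dif_neg fun ⟨k, hk⟩ => hq k hk

/-- The cubic phases of the step between the gates `U` and `U'` on the targets. -/
noncomputable def sandwich (U U' : s.ι → Matrix.unitaryGroup Bool ℂ) : List (CubicLayer Λ) :=
  [⟨s.targetGate U, s.cubic⟩, ⟨s.targetGate U', fun _ _ _ => false⟩]

-- The cubic sign is the product over `k` of the signs of `z (tgt k) * poly k z`. The polynomials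
-- ignore the targets, so once the other qubits are fixed at `x` each factor is a diagonal gate on a
-- single target, and the whole is a product map. The matrices `W` may therefore depend on `x`.
open Classical in
theorem run_sandwich (U U' : s.ι → Matrix.unitaryGroup Bool ℂ) (φ : QState Λ) (x : Λ → Bool)
    (W : Λ → Matrix Bool Bool ℂ) (hW : ∀ k, W (s.tgt k) = (U' k : Matrix Bool Bool ℂ) *
      Matrix.diagonal (fun b => boolSign (b * s.poly k x)) * (U k : Matrix Bool Bool ℂ))
    (hW' : ∀ q, (∀ k, s.tgt k ≠ q) → W q = 1) :
    CubicLayer.run (s.sandwich U U') φ x = localMap W φ x := by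
  let D : Λ → Bool → ℂ := fun q b => ∏ k, if s.tgt k = q then boolSign (b * s.poly k x) else 1
  have hD : ∀ k, D (s.tgt k) = fun b => boolSign (b * s.poly k x) := by
    intro k
    funext b
    simp only [D]
    rw [Finset.prod_eq_single k]
    · simp
    · intro k' _ hk'
      rw [if_neg fun e => hk' (s.tgt.injective e)]
    · simp
  have hD' : ∀ q, (∀ k, s.tgt k ≠ q) → D q = fun _ => 1 := by
    intro q hq
    funext b
    exact Finset.prod_eq_one fun k _ => if_neg (hq k)
  have h0 : ∀ z : Λ → Bool, cubicSum (fun _ _ _ => false) z = 0 := by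
    intro z
    refine Finset.sum_eq_zero fun _ _ => Finset.sum_eq_zero fun _ _ =>
      Finset.sum_eq_zero fun _ _ => zero_mul _
  simp only [sandwich, CubicLayer.run, List.foldl_cons, List.foldl_nil]
  rw [CubicLayer.apply]
  simp only [h0, boolSign_zero, one_mul]
  rw [localMap_congr_of_agree (Finset.univ.map s.tgt) _ _ _
    (localMap (fun q => Matrix.diagonal (D q))
      (localMap (fun q => (s.targetGate U q : Matrix Bool Bool ℂ)) φ)), localMap_mul,
    localMap_mul]
  · congr 1
    funext q
    by_cases hq : ∃ k, s.tgt k = q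
    · obtain ⟨k, rfl⟩ := hq
      rw [hW, hD, targetGate_tgt, targetGate_tgt]
    · have hq' : ∀ k, s.tgt k ≠ q := fun k e => hq ⟨k, e⟩
      rw [hW' q hq', hD' q hq', targetGate_of_ne _ _ hq', targetGate_of_ne _ _ hq']
      simp
  · intro y hy
    rw [CubicLayer.apply, localMap_diagonal, cubicSum_cubic, boolSign_sum]
    simp only [D]
    rw [Finset.prod_comm]
    congr 1
    refine Finset.prod_congr rfl fun k _ => ?_
    rw [Finset.prod_eq_single (s.tgt k)]
    · rw [if_pos rfl, s.poly_congr (z' := x)]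
      intro q hq
      exact hy q (by simpa using hq)
    · intro q _ hq
      rw [if_neg fun e => hq e.symm]
    · simp
  · intro q hq
    rw [targetGate_of_ne]
    · rfl
    · intro k e
      exact hq (by simp [← e])

/-- The layers which perform the quadratic map. -/
noncomputable def layers : List (CubicLayer Λ) :=
  s.sandwich (fun _ => ⟨hadamard, hadamard_mem⟩) fun _ => ⟨hadamard, hadamard_mem⟩

/-- Conjugation by the Hadamard gate turns the sign gate into a bit flip, so target `k` is flipped
precisely if `poly k` is one. -/
theorem run_layers (φ : QState Λ) : CubicLayer.run s.layers φ = fun z => φ (s.map z) := by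
  funext x
  rw [layers, s.run_sandwich _ _ _ _ (fun q => if (∑ k, if s.tgt k = q then s.poly k x else 0) = true
    then notMatrix else 1), localMap_not]
  · rfl
  · intro k
    rw [Finset.sum_eq_single k]
    · rw [if_pos rfl]
      have h := rootHalf_mul_self
      ext a b
      cases s.poly k x <;> cases a <;> cases b <;>
        simp [notMatrix, Matrix.mul_apply, hadamard_apply, Bool.mul_eq_and,
          Matrix.diagonal_apply, h]
      all_goals norm_num
    · intro k' _ hk'
      rw [if_neg fun e => hk' (s.tgt.injective e)]
    · simp
  · intro q hq
    rw [Finset.sum_eq_zero fun k _ => if_neg (hq k)]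
    rfl

/-- The layers of a sequence of steps. -/
noncomputable def program (ss : List (QuadStep Λ)) : List (CubicLayer Λ) := ss.flatMap layers

/-- The composition of the maps of a sequence of steps, the last one being applied first. -/
def mapAll (ss : List (QuadStep Λ)) (z : Λ → Bool) : Λ → Bool :=
  ss.foldr (fun s z => s.map z) z

theorem run_program : ∀ (ss : List (QuadStep Λ)) (φ : QState Λ),
    CubicLayer.run (program ss) φ = fun z => φ (mapAll ss z)
  | [], _ => rfl
  | s :: ss, φ => by
    rw [program, List.flatMap_cons, CubicLayer.run_append, run_layers]
    exact run_program ss _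

theorem mapAll_append (ss ss' : List (QuadStep Λ)) (z : Λ → Bool) :
    mapAll (ss ++ ss') z = mapAll ss (mapAll ss' z) := List.foldr_append

theorem mapAll_mapAll_reverse : ∀ (ss : List (QuadStep Λ)) (z : Λ → Bool),
    mapAll ss (mapAll ss.reverse z) = z
  | [], _ => rfl
  | s :: ss, z => by
    rw [List.reverse_cons, mapAll_append]
    change s.map (mapAll ss (mapAll ss.reverse (s.map z))) = z
    rw [mapAll_mapAll_reverse, map_map]

theorem length_program (ss : List (QuadStep Λ)) : (program ss).length = 2 * ss.length := by
  induction ss with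
  | nil => rfl
  | cons s ss ih =>
    rw [program, List.flatMap_cons, List.length_append, ← program, ih, List.length_cons]
    simp only [layers, sandwich, List.length_cons, List.length_nil]
    ring

end QuadStep

/-! ### The registers -/

/-- The qubits of the preparation of Dicke states: the output bits; for each position `i` and each
number `s` of preceding ones a coin which decides about bit number `i`; the transition
matrices of segments of `2 ^ l` positions up to `i`; and for each `i` the number of preceding ones
in unary one-hot encoding. -/
inductive DickeReg (n L : ℕ) : Type
  | bit (i : Fin n)
  | coin (i : Fin n) (s : Fin (n + 1))
  | seg (l : Fin (L + 1)) (i : Fin n) (s t : Fin (n + 1))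
  | pos (i : Fin n) (s : Fin (n + 1))
  deriving DecidableEq

namespace DickeReg

variable {n L : ℕ}

/-- The registers as a sum type. -/
def equivSum : DickeReg n L ≃ Fin n ⊕ (Fin n × Fin (n + 1)) ⊕
    (Fin (L + 1) × Fin n × Fin (n + 1) × Fin (n + 1)) ⊕ (Fin n × Fin (n + 1)) where
  toFun
    | bit i => .inl i
    | coin i s => .inr (.inl (i, s))
    | seg l i s t => .inr (.inr (.inl (l, i, s, t)))
    | pos i s => .inr (.inr (.inr (i, s)))
  invFun
    | .inl i => bit i
    | .inr (.inl (i, s)) => coin i s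
    | .inr (.inr (.inl (l, i, s, t))) => seg l i s t
    | .inr (.inr (.inr (i, s))) => pos i s
  left_inv := by rintro (_ | _) <;> rfl
  right_inv := by rintro (_ | _ | _ | _) <;> rfl

instance : Fintype (DickeReg n L) := Fintype.ofEquiv _ equivSum.symm

theorem card_eq : Fintype.card (DickeReg n L) =
    n + (n * (n + 1) + ((L + 1) * (n * ((n + 1) * (n + 1))) + n * (n + 1))) := by
  rw [Fintype.card_congr equivSum]
  simp [Fintype.card_sum, Fintype.card_prod]

def bitEmb : Fin n ↪ DickeReg n L := ⟨bit, fun i j h => by simpa using h⟩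

def coinEmb : Fin n × Fin (n + 1) ↪ DickeReg n L :=
  ⟨fun k => coin k.1 k.2, fun i j h => by simpa [Prod.ext_iff] using h⟩

def posEmb : Fin n × Fin (n + 1) ↪ DickeReg n L :=
  ⟨fun k => pos k.1 k.2, fun i j h => by simpa [Prod.ext_iff] using h⟩

def segEmb (l : Fin (L + 1)) : Fin n × Fin (n + 1) × Fin (n + 1) ↪ DickeReg n L :=
  ⟨fun k => seg l k.1 k.2.1 k.2.2, fun i j h => by simpa [Prod.ext_iff] using h⟩

theorem bitEmb_apply (i : Fin n) : bitEmb (L := L) i = bit i := rfl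

theorem coinEmb_apply (k : Fin n × Fin (n + 1)) : coinEmb (L := L) k = coin k.1 k.2 := rfl

theorem posEmb_apply (k : Fin n × Fin (n + 1)) : posEmb (L := L) k = pos k.1 k.2 := rfl

theorem segEmb_apply (l : Fin (L + 1)) (k : Fin n × Fin (n + 1) × Fin (n + 1)) :
    segEmb l k = seg l k.1 k.2.1 k.2.2 := rfl

/-- Index `i` moved back by `d`, but not below the first index. -/
def backBy (i : Fin n) (d : ℕ) : Fin n := ⟨i - d, by omega⟩

/-- The transition matrices of segments of length one. -/
def initStep (n L : ℕ) : QuadStep (DickeReg n L) where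
  ι := Fin n × Fin (n + 1) × Fin (n + 1)
  R := Unit
  tgt := segEmb 0
  -- In characteristic two the entry is `[s = t] + c * ([s = t] + [s + 1 = t])`: stay if the coin
  -- `c` is zero, advance if it is one. No coin precedes the first position, where the matrix is the
  -- identity. Taking the same qubit on the left and on the right yields a linear term.
  const k := decide (k.2.1 = k.2.2)
  coef k _ := if k.1.val = 0 then 0 else decide (k.2.1 = k.2.2) + decide (k.2.1 + 1 = k.2.2)
  left k _ := coin (backBy k.1 1) k.2.1
  right k _ := coin (backBy k.1 1) k.2.1
  left_ne _ _ _ := by simp [segEmb_apply]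
  right_ne _ _ _ := by simp [segEmb_apply]

/-- The transition matrices of segments of doubled length. -/
def mulStep (l : Fin L) : QuadStep (DickeReg n L) where
  ι := Fin n × Fin (n + 1) × Fin (n + 1)
  R := Fin (n + 1)
  tgt := segEmb l.succ
  const _ := 0
  coef _ _ := 1
  left k r := seg l.castSucc (backBy k.1 (2 ^ l.val)) k.2.1 r
  right k r := seg l.castSucc k.1 r k.2.2
  left_ne _ _ _ := by simp [segEmb_apply, Fin.ext_iff]
  right_ne _ _ _ := by simp [segEmb_apply, Fin.ext_iff]

/-- The numbers of preceding ones. -/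
def posStep (n L : ℕ) : QuadStep (DickeReg n L) where
  ι := Fin n × Fin (n + 1)
  R := Unit
  tgt := posEmb
  const _ := 0
  coef _ _ := 1
  left k _ := seg (Fin.last L) k.1 0 k.2
  right k _ := seg (Fin.last L) k.1 0 k.2
  left_ne _ _ _ := by simp [posEmb_apply]
  right_ne _ _ _ := by simp [posEmb_apply]

/-- The bits chosen by the coins. -/
def bitStep (n L : ℕ) : QuadStep (DickeReg n L) where
  ι := Fin n
  R := Fin (n + 1)
  tgt := bitEmb
  const _ := 0
  coef _ _ := 1
  left i s := pos i s
  right i s := coin i s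
  left_ne _ _ _ := by simp [bitEmb_apply]
  right_ne _ _ _ := by simp [bitEmb_apply]

/-- Erasure of the coins which have been used. -/
def clearStep (n L : ℕ) : QuadStep (DickeReg n L) where
  ι := Fin n × Fin (n + 1)
  R := Unit
  tgt := coinEmb
  const _ := 0
  coef _ _ := 1
  left k _ := pos k.1 k.2
  right k _ := bit k.1
  left_ne _ _ _ := by simp [coinEmb_apply]
  right_ne _ _ _ := by simp [coinEmb_apply]

/-- Copies of the bits in place of the coins. -/
def copyStep (n L : ℕ) : QuadStep (DickeReg n L) where
  ι := Fin n × Fin (n + 1)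
  R := Unit
  tgt := coinEmb
  const _ := 0
  coef _ _ := 1
  left k _ := bit k.1
  right k _ := bit k.1
  left_ne _ _ _ := by simp [coinEmb_apply]
  right_ne _ _ _ := by simp [coinEmb_apply]

/-- The coupling of each coin to the corresponding qubit `pos`. -/
def controlStep (n L : ℕ) : QuadStep (DickeReg n L) where
  ι := Fin n × Fin (n + 1)
  R := Unit
  tgt := coinEmb
  const _ := 0
  coef _ _ := 1
  left k _ := pos k.1 k.2
  right k _ := pos k.1 k.2
  left_ne _ _ _ := by simp [coinEmb_apply]
  right_ne _ _ _ := by simp [coinEmb_apply]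

/-! ### The number of preceding ones -/

/-- The entries of the transition matrices for given coins. -/
def segEntry (c : Fin n → Fin (n + 1) → Bool) : ℕ → Fin n → Fin (n + 1) → Fin (n + 1) → Bool
  | 0, i, s, t => decide (s = t) + (if i.val = 0 then 0
      else decide (s = t) + decide (s + 1 = t)) * c (backBy i 1) s
  | l + 1, i, s, t => ∑ r, segEntry c l (backBy i (2 ^ l)) s r * segEntry c l i r t

/-- The number of ones before position `i`, if the coins are used for their choice. -/
def path (c : Fin n → Fin (n + 1) → Bool) : ℕ → Fin (n + 1)
  | 0 => 0
  | i + 1 => path c i + if h : i < n then (if c ⟨i, h⟩ (path c i) = true then 1 else 0) else 0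

/-- The row of the value reached at the start of a segment is the unit vector of the value reached
at its end, so in the product only the summand at the intermediate value survives. Truncated
subtraction lets segments start no earlier than position zero, consistently with `backBy`. -/
theorem segEntry_path (c : Fin n → Fin (n + 1) → Bool) (l : ℕ) : ∀ (i : Fin n) (t : Fin (n + 1)),
    segEntry c l i (path c (i - 2 ^ l)) t = decide (path c i = t) := by
  induction l with
  | zero =>
    intro i t
    rw [segEntry, pow_zero]
    by_cases hi : i.val = 0
    · rw [if_pos hi, zero_mul, add_zero, hi, Nat.zero_sub]
    · obtain ⟨j, hj⟩ := Nat.exists_eq_succ_of_ne_zero hi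
      have hjn : j < n := by omega
      have hb : backBy i 1 = ⟨j, hjn⟩ := Fin.ext (by simp [backBy, hj])
      rw [if_neg hi, hb, hj, Nat.succ_eq_add_one, Nat.add_sub_cancel, path, dif_pos hjn]
      cases c ⟨j, hjn⟩ (path c j)
      · rw [show (false : Bool) = 0 from rfl, mul_zero, add_zero]
        simp
      · rw [show (true : Bool) = 1 from rfl, mul_one]
        generalize decide (path c j = t) = a
        simp only [if_true]
        generalize decide (path c j + 1 = t) = b
        cases a <;> cases b <;> rfl
  | succ l ih =>
    intro i t
    rw [segEntry, Finset.sum_eq_single (path c (i - 2 ^ l))]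
    · have h1 := ih (backBy i (2 ^ l)) (path c (i - 2 ^ l))
      have h2 : (backBy i (2 ^ l)).val - 2 ^ l = i.val - 2 ^ (l + 1) := by
        simp only [backBy]; rw [pow_succ]; omega
      rw [h2] at h1
      rw [h1, ih, show (backBy i (2 ^ l)).val = i.val - 2 ^ l from rfl, decide_eq_true rfl]
      exact one_mul _
    · intro r _ hr
      have h1 := ih (backBy i (2 ^ l)) r
      have h2 : (backBy i (2 ^ l)).val - 2 ^ l = i.val - 2 ^ (l + 1) := by
        simp only [backBy]; rw [pow_succ]; omega
      rw [h2] at h1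
      rw [h1, decide_eq_false (fun e => hr e.symm)]
      exact zero_mul _
    · simp

/-- Only the coins met along the path matter. This is what permits coins to be erased or replaced by
copies of the bits. -/
theorem path_congr (c c' : Fin n → Fin (n + 1) → Bool)
    (h : ∀ i : Fin n, c i (path c i) = c' i (path c i)) (i : ℕ) : path c i = path c' i := by
  induction i with
  | zero => rfl
  | succ i ih =>
    rw [path, path, ← ih]
    by_cases hi : i < n
    · rw [dif_pos hi, dif_pos hi, h ⟨i, hi⟩]
    · rw [dif_neg hi, dif_neg hi]

/-- The one-hot encoding of `path`. -/
def onPath (c : Fin n → Fin (n + 1) → Bool) (i : Fin n) (s : Fin (n + 1)) : Bool :=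
  decide (path c i = s)

/-! ### The computation of the numbers of preceding ones -/

/-- The computation of the transition matrices of segments of length up to `2 ^ m`. -/
def segSteps (n : ℕ) {L : ℕ} : (m : ℕ) → m ≤ L → List (QuadStep (DickeReg n L))
  | 0, _ => [initStep n L]
  | m + 1, h => segSteps n m (Nat.le_of_succ_le h) ++ [mulStep ⟨m, h⟩]

/-- The assignment `z` with the correct transition matrices. -/
def fillSeg (m : ℕ) (z : DickeReg n L → Bool) : DickeReg n L → Bool
  | seg l i s t => if l.val ≤ m then segEntry (fun i s => z (coin i s)) l i s t
      else z (seg l i s t)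
  | q => z q

theorem initStep_map_seg (z : DickeReg n L → Bool) (i : Fin n) (s t : Fin (n + 1)) :
    (initStep n L).map z (seg 0 i s t) = z (seg 0 i s t) + (decide (s = t) + (if i.val = 0 then 0
      else decide (s = t) + decide (s + 1 = t)) * z (coin (backBy i 1) s)) := by
  have h : (initStep n L).map z (seg 0 i s t) = z (seg 0 i s t) + (decide (s = t) +
      ∑ _r : Unit, (if i.val = 0 then 0 else decide (s = t) + decide (s + 1 = t)) *
        (z (coin (backBy i 1) s) * z (coin (backBy i 1) s))) :=
    (initStep n L).map_tgt z (i, s, t)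
  rw [h, Fintype.sum_unique, BooleanRing.mul_self]

theorem mulStep_map_seg (l : Fin L) (z : DickeReg n L → Bool) (i : Fin n) (s t : Fin (n + 1)) :
    (mulStep l).map z (seg l.succ i s t) = z (seg l.succ i s t) +
      ∑ r, z (seg l.castSucc (backBy i (2 ^ l.val)) s r) * z (seg l.castSucc i r t) := by
  have h : (mulStep l).map z (seg l.succ i s t) = z (seg l.succ i s t) + (0 + ∑ r : Fin (n + 1),
      1 * (z (seg l.castSucc (backBy i (2 ^ l.val)) s r) * z (seg l.castSucc i r t))) :=
    (mulStep l).map_tgt z (i, s, t)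
  simpa only [zero_add, one_mul] using h

theorem posStep_map_pos (z : DickeReg n L → Bool) (i : Fin n) (s : Fin (n + 1)) :
    (posStep n L).map z (pos i s) = z (pos i s) + z (seg (Fin.last L) i 0 s) := by
  have h : (posStep n L).map z (pos i s) = z (pos i s) + (0 + ∑ _r : Unit,
      1 * (z (seg (Fin.last L) i 0 s) * z (seg (Fin.last L) i 0 s))) :=
    (posStep n L).map_tgt z (i, s)
  simpa only [zero_add, one_mul, Fintype.sum_unique, BooleanRing.mul_self] using h

theorem bitStep_map_bit (z : DickeReg n L → Bool) (i : Fin n) :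
    (bitStep n L).map z (bit i) = z (bit i) + ∑ s, z (pos i s) * z (coin i s) := by
  have h : (bitStep n L).map z (bit i) = z (bit i) + (0 + ∑ s : Fin (n + 1),
      1 * (z (pos i s) * z (coin i s))) := (bitStep n L).map_tgt z i
  simpa only [zero_add, one_mul] using h

theorem clearStep_map_coin (z : DickeReg n L → Bool) (i : Fin n) (s : Fin (n + 1)) :
    (clearStep n L).map z (coin i s) = z (coin i s) + z (pos i s) * z (bit i) := by
  have h : (clearStep n L).map z (coin i s) = z (coin i s) + (0 + ∑ _r : Unit,
      1 * (z (pos i s) * z (bit i))) := (clearStep n L).map_tgt z (i, s)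
  simpa only [zero_add, one_mul, Fintype.sum_unique] using h

theorem copyStep_map_coin (z : DickeReg n L → Bool) (i : Fin n) (s : Fin (n + 1)) :
    (copyStep n L).map z (coin i s) = z (coin i s) + z (bit i) := by
  have h : (copyStep n L).map z (coin i s) = z (coin i s) + (0 + ∑ _r : Unit,
      1 * (z (bit i) * z (bit i))) := (copyStep n L).map_tgt z (i, s)
  simpa only [zero_add, one_mul, Fintype.sum_unique, BooleanRing.mul_self] using h

theorem controlStep_poly (z : DickeReg n L → Bool) (k : Fin n × Fin (n + 1)) :
    (controlStep n L).poly k z = z (pos k.1 k.2) := by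
  have h : (controlStep n L).poly k z = 0 + ∑ _r : Unit,
      1 * (z (pos k.1 k.2) * z (pos k.1 k.2)) := rfl
  simpa only [zero_add, one_mul, Fintype.sum_unique, BooleanRing.mul_self] using h

theorem map_initStep (z : DickeReg n L → Bool) (hz : ∀ l i s t, z (seg l i s t) = false) :
    (initStep n L).map z = fillSeg 0 z := by
  funext q
  cases q with
  | seg l i s t =>
    by_cases hl : l = 0
    · subst hl
      rw [initStep_map_seg, hz]
      refine (zero_add _).trans ?_
      simp only [fillSeg, Fin.val_zero, le_refl, if_true, segEntry]
    · rw [(initStep n L).map_of_ne]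
      · have : ¬ l.val ≤ 0 := fun h => hl (Fin.ext (by simpa using h))
        simp only [fillSeg, if_neg this]
      · rintro ⟨i', s', t'⟩
        change seg 0 i' s' t' ≠ _
        simp [Ne.symm hl]
  | _ => exact (initStep n L).map_of_ne z fun (k : Fin n × Fin (n + 1) × Fin (n + 1))
      (h : seg 0 k.1 k.2.1 k.2.2 = _) => by cases h

theorem map_mulStep (l : Fin L) (z : DickeReg n L → Bool)
    (hz : ∀ l i s t, z (seg l i s t) = false) :
    (mulStep l).map (fillSeg l z) = fillSeg (l + 1) z := by
  funext q
  cases q with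
  | seg l' i s t =>
    by_cases hl : l' = l.succ
    · subst hl
      have h0 : fillSeg l z (seg l.succ i s t) = 0 := by
        simp only [fillSeg, Fin.val_succ]
        rw [if_neg (by omega)]
        exact hz _ _ _ _
      rw [mulStep_map_seg, h0, zero_add]
      simp only [fillSeg, Fin.val_succ, le_refl, if_true, segEntry, Fin.val_castSucc]
    · rw [(mulStep l).map_of_ne]
      · have : l'.val ≤ l.val ↔ l'.val ≤ l.val + 1 := by
          have : l'.val ≠ l.val + 1 := fun h => hl (Fin.ext h)
          omega
        simp only [fillSeg, this]
      · rintro ⟨i', s', t'⟩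
        change seg l.succ i' s' t' ≠ _
        simp [Ne.symm hl]
  | _ => exact (mulStep l).map_of_ne _ fun (k : Fin n × Fin (n + 1) × Fin (n + 1))
      (h : seg l.succ k.1 k.2.1 k.2.2 = _) => by cases h

/-- `mapAll` applies the last step of a list first, so it is the reversed list that fills the levels
from short to long segments. -/
theorem mapAll_segSteps (z : DickeReg n L → Bool) (hz : ∀ l i s t, z (seg l i s t) = false) :
    ∀ (m : ℕ) (h : m ≤ L), QuadStep.mapAll (segSteps n m h).reverse z = fillSeg m z
  | 0, _ => map_initStep z hz
  | m + 1, h => by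
    rw [segSteps, List.reverse_append, QuadStep.mapAll_append,
      mapAll_segSteps z hz m (Nat.le_of_succ_le h)]
    exact map_mulStep ⟨m, h⟩ z hz

/-- The computation of the numbers of preceding ones. -/
def pathSteps (n L : ℕ) : List (QuadStep (DickeReg n L)) :=
  segSteps n L le_rfl ++ ([posStep n L] ++ (segSteps n L le_rfl).reverse)

/-- The assignment `z` after addition of the numbers of preceding ones. -/
def addPath (z : DickeReg n L → Bool) : DickeReg n L → Bool
  | pos i s => z (pos i s) + onPath (fun i s => z (coin i s)) i s
  | q => z q

/-- Compute, copy, uncompute. The matrices depend on the coins only, so adding to `pos` leaves them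
correct and the reverse computation clears them. As `n ≤ 2 ^ L`, the longest segments start at
position zero, where the count is `0`, and their row `0` is the one-hot code. -/
theorem mapAll_pathSteps_of_zero (hL : n ≤ 2 ^ L) (z : DickeReg n L → Bool)
    (hz : ∀ l i s t, z (seg l i s t) = false) :
    QuadStep.mapAll (pathSteps n L) z = addPath z := by
  have hz' : ∀ l i s t, addPath z (seg l i s t) = false := hz
  have key : (posStep n L).map (fillSeg L z) = fillSeg L (addPath z) := by
    funext q
    cases q with
    | pos i s =>
      rw [posStep_map_pos]
      simp only [fillSeg, addPath, Fin.val_last, le_refl, if_true]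
      congr 1
      have h := segEntry_path (fun i s => z (coin i s)) L i s
      have hi : i.val - 2 ^ L = 0 := by omega
      rw [hi] at h
      exact h
    | _ => exact (posStep n L).map_of_ne _ fun (k : Fin n × Fin (n + 1))
        (h : pos k.1 k.2 = _) => by cases h
  rw [pathSteps, QuadStep.mapAll_append, QuadStep.mapAll_append, mapAll_segSteps z hz]
  change QuadStep.mapAll _ ((posStep n L).map (fillSeg L z)) = _
  rw [key, ← mapAll_segSteps _ hz' L le_rfl, QuadStep.mapAll_mapAll_reverse]

/-- The list is a palindrome of involutions. -/
theorem mapAll_pathSteps_pathSteps (z : DickeReg n L → Bool) :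
    QuadStep.mapAll (pathSteps n L) (QuadStep.mapAll (pathSteps n L) z) = z := by
  have h : (pathSteps n L).reverse = pathSteps n L := by
    simp [pathSteps]
  have := QuadStep.mapAll_mapAll_reverse (pathSteps n L) z
  rwa [h] at this

open Classical in
/-- The computation of the numbers of preceding ones, on states in which the auxiliary qubits
are zero. -/
theorem run_pathSteps (hL : n ≤ 2 ^ L) (φ : QState (DickeReg n L))
    (hφ : ∀ z, (¬ ∀ l i s t, z (seg l i s t) = false) → φ z = 0) (z : DickeReg n L → Bool) :
    CubicLayer.run (QuadStep.program (pathSteps n L)) φ z =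
      if ∀ l i s t, z (seg l i s t) = false then φ (addPath z) else 0 := by
  rw [QuadStep.run_program]
  beta_reduce
  split_ifs with hz
  · rw [mapAll_pathSteps_of_zero hL z hz]
  -- An involution that keeps the `seg` qubits zero when they are zero also maps the complement of
  -- such assignments to itself.
  · refine hφ _ fun h => hz ?_
    have := mapAll_pathSteps_of_zero hL _ h
    rw [mapAll_pathSteps_pathSteps] at this
    rw [this]
    exact h

theorem length_segSteps (n : ℕ) {L : ℕ} : ∀ (m : ℕ) (h : m ≤ L),
    (segSteps n m h).length = m + 1
  | 0, _ => rfl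
  | m + 1, h => by rw [segSteps, List.length_append, length_segSteps n m]; rfl

theorem length_pathSteps (n L : ℕ) : (pathSteps n L).length = 2 * L + 3 := by
  rw [pathSteps, List.length_append, List.length_append, List.length_reverse, length_segSteps]
  simp only [List.length_cons, List.length_nil]
  ring

end DickeReg

/-! ### Amplitudes -/

/-- The reflection which maps `|0⟩` to `cos θ |0⟩ + sin θ |1⟩`. -/
noncomputable def reflectionMatrix (θ : ℝ) : Matrix Bool Bool ℂ :=
  Matrix.of fun a b =>
    (if a = b then boolSign a * (Real.cos θ : ℂ) else (Real.sin θ : ℂ))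

/-- The rotation by the angle `θ`. -/
noncomputable def rotationMatrix (θ : ℝ) : Matrix Bool Bool ℂ :=
  Matrix.of fun a b =>
    (if a = b then (Real.cos θ : ℂ) else boolSign b * (Real.sin θ : ℂ))

theorem cos_mul_self_add (θ : ℝ) :
    (Real.cos θ : ℂ) * Real.cos θ + (Real.sin θ : ℂ) * Real.sin θ = 1 := by
  have := Real.cos_sq_add_sin_sq θ
  rw [sq, sq] at this
  exact_mod_cast this

theorem star_reflectionMatrix (θ : ℝ) : star (reflectionMatrix θ) = reflectionMatrix θ := by
  ext a b
  cases a <;> cases b <;>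
    simp [reflectionMatrix, Matrix.star_apply, -Complex.ofReal_cos, -Complex.ofReal_sin]

theorem reflectionMatrix_mul_self (θ : ℝ) : reflectionMatrix θ * reflectionMatrix θ = 1 := by
  have h := cos_mul_self_add θ
  ext a b
  cases a <;> cases b <;>
    simp [reflectionMatrix, Matrix.mul_apply, -Complex.ofReal_cos, -Complex.ofReal_sin]
  all_goals first | linear_combination h | ring

/-- The reflection as a gate. -/
noncomputable def reflectionGate (θ : ℝ) : Matrix.unitaryGroup Bool ℂ :=
  ⟨reflectionMatrix θ, by
    rw [Matrix.mem_unitaryGroup_iff, star_reflectionMatrix, reflectionMatrix_mul_self]⟩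

theorem rotationMatrix_mem (θ : ℝ) : rotationMatrix θ ∈ Matrix.unitaryGroup Bool ℂ := by
  have h := cos_mul_self_add θ
  rw [Matrix.mem_unitaryGroup_iff]
  ext a b
  cases a <;> cases b <;>
    simp [rotationMatrix, Matrix.mul_apply, Matrix.star_apply, -Complex.ofReal_cos,
      -Complex.ofReal_sin]
  all_goals first | linear_combination h | ring

/-- The rotation as a gate. -/
noncomputable def rotationGate (θ : ℝ) : Matrix.unitaryGroup Bool ℂ :=
  ⟨rotationMatrix θ, rotationMatrix_mem θ⟩

/-- By the double-angle formulas, the reflection is the sign gate conjugated by a rotation through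
half the angle. A reflection controlled by a qubit thus becomes a controlled sign between
uncontrolled gates. -/
theorem rotation_conj_sign (θ : ℝ) :
    rotationMatrix (θ / 2) * Matrix.diagonal (fun b => boolSign b) *
      star (rotationMatrix (θ / 2)) = reflectionMatrix θ := by
  have h1 : (Real.cos θ : ℂ) = (Real.cos (θ / 2) : ℂ) * Real.cos (θ / 2) -
      (Real.sin (θ / 2) : ℂ) * Real.sin (θ / 2) := by
    have := Real.cos_add (θ / 2) (θ / 2)
    rw [add_halves] at this
    exact_mod_cast this
  have h2 : (Real.sin θ : ℂ) = 2 * (Real.sin (θ / 2) : ℂ) * Real.cos (θ / 2) := by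
    have := Real.sin_two_mul (θ / 2)
    rw [mul_div_cancel₀ θ two_ne_zero] at this
    exact_mod_cast this
  ext a b
  cases a <;> cases b <;>
    simp [rotationMatrix, reflectionMatrix, Matrix.mul_apply, Matrix.star_apply,
      Matrix.diagonal_apply, h1, h2, -Complex.ofReal_cos, -Complex.ofReal_sin]
  all_goals ring

/-- The amplitude of the outcome `b` of a coin with angle `θ`. -/
noncomputable def coinAmp (θ : ℝ) (b : Bool) : ℂ := reflectionMatrix θ b false

/-- The angle of a coin which is one with probability `j / m`. -/
noncomputable def coinAngle (m j : ℕ) : ℝ := Real.arcsin (Real.sqrt (j / m))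

theorem coinAmp_true {m j : ℕ} (hj : j ≤ m) :
    coinAmp (coinAngle m j) true = (Real.sqrt (j / m) : ℝ) := by
  have h1 : (j / m : ℝ) ≤ 1 := div_le_one_of_le₀ (by exact_mod_cast hj) (by positivity)
  have h2 := Real.sin_arcsin (x := Real.sqrt (j / m)) (by linarith [Real.sqrt_nonneg (j / m : ℝ)])
    (Real.sqrt_le_one.mpr h1)
  change ((Real.sin (Real.arcsin (Real.sqrt (j / m))) : ℝ) : ℂ) = _
  rw [h2]

theorem coinAmp_false (m j : ℕ) :
    coinAmp (coinAngle m j) false = (Real.sqrt (1 - j / m) : ℝ) := by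
  have h2 := Real.cos_arcsin (Real.sqrt (j / m))
  rw [Real.sq_sqrt (by positivity)] at h2
  change (boolSign false : ℂ) * ((Real.cos (Real.arcsin (Real.sqrt (j / m))) : ℝ) : ℂ) = _
  rw [h2, boolSign_false, one_mul]

/-- The number of ones before position `i`. -/
def weightBefore (x : ℕ → Bool) (i : ℕ) : ℕ := ∑ j ∈ Finset.range i, (x j).toNat

theorem weightBefore_succ (x : ℕ → Bool) (i : ℕ) :
    weightBefore x (i + 1) = weightBefore x i + (x i).toNat := Finset.sum_range_succ _ _

theorem weightBefore_succ' (x : ℕ → Bool) (i : ℕ) :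
    weightBefore x (i + 1) = (x 0).toNat + weightBefore (fun j => x (j + 1)) i := by
  rw [weightBefore, Finset.sum_range_succ', add_comm, weightBefore]

theorem weightBefore_le (x : ℕ → Bool) (i : ℕ) : weightBefore x i ≤ i := by
  induction i with
  | zero => simp [weightBefore]
  | succ i ih => rw [weightBefore_succ]; have := Bool.toNat_le (x i); omega

/-- The probabilities of a string of weight `j` multiply to `1 / m.choose j`, if each bit is one
with the proportion of the missing ones among the remaining positions as its probability. -/
theorem prod_coinAmp : ∀ (m j : ℕ), j ≤ m → ∀ x : ℕ → Bool,
    ∏ i ∈ Finset.range m, coinAmp (coinAngle (m - i) (j - weightBefore x i)) (x i) =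
      if weightBefore x m = j then (((Real.sqrt (m.choose j))⁻¹ : ℝ) : ℂ) else 0
  | 0, j, hj, x => by
    obtain rfl : j = 0 := by omega
    simp [weightBefore]
  | m + 1, j, hj, x => by
    rw [Finset.prod_range_succ', weightBefore_succ']
    have hw0 : weightBefore x 0 = 0 := rfl
    simp only [hw0, Nat.sub_zero, weightBefore_succ', Nat.add_sub_add_right]
    have hpos : (0 : ℝ) < ((m + 1 : ℕ) : ℝ) := by positivity
    cases hx : x 0
    · simp only [Bool.toNat_false, zero_add]
      rw [coinAmp_false]
      -- If all positions must be ones, a zero has amplitude zero, and the weight `m + 1` can no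
      -- longer be attained by the remaining `m` bits.
      by_cases hjm : j = m + 1
      · subst hjm
        rw [div_self hpos.ne', sub_self, Real.sqrt_zero, Complex.ofReal_zero, mul_zero, if_neg]
        have := weightBefore_le (fun j => x (j + 1)) m
        omega
      · have hj' : j ≤ m := by omega
        rw [prod_coinAmp m j hj' fun i => x (i + 1)]
        split_ifs with h
        · rw [← Complex.ofReal_mul]
          congr 1
          have hc : ((m + 1).choose j : ℝ) * ((m + 1 : ℕ) - j : ℝ) = (m + 1 : ℕ) * m.choose j := by
            have h2 := Nat.choose_mul_succ_eq m j
            have h3 : ((m + 1 - j : ℕ) : ℝ) = ((m + 1 : ℕ) : ℝ) - j := Nat.cast_sub hj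
            rw [← h3]
            have h4 : (m + 1).choose j * (m + 1 - j) = (m + 1) * m.choose j := by
              rw [← h2]; ring
            exact_mod_cast h4
          have hm : (0 : ℝ) < m.choose j := by exact_mod_cast Nat.choose_pos hj'
          have hM : (0 : ℝ) < (m + 1).choose j := by exact_mod_cast Nat.choose_pos hj
          rw [← Real.sqrt_inv, ← Real.sqrt_inv, ← Real.sqrt_mul (by positivity)]
          congr 1
          field_simp
          linear_combination hc
        · rw [zero_mul]
    · simp only [Bool.toNat_true]
      rw [coinAmp_true hj]
      -- If no one is missing, the amplitude of a one vanishes. Hence the truncation of `j -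
      -- weightBefore x i` is harmless: a string that exceeds the weight has met a zero factor
      -- already.
      cases j with
      | zero =>
        rw [Nat.cast_zero, zero_div, Real.sqrt_zero, Complex.ofReal_zero, mul_zero, if_neg]
        omega
      | succ j =>
        have hsub : ∀ a, j + 1 - (1 + a) = j - a := fun a => by omega
        simp only [hsub]
        rw [prod_coinAmp m j (by omega) fun i => x (i + 1)]
        have hiff : 1 + weightBefore (fun j => x (j + 1)) m = j + 1 ↔
            weightBefore (fun j => x (j + 1)) m = j := by omega
        simp only [hiff]
        split_ifs with h
        · rw [← Complex.ofReal_mul]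
          congr 1
          have hc : ((m + 1 : ℕ) : ℝ) * m.choose j = (m + 1).choose (j + 1) * (j + 1 : ℕ) := by
            exact_mod_cast Nat.add_one_mul_choose_eq m j
          have hm : (0 : ℝ) < m.choose j := by exact_mod_cast Nat.choose_pos (by omega)
          have hM : (0 : ℝ) < (m + 1).choose (j + 1) := by exact_mod_cast Nat.choose_pos hj
          rw [← Real.sqrt_inv, ← Real.sqrt_inv, ← Real.sqrt_mul (by positivity)]
          congr 1
          field_simp
          linear_combination -hc
        · rw [zero_mul]

/-! ### Paths determined by bits, and the amplitudes of the Dicke state. -/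

namespace DickeReg

variable {n L : ℕ}

/-- A string as a sequence. -/
def bitSeq (x : Fin n → Bool) (i : ℕ) : Bool := if h : i < n then x ⟨i, h⟩ else false

theorem path_bits (x : Fin n → Bool) (i : ℕ) (hi : i ≤ n) :
    (path (fun i _ => x i) i).val = weightBefore (bitSeq x) i := by
  induction i with
  | zero => rfl
  | succ i ih =>
    have ih' := ih (by omega)
    have hle := weightBefore_le (bitSeq x) i
    rw [path, weightBefore_succ, dif_pos (by omega : i < n), bitSeq, dif_pos (by omega : i < n)]
    cases hx : x ⟨i, by omega⟩
    · simp [ih']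
    · simp only [if_true, Bool.toNat_true]
      -- The weight before position `i` is at most `i < n`, so addition modulo `n + 1` does not wrap
      -- around.
      rw [Fin.val_add, ih', Fin.val_one']
      rw [Nat.mod_eq_of_lt (a := 1) (by omega), Nat.mod_eq_of_lt (by omega)]

theorem weightBefore_bitSeq (x : Fin n → Bool) :
    weightBefore (bitSeq x) n = (Finset.univ.filter fun i => x i = true).card := by
  rw [weightBefore, Finset.card_filter, ← Fin.sum_univ_eq_sum_range fun j => (bitSeq x j).toNat]
  refine Finset.sum_congr rfl fun i _ => ?_
  simp only [bitSeq, Fin.is_lt, dif_pos]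
  cases x i <;> rfl

/-- The angle of a coin. -/
noncomputable def angle (n k : ℕ) (p : Fin n × Fin (n + 1)) : ℝ :=
  coinAngle (n - p.1.val) (k - p.2.val)

/-- At each position the only nontrivial factor belongs to the actual number of preceding ones, so
the product is that of `prod_coinAmp`. -/
theorem prod_path_coinAmp {k : ℕ} (hk : k ≤ n) (x : Fin n → Bool) :
    ∏ p : Fin n × Fin (n + 1), (if onPath (fun i _ => x i) p.1 p.2 = true
      then coinAmp (angle n k p) (x p.1) else 1) = dickeState n k x := by
  rw [Fintype.prod_prod_type, dickeState, ← weightBefore_bitSeq,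
    ← prod_coinAmp n k hk (bitSeq x), ← Fin.prod_univ_eq_prod_range
      fun i => coinAmp (coinAngle (n - i) (k - weightBefore (bitSeq x) i)) (bitSeq x i)]
  refine Finset.prod_congr rfl fun i _ => ?_
  simp only [onPath, decide_eq_true_eq]
  rw [Finset.prod_ite_eq, if_pos (Finset.mem_univ _), angle, path_bits x i (by omega), bitSeq,
    dif_pos i.2]

/-! ### The preparation of Dicke states -/

/-- Here `S`, `c`, `x` are the final values of `pos`, `coin`, `bit`, and `c + S * x` are the coins
before the erasure. As `S` is one-hot, the sum selects the coin on the path, so the second condition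
on the left says that `c` vanishes there. Then the former coins agree with the bits along the path,
and `path_congr` exchanges one for the other. -/
theorem path_step_iff (x : Fin n → Bool) (S c : Fin n → Fin (n + 1) → Bool) :
    (S = onPath (fun i s => c i s + S i s * x i) ∧
      ∀ i, x i + ∑ s, S i s * (c i s + S i s * x i) = false) ↔
    (S = onPath (fun i _ => x i) ∧ ∀ i s, S i s = true → c i s = false) := by
  have hsum : ∀ d : Fin n → Fin (n + 1) → Bool, S = onPath d → ∀ i,
      ∑ s, S i s * (c i s + S i s * x i) = c i (path d i) + x i := by
    intro d hd i
    rw [Finset.sum_eq_single (path d i)]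
    · have : S i (path d i) = 1 := by rw [hd]; exact decide_eq_true rfl
      rw [this, one_mul, one_mul]
    · intro s _ hs
      have : S i s = 0 := by rw [hd]; exact decide_eq_false (Ne.symm hs)
      rw [this, zero_mul]
    · simp
  have hval : ∀ d : Fin n → Fin (n + 1) → Bool, S = onPath d → ∀ i,
      c i (path d i) + S i (path d i) * x i = c i (path d i) + x i := by
    intro d hd i
    have : S i (path d i) = 1 := by rw [hd]; exact decide_eq_true rfl
    rw [this, one_mul]
  have hzero : ∀ d : Fin n → Fin (n + 1) → Bool, S = onPath d →
      ((∀ i, c i (path d i) = false) ↔ ∀ i s, S i s = true → c i s = false) := by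
    intro d hd
    constructor
    · intro h i s hs
      rw [hd, onPath, decide_eq_true_eq] at hs
      rw [← hs, h]
    · intro h i
      exact h i _ (by rw [hd]; simp [onPath])
  have hadd : ∀ a b : Bool, a + (b + a) = false ↔ b = false := by decide
  constructor
  · rintro ⟨h, h'⟩
    have h0 : ∀ i, c i (path (fun i s => c i s + S i s * x i) i) = false := by
      intro i
      rw [← hadd (x i), ← hsum _ h]
      exact h' i
    refine ⟨?_, (hzero _ h).mp h0⟩
    refine h.trans (funext fun i => funext fun s => ?_)
    rw [onPath, onPath, path_congr _ (fun i _ => x i)]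
    intro i
    rw [hval _ h, h0]
    exact zero_add _
  · rintro ⟨h, h'⟩
    have h0 := (hzero _ h).mpr h'
    refine ⟨?_, fun i => ?_⟩
    · refine h.trans (funext fun i => funext fun s => ?_)
      rw [onPath, onPath, path_congr (fun i _ => x i) (fun i s => c i s + S i s * x i)]
      intro i
      rw [hval _ h, h0]
      exact (zero_add _).symm
    · rw [hsum _ h, hadd, h0]

/-- The condition that the auxiliary qubits `seg` are zero. -/
def SegZero (z : DickeReg n L → Bool) : Prop := ∀ l i s t, z (seg l i s t) = false

/-- The values of the qubits `coin`. -/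
def coins (z : DickeReg n L → Bool) (i : Fin n) (s : Fin (n + 1)) : Bool := z (coin i s)

/-- The values of the qubits `pos`. -/
def poss (z : DickeReg n L → Bool) (i : Fin n) (s : Fin (n + 1)) : Bool := z (pos i s)

/-- The values of the qubits `bit`. -/
def bits (z : DickeReg n L → Bool) (i : Fin n) : Bool := z (bit i)

theorem prod_coin (f : DickeReg n L → ℂ) (hf : ∀ q, (∀ k, coinEmb k ≠ q) → f q = 1) :
    ∏ q, f q = ∏ k : Fin n × Fin (n + 1), f (coin k.1 k.2) := by
  rw [prod_data_mul_prod coinEmb, Finset.prod_eq_one, one_mul]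
  · rfl
  · intro q hq
    exact hf q (by simpa using hq)

/-- The layer which tosses the coins. -/
noncomputable def tossLayer (n k L : ℕ) : CubicLayer (DickeReg n L) :=
  ⟨(controlStep n L).targetGate fun p => reflectionGate (angle n k p), fun _ _ _ => false⟩

/-- The layers which undo the coins which are not used. -/
noncomputable def untossLayers (n k L : ℕ) : List (CubicLayer (DickeReg n L)) :=
  (controlStep n L).sandwich (fun p => star (rotationGate (angle n k p / 2)))
    fun p => reflectionGate (angle n k p) * rotationGate (angle n k p / 2)

theorem tossLayer_gate_coin (n k L : ℕ) (p : Fin n × Fin (n + 1)) :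
    (tossLayer n k L).gate (coin p.1 p.2) = reflectionGate (angle n k p) :=
  (controlStep n L).targetGate_tgt (fun p => reflectionGate (angle n k p)) p

theorem tossLayer_gate_of_ne (n k L : ℕ) {q : DickeReg n L} (hq : ∀ p, coinEmb p ≠ q) :
    (tossLayer n k L).gate q = 1 :=
  (controlStep n L).targetGate_of_ne (fun p => reflectionGate (angle n k p)) hq

open Classical in
theorem run_tossLayer (n k L : ℕ) (z : DickeReg n L → Bool) :
    (tossLayer n k L).apply (zeroState _) z =
      if SegZero z ∧ poss z = (fun _ _ => false) ∧ bits z = (fun _ => false) then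
        ∏ p : Fin n × Fin (n + 1), coinAmp (angle n k p) (coins z p.1 p.2) else 0 := by
  have h0 : cubicSum (tossLayer n k L).cubic z = 0 :=
    Finset.sum_eq_zero fun _ _ => Finset.sum_eq_zero fun _ _ =>
      Finset.sum_eq_zero fun _ _ => zero_mul _
  rw [CubicLayer.apply, h0, boolSign_zero, one_mul, localMap_zeroState]
  split_ifs with h
  · rw [prod_coin]
    · refine Finset.prod_congr rfl fun p _ => ?_
      rw [tossLayer_gate_coin]
      rfl
    · intro q hq
      rw [tossLayer_gate_of_ne n k L hq]
      have : z q = false := by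
        cases q with
        | bit i => exact congrFun h.2.2 i
        | coin i s => exact absurd rfl (hq (i, s))
        | seg l i s t => exact h.1 l i s t
        | pos i s => exact congrFun (congrFun h.2.1 i) s
      rw [this]
      exact Matrix.one_apply_eq _
  · have : ∃ q, (∀ p, coinEmb p ≠ q) ∧ z q ≠ false := by
      by_contra hcon
      push Not at hcon
      refine h ⟨fun l i s t => hcon _ fun p hp => ?_, funext fun i => funext fun s =>
        hcon _ fun p hp => ?_, funext fun i => hcon _ fun p hp => ?_⟩
      all_goals rw [coinEmb_apply] at hp; cases hp
    obtain ⟨q, hq, hz⟩ := this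
    rw [Finset.prod_eq_zero (Finset.mem_univ q)]
    rw [tossLayer_gate_of_ne n k L hq]
    exact Matrix.one_apply_ne hz

open Classical in
/-- The state after all coins have been used. -/
noncomputable def tossedState (n k L : ℕ) : QState (DickeReg n L) := fun z =>
  if SegZero z ∧ poss z = onPath (fun i _ => bits z i) ∧
      ∀ i s, poss z i s = true → coins z i s = false then
    ∏ p : Fin n × Fin (n + 1), (if poss z p.1 p.2 = true then coinAmp (angle n k p) (bits z p.1)
      else coinAmp (angle n k p) (coins z p.1 p.2)) else 0

/-- The amplitude at `z` is that of the tossed coins at the assignment from which `z` arises, and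
`path_step_iff` rewrites the condition that this assignment be admissible. A used coin, now zero,
had the value of its bit. -/
theorem run_toss (hL : n ≤ 2 ^ L) (k : ℕ) :
    CubicLayer.run (QuadStep.program [bitStep n L, clearStep n L])
      (CubicLayer.run (QuadStep.program (pathSteps n L))
        ((tossLayer n k L).apply (zeroState _))) = tossedState n k L := by
  classical
  funext z
  rw [QuadStep.run_program]
  change CubicLayer.run _ _ ((bitStep n L).map ((clearStep n L).map z)) = _
  set z' := (bitStep n L).map ((clearStep n L).map z) with hz'
  have hseg : ∀ l i s t, z' (seg l i s t) = z (seg l i s t) := by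
    intro l i s t
    rw [hz', QuadStep.map_of_ne, QuadStep.map_of_ne]
    · exact fun (p : Fin n × Fin (n + 1)) (h : coin p.1 p.2 = _) => by cases h
    · exact fun (i : Fin n) (h : bit i = _) => by cases h
  have hpos : poss z' = poss z := by
    funext i s
    rw [poss, hz', QuadStep.map_of_ne, QuadStep.map_of_ne]
    · rfl
    · exact fun (p : Fin n × Fin (n + 1)) (h : coin p.1 p.2 = _) => by cases h
    · exact fun (i : Fin n) (h : bit i = _) => by cases h
  have hpos1 : ∀ i s, (clearStep n L).map z (pos i s) = poss z i s := by
    intro i s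
    rw [QuadStep.map_of_ne]
    · rfl
    · exact fun (p : Fin n × Fin (n + 1)) (h : coin p.1 p.2 = _) => by cases h
  have hcoin : coins z' = fun i s => coins z i s + poss z i s * bits z i := by
    funext i s
    rw [coins, hz', QuadStep.map_of_ne, clearStep_map_coin]
    · rfl
    · exact fun (i : Fin n) (h : bit i = _) => by cases h
  have hbit1 : ∀ i, (clearStep n L).map z (bit i) = bits z i := by
    intro i
    rw [QuadStep.map_of_ne]
    · rfl
    · exact fun (p : Fin n × Fin (n + 1)) (h : coin p.1 p.2 = _) => by cases h
  have hbit : bits z' = fun i => bits z i +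
      ∑ s, poss z i s * (coins z i s + poss z i s * bits z i) := by
    funext i
    rw [bits, hz', bitStep_map_bit, hbit1]
    simp only [hpos1, clearStep_map_coin]
    rfl
  rw [run_pathSteps hL]
  · rw [run_tossLayer]
    have e1 : SegZero (addPath z') ↔ SegZero z' := Iff.rfl
    have e2 : poss (addPath z') = fun i s => poss z' i s + onPath (coins z') i s := rfl
    have e3 : bits (addPath z') = bits z' := rfl
    have e4 : coins (addPath z') = coins z' := rfl
    have e5 : SegZero z' ↔ SegZero z := by simp only [SegZero, hseg]
    have e6 : (∀ l i s t, z' (seg l i s t) = false) ↔ SegZero z := e5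
    have hxor : ∀ a b : Bool, a + b = false ↔ a = b := by decide
    have e7 : (poss (addPath z') = fun _ _ => false) ∧ (bits (addPath z') = fun _ => false) ↔
        poss z = onPath (fun i _ => bits z i) ∧ ∀ i s, poss z i s = true → coins z i s = false := by
      rw [← path_step_iff, e2, e3, hpos, hcoin, hbit]
      simp only [funext_iff, hxor]
    rw [tossedState]
    simp only [e1, e5, e6, e7, e4]
    by_cases hs : SegZero z
    · simp only [hs, true_and, if_true]
      split_ifs with h
      · refine Finset.prod_congr rfl fun p _ => ?_
        rw [hcoin]
        split_ifs with hp
        · simp only [hp, h.2 _ _ hp]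
          congr 1
          exact (zero_add _).trans (one_mul _)
        · have : poss z p.1 p.2 = 0 := eq_false_of_ne_true hp
          simp only [this, zero_mul, add_zero]
      · rfl
    · simp only [hs, false_and, if_false]
  · intro z hz
    rw [run_tossLayer, if_neg fun h => hz h.1]

-- Between its two outer gates a coin undergoes the sign gate if `pos` is one and the identity
-- otherwise. In total it undergoes the squared reflection, which is the identity, if it was used,
-- and a single reflection if it was not. The latter undoes its toss, so all coins end in zero and
-- only the amplitudes of used coins remain.
open Classical in
theorem run_untossLayers (n k L : ℕ) (x : DickeReg n L → Bool) :
    CubicLayer.run (untossLayers n k L) (tossedState n k L) x =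
      if SegZero x ∧ poss x = onPath (fun i _ => bits x i) ∧ coins x = (fun _ _ => false) then
        ∏ p : Fin n × Fin (n + 1), (if poss x p.1 p.2 = true
          then coinAmp (angle n k p) (bits x p.1) else 1) else 0 := by
  let W : DickeReg n L → Matrix Bool Bool ℂ
    | coin i s => if poss x i s = true then 1 else reflectionMatrix (angle n k (i, s))
    | _ => 1
  have hWne : ∀ q, (∀ p, coinEmb p ≠ q) → W q = 1 := by
    intro q hq
    cases q with
    | coin i s => exact absurd rfl (hq (i, s))
    | _ => rfl
  rw [untossLayers, QuadStep.run_sandwich _ _ _ _ _ W]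
  rotate_left
  · intro (p : Fin n × Fin (n + 1))
    refine Eq.trans ?_ (congrArg (fun c => reflectionMatrix (angle n k p) *
      rotationMatrix (angle n k p / 2) * Matrix.diagonal (fun b => boolSign (b * c)) *
      star (rotationMatrix (angle n k p / 2))) (controlStep_poly x p).symm)
    change (if poss x p.1 p.2 = true then 1 else reflectionMatrix (angle n k p)) =
      reflectionMatrix (angle n k p) * rotationMatrix (angle n k p / 2) *
        Matrix.diagonal (fun b => boolSign (b * poss x p.1 p.2)) *
        star (rotationMatrix (angle n k p / 2))
    cases poss x p.1 p.2
    · have : (fun b : Bool => boolSign (b * false)) = fun _ => 1 := by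
        funext b; cases b <;> rfl
      rw [this, Matrix.diagonal_one, mul_one, mul_assoc,
        Matrix.mem_unitaryGroup_iff.mp (rotationMatrix_mem _), mul_one]
      rfl
    · have : (fun b : Bool => boolSign (b * true)) = fun b => boolSign b := by
        funext b; cases b <;> rfl
      rw [this, mul_assoc, mul_assoc, ← mul_assoc (rotationMatrix _), rotation_conj_sign,
        reflectionMatrix_mul_self]
      rfl
  · exact hWne
  -- With all registers but the coins fixed at `x`, the tossed state is a product over the coins
  -- with factors `K`.
  let K : DickeReg n L → Bool → ℂ
    | coin i s => fun b => if poss x i s = true then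
        (if b = false then coinAmp (angle n k (i, s)) (bits x i) else 0)
        else coinAmp (angle n k (i, s)) b
    | _ => fun _ => 1
  have hKne : ∀ q, (∀ p, coinEmb p ≠ q) → K q = fun _ => 1 := by
    intro q hq
    cases q with
    | coin i s => exact absurd rfl (hq (i, s))
    | _ => rfl
  have hsingle : ∀ p : Fin n × Fin (n + 1), ∑ b, W (coin p.1 p.2) (x (coin p.1 p.2)) b *
      K (coin p.1 p.2) b = if coins x p.1 p.2 = false then
        (if poss x p.1 p.2 = true then coinAmp (angle n k p) (bits x p.1) else 1) else 0 := by
    intro p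
    simp only [W, K, coins]
    by_cases hp : poss x p.1 p.2 = true
    · simp only [hp, if_true]
      cases x (coin p.1 p.2) <;> simp
    · simp only [hp]
      -- For an unused coin, `K` is the column `false` of the reflection, so the sum is an entry of
      -- its square.
      have h := congrFun (congrFun (reflectionMatrix_mul_self (angle n k p))
        (x (coin p.1 p.2))) false
      rw [Matrix.mul_apply] at h
      refine h.trans ?_
      cases x (coin p.1 p.2) <;> simp
  have hagree : ∀ y : DickeReg n L → Bool,
      (∀ q ∉ Finset.univ.map coinEmb, y q = x q) →
      tossedState n k L y = (if SegZero x ∧ poss x = onPath (fun i _ => bits x i) then 1 else 0) *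
        ∏ q, K q (y q) := by
    intro y hy
    have hy' : ∀ q, (∀ p, coinEmb p ≠ q) → y q = x q := fun q hq => hy q (by simpa using hq)
    have e1 : SegZero y ↔ SegZero x := by
      refine forall_congr' fun l => forall_congr' fun i => forall_congr' fun s =>
        forall_congr' fun t => ?_
      rw [hy' _ fun p hp => by rw [coinEmb_apply] at hp; cases hp]
    have e2 : poss y = poss x := funext fun i => funext fun s =>
      hy' _ fun p hp => by rw [coinEmb_apply] at hp; cases hp
    have e3 : bits y = bits x := funext fun i =>
      hy' _ fun p hp => by rw [coinEmb_apply] at hp; cases hp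
    rw [prod_coin _ fun q hq => by rw [hKne q hq], tossedState]
    simp only [e1, e2, e3, ← and_assoc]
    by_cases hx : SegZero x ∧ poss x = onPath (fun i _ => bits x i)
    · simp only [hx, true_and, and_self, if_true, one_mul]
      split_ifs with h
      · refine Finset.prod_congr rfl fun p _ => ?_
        simp only [K]
        by_cases hp : poss x p.1 p.2 = true
        · rw [← hx.2, if_pos hp, if_pos hp]
          exact (if_pos (h p.1 p.2 (by rw [← hx.2]; exact hp))).symm
        · rw [← hx.2, if_neg hp, if_neg hp]
          rfl
      · push Not at h
        obtain ⟨i, s, hp, hc⟩ := h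
        symm
        refine Finset.prod_eq_zero (Finset.mem_univ (i, s)) ?_
        simp only [K]
        rw [hx.2, if_pos hp]
        exact if_neg hc
    · simp only [hx, false_and, if_false, zero_mul]
  rw [localMap_congr_of_agree (Finset.univ.map coinEmb) W
    (fun q hq => hWne q (by simpa using hq)) _
    ((if SegZero x ∧ poss x = onPath (fun i _ => bits x i) then (1 : ℂ) else 0) •
      fun y => ∏ q, K q (y q)) x hagree, localMap_smul, Pi.smul_apply, localMap_prod,
    prod_coin _ fun q hq => by
      rw [hWne q hq, hKne q hq]
      cases x q <;> simp,
    Finset.prod_congr rfl fun p _ => hsingle p]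
  by_cases hx : SegZero x ∧ poss x = onPath (fun i _ => bits x i)
  · rw [if_pos hx, one_smul]
    by_cases hc : coins x = fun _ _ => false
    · rw [if_pos ⟨hx.1, hx.2, hc⟩]
      refine Finset.prod_congr rfl fun p _ => ?_
      rw [if_pos (congrFun (congrFun hc p.1) p.2)]
    · rw [if_neg fun h => hc h.2.2]
      have : ∃ i s, coins x i s ≠ false := by
        by_contra hcon
        push Not at hcon
        exact hc (funext fun i => funext fun s => hcon i s)
      obtain ⟨i, s, h⟩ := this
      exact Finset.prod_eq_zero (Finset.mem_univ (i, s)) (if_neg h)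
  · rw [if_neg hx, zero_smul, if_neg fun h => hx ⟨h.1, h.2.1⟩]

/-- The layers which prepare the Dicke state. -/
noncomputable def dickeLayers (n k L : ℕ) : List (CubicLayer (DickeReg n L)) :=
  [tossLayer n k L] ++ QuadStep.program (pathSteps n L) ++
    QuadStep.program [bitStep n L, clearStep n L] ++ untossLayers n k L ++
    QuadStep.program [copyStep n L] ++ QuadStep.program (pathSteps n L) ++
    QuadStep.program [copyStep n L]

theorem length_dickeLayers (n k L : ℕ) : (dickeLayers n k L).length = 8 * L + 23 := by
  simp only [dickeLayers, List.length_append, QuadStep.length_program, length_pathSteps,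
    untossLayers, QuadStep.sandwich, List.length_cons, List.length_nil]
  ring

/-- Once the coins are zero, `copyStep` puts bit `i` into `coin i s` for every `s`. The path of
these coins is the path of the bits, already stored in `pos`, so adding it again clears `pos`, and a
second `copyStep` clears the coins. -/
theorem run_dickeLayers (hL : n ≤ 2 ^ L) {k : ℕ} (hk : k ≤ n) :
    CubicLayer.run (dickeLayers n k L) (zeroState _) = withAncillas bitEmb (dickeState n k) := by
  classical
  funext z
  simp only [dickeLayers, CubicLayer.run_append]
  change CubicLayer.run _ (CubicLayer.run _ (CubicLayer.run _ (CubicLayer.run _ (CubicLayer.run _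
    (CubicLayer.run _ ((tossLayer n k L).apply (zeroState _))))))) z = _
  rw [run_toss hL]
  simp only [QuadStep.run_program [copyStep n L]]
  change CubicLayer.run _ (fun y => CubicLayer.run _ _ ((copyStep n L).map y))
    ((copyStep n L).map z) = _
  have hne : ∀ (y : DickeReg n L → Bool) q, (∀ p, coinEmb p ≠ q) → (copyStep n L).map y q = y q :=
    fun y q hq => QuadStep.map_of_ne _ _ hq
  have hseg : ∀ y : DickeReg n L → Bool, SegZero ((copyStep n L).map y) ↔ SegZero y := by
    intro y
    refine forall_congr' fun l => forall_congr' fun i => forall_congr' fun s =>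
      forall_congr' fun t => ?_
    rw [hne _ _ fun p hp => by rw [coinEmb_apply] at hp; cases hp]
  have hpos : ∀ y : DickeReg n L → Bool, poss ((copyStep n L).map y) = poss y := fun y =>
    funext fun i => funext fun s => hne _ _ fun p hp => by rw [coinEmb_apply] at hp; cases hp
  have hbit : ∀ y : DickeReg n L → Bool, bits ((copyStep n L).map y) = bits y := fun y =>
    funext fun i => hne _ _ fun p hp => by rw [coinEmb_apply] at hp; cases hp
  have hcoin : ∀ y : DickeReg n L → Bool, coins ((copyStep n L).map y) =
      fun i s => coins y i s + bits y i := fun y =>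
    funext fun i => funext fun s => copyStep_map_coin y i s
  rw [run_pathSteps hL]
  · set y := (copyStep n L).map z with hy
    have e1 : SegZero (addPath y) ↔ SegZero y := Iff.rfl
    have e2 : poss (addPath y) = fun i s => poss y i s + onPath (coins y) i s := rfl
    have e3 : bits (addPath y) = bits y := rfl
    have e4 : coins (addPath y) = coins y := rfl
    have e5 : (∀ l i s t, y (seg l i s t) = false) ↔ SegZero z := hseg z
    have hxx : ∀ a b : Bool, a + b + b = a := by decide
    rw [run_untossLayers]
    simp only [hseg, hpos, hbit, hcoin, e1, e2, e3, e4, e5]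
    rw [hy, hpos, hbit, hcoin, hseg]
    simp only [hxx]
    have hrange : (∀ q, q ∉ Set.range (bitEmb (n := n) (L := L)) → z q = false) ↔
        SegZero z ∧ poss z = (fun _ _ => false) ∧ coins z = (fun _ _ => false) := by
      constructor
      · intro h
        refine ⟨fun l i s t => h _ ?_, funext fun i => funext fun s => h _ ?_,
          funext fun i => funext fun s => h _ ?_⟩
        all_goals
          rintro ⟨j, hj⟩
          rw [bitEmb_apply] at hj
          cases hj
      · rintro ⟨h1, h2, h3⟩ q hq
        cases q with
        | bit i => exact absurd ⟨i, rfl⟩ hq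
        | coin i s => exact congrFun (congrFun h3 i) s
        | seg l i s t => exact h1 l i s t
        | pos i s => exact congrFun (congrFun h2 i) s
    rw [withAncillas]
    simp only [hrange]
    by_cases hs : SegZero z
    · by_cases hc : coins z = fun _ _ => false
      · have hc' : (fun i s => coins z i s + bits z i) = fun i _ => bits z i := by
          funext i s
          rw [hc]
          exact zero_add _
        have hiff : ((fun i s => poss z i s + onPath (fun i _ => bits z i) i s) =
            onPath fun i _ => bits z i) ↔ poss z = fun _ _ => false := by
          simp only [funext_iff]
          exact forall_congr' fun i => forall_congr' fun s => add_eq_right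
        rw [hc']
        have hc2 : (fun i s => coins z i s) = fun _ _ => false := hc
        simp only [hs, hc, hiff, true_and, and_true, if_true]
        split_ifs with hp
        · rw [hp]
          have hf : ∀ b : Bool, false + b = b := by decide
          simp only [hf]
          exact prod_path_coinAmp hk (bits z)
        · rfl
      · have hc2 : ¬ (fun i s => coins z i s) = fun _ _ => false := hc
        simp [hc]
    · simp [hs]
  · intro y hy
    rw [run_untossLayers, if_neg]
    exact fun h => hy ((hseg y).mp h.1)

end DickeReg

/-! ### Resource bounds -/

/-- The depth of the segment doubling for strings of length `n`. -/
def doublingDepth (n : ℕ) : ℕ := Nat.log 2 n + 1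

theorem le_two_pow_doublingDepth (n : ℕ) : n ≤ 2 ^ doublingDepth n :=
  (Nat.lt_pow_succ_log_self one_lt_two n).le

theorem DickeReg.card_le {n : ℕ} (hn : 1 ≤ n) :
    Fintype.card (DickeReg n (doublingDepth n)) ≤ 4 * (n + 1) ^ 4 := by
  have hlog : doublingDepth n + 1 ≤ n + 1 := by
    have := Nat.log_lt_self 2 (by omega : n ≠ 0)
    rw [doublingDepth]
    omega
  rw [DickeReg.card_eq]
  calc n + (n * (n + 1) + ((doublingDepth n + 1) * (n * ((n + 1) * (n + 1))) + n * (n + 1)))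
      ≤ (n + 1) ^ 4 + ((n + 1) ^ 4 + ((n + 1) ^ 4 + (n + 1) ^ 4)) := by
        have h1 : n + 1 ≤ (n + 1) ^ 4 := Nat.le_self_pow (by norm_num) _
        have h2 : (n + 1) ^ 2 ≤ (n + 1) ^ 4 := Nat.pow_le_pow_right (by omega) (by norm_num)
        have h3 : (doublingDepth n + 1) * (n * ((n + 1) * (n + 1))) ≤
            (n + 1) * ((n + 1) * ((n + 1) * (n + 1))) := by gcongr; omega
        have h4 : (n + 1) * ((n + 1) * ((n + 1) * (n + 1))) = (n + 1) ^ 4 := by ring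
        have h5 : n * (n + 1) ≤ (n + 1) ^ 2 := by nlinarith
        omega
    _ = 4 * (n + 1) ^ 4 := by ring

/-- The number of qubits, up to which circuits for strings of length `n` suffice. -/
def qubitBound (n : ℕ) : ℕ := 12288 * (n + 1) ^ 16

theorem DickeReg.qubits_le {n : ℕ} (hn : 1 ≤ n) :
    48 * Fintype.card (DickeReg n (doublingDepth n)) ^ 4 ≤ qubitBound n :=
  calc 48 * Fintype.card (DickeReg n (doublingDepth n)) ^ 4
      ≤ 48 * (4 * (n + 1) ^ 4) ^ 4 := by gcongr; exact DickeReg.card_le hn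
    _ = qubitBound n := by rw [qubitBound]; ring

theorem clog_qubitBound_le (n : ℕ) : Nat.clog 2 (qubitBound n) ≤ 16 * Nat.log 2 n + 30 := by
  apply Nat.clog_le_of_le_pow
  -- The additive constant `30` is `14 + 16`, because `12288 ≤ 2 ^ 14`.
  calc 12288 * (n + 1) ^ 16 ≤ 2 ^ 14 * (2 ^ (Nat.log 2 n + 1)) ^ 16 := by
        gcongr
        · norm_num
        · exact Nat.lt_pow_succ_log_self one_lt_two n
    _ = 2 ^ (16 * Nat.log 2 n + 30) := by
        rw [← pow_mul, ← pow_add]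
        congr 1
        ring

open Filter in
theorem isBigO_log_affine (a b : ℕ) :
    (fun m : ℕ => ((a * Nat.log 2 m + b : ℕ) : ℝ)) =O[atTop] fun m : ℕ => Real.log m := by
  have h2 : 0 < Real.log 2 := Real.log_pos one_lt_two
  refine Asymptotics.IsBigO.of_bound ((a + b : ℕ) / Real.log 2) ?_
  filter_upwards [eventually_ge_atTop 2] with m hm
  have hm' : (2 : ℝ) ≤ m := by exact_mod_cast hm
  have h1 : Real.log 2 ≤ Real.log m := Real.log_le_log two_pos hm'
  have h3 : (Nat.log 2 m : ℝ) * Real.log 2 ≤ Real.log m := by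
    rw [← Real.log_pow]
    refine Real.log_le_log (by positivity) ?_
    exact_mod_cast Nat.pow_log_le_self 2 (by omega : m ≠ 0)
  rw [Real.norm_of_nonneg (Nat.cast_nonneg _), Real.norm_of_nonneg (h2.le.trans h1),
    div_mul_eq_mul_div, le_div_iff₀ h2]
  push_cast
  have ha : (a : ℝ) * (Nat.log 2 m * Real.log 2) ≤ a * Real.log m := by gcongr
  have hb : (b : ℝ) * Real.log 2 ≤ b * Real.log m := by gcongr
  linarith

theorem exists_dickeCircuit {n k : ℕ} (hk : 1 ≤ k) (hkn : k ≤ n) :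
    ∃ C : LAQCircuit, C.numQubits ≤ qubitBound n ∧
      C.alternations.length ≤ 24 * Nat.log 2 n + 93 ∧
      (∀ A ∈ C.alternations, A.quantum.length ≤ 10 ∧
        A.conventional.depth ≤ 48 * Nat.log 2 n + 91 ∧
        A.conventional.size ≤ 12 * qubitBound n ^ 2) ∧
      Prepares C.alternations (dickeState n k) := by
  have hn : 1 ≤ n := hk.trans hkn
  have hq := DickeReg.qubits_le hn
  have : Nonempty (DickeReg n (doublingDepth n)) := ⟨.bit ⟨0, hn⟩⟩
  obtain ⟨C, hC, hlen, hA, hprep⟩ :=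
    exists_laqCircuit (DickeReg n (doublingDepth n)) (DickeReg.dickeLayers n k (doublingDepth n))
  refine ⟨C, hC.trans_le hq, ?_, fun A h => ⟨(hA A h).1, ?_, ?_⟩, hprep _ _
    (DickeReg.run_dickeLayers (le_two_pow_doublingDepth n) hkn)⟩
  -- Three alternations for each of `8 * L + 23` layers with `L = Nat.log 2 n + 1`.
  · rw [hlen, DickeReg.length_dickeLayers, doublingDepth]
    omega
  -- The depth is at most `3 * (16 * Nat.log 2 n + 30) + 1`.
  · have h1 := (hA A h).2.1
    have h2 := (Nat.clog_mono_right 2 hq).trans (clog_qubitBound_le n)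
    omega
  · refine (hA A h).2.2.trans ?_
    gcongr

theorem theorem7p5p1 :
    ∃ C : {p : ℕ × ℕ // 1 ≤ p.2 ∧ p.2 ≤ p.1} → LAQCircuit,
      IsLAQCCLOG (fun i => i.1.1) C ∧
      (∃ q : Polynomial ℕ, ∀ i, (C i).numQubits ≤ q.eval i.1.1) ∧
      ∀ i, Prepares (C i).alternations (dickeState i.1.1 i.1.2) := by
  choose C hqubits hlen hA hprep using
    fun i : {p : ℕ × ℕ // 1 ≤ p.2 ∧ p.2 ≤ p.1} => exists_dickeCircuit i.2.1 i.2.2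
  let q : Polynomial ℕ := 12288 * (Polynomial.X + 1) ^ 16
  have hq : ∀ n, q.eval n = qubitBound n := fun n => by simp [q, qubitBound]
  refine ⟨C, ⟨⟨10, fun i A h => (hA i A h).1⟩, ⟨fun n => 48 * Nat.log 2 n + 91, 12 * q ^ 2,
    isBigO_log_affine 48 91, fun i A h => ⟨(hA i A h).2.1, ?_⟩⟩,
    ⟨fun n => 24 * Nat.log 2 n + 93, isBigO_log_affine 24 93, hlen⟩⟩,
    ⟨q, fun i => (hqubits i).trans_eq (hq _).symm⟩, hprep⟩
  refine (hA i A h).2.2.trans_eq ?_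
  rw [← hq]
  simp
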